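/- Let $k$ be a field of characteristic $0$, $\mathrm{Vec}$ the category of $k$-vector spaces, $G$ a finite abelian group (written additively) and $\chi : G\times G\to k^\times$ a bicharacter such that $\omega(x,y)=\chi(x,y)\chi(y,x)$ is non-degenerate, i.e. $\omega(x,-)=1$ only for $x=0$. Let $\mathcal B=(\mathrm{Vec}_G,\chi)$ be the category of $G$-graded vector spaces with the usual tensor product and the braiding $\tau(v\otimes w)=\chi(x,y)\,w\otimes v$ for $v$ of degree $x$, $w$ of degree $y$, and put $\theta(g)=\chi(g,g)$. Definitions. (1) $HH(\mathcal B)$ is the category of graded spaces $M$ with isomorphisms $\tau_{x,y}:M_{y+x}\to M_{x+y}$ ($x,y\in G$) with $\tau_{0,g}=\mathrm{id}$ and $\tau_{x,y+z}\tau_{y,z+x}=\tau_{x+y,z}$; morphisms are the graded linear maps commuting with all $\tau_{x,y}$. Write $a\cdot m=\tau_{a,g-a}(m)$ for $m\in M_g$. The automorphism $\varsigma$ of the identity functor is $\tau_{g,0}$ on $M_g$. The annuli-stacking product of $M$ and $N$ is the quotient of $M\otimes N$ by the relations $\chi(y,a)^{-1}(a\cdot m)\otimes n=\chi(a,x)\,m\otimes(a\cdot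 n)$ ($m\in M_x$, $n\in N_y$, $a\in G$), on which $a$ acts by the common value; the unit is $k[G]$ in degree $0$. $HC(\mathcal B)$ is the full monoidal subcategory of the objects with $\varsigma_M=\mathrm{id}$. (2) $M_n(\mathrm{Vec})$ is the monoidal category of $n\times n$ matrices of vector spaces, with $(A\otimes B)_{ij}=\bigoplus_l A_{il}\otimes B_{lj}$. (3) A twist on $\mathcal B$ is $t\in\mathrm{Aut}(\mathrm{Id}_{\mathcal B})$ with $t_{X\otimes Y}=\tau_{Y,X}\tau_{X,Y}(t_X\otimes t_Y)$; it acts in degree $g$ by a scalar $t(g)$. (4) For a twist $t$, the left $HH(\mathcal B)$-module category $\mathcal B_t$ is $\mathrm{Vec}_G$, where $M\in HH(\mathcal B)$ acts on $V$ by the underlying graded space of the annuli-stacking product $M\otimes J_t(V)$; here $J_t(V)$ is $V$ with $a\in G$ acting on $V_y$ by $t(a)\theta(a)^{-1}\chi(a,y)$. The $HC(\mathcal B)$-module category $\mathcal B_t^t\subset\mathcal B_t$ consists of the $V$ with $t_V=\mathrm{id}$. (5) Twists $t,t'$ yield the same theory if there are a $k$-linear equivalence $\mathcal B_t\simeq\mathcal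 B_{t'}$ of $HH(\mathcal B)$-module categories that carries $t$ to $t'$, and a $k$-linear equivalence $\mathcal B_t^t\simeq\mathcal B_{t'}^{t'}$ of $HC(\mathcal B)$-module categories. Then there are $k$-linear equivalences of monoidal categories $$HH(\mathcal B)\simeq M_{|G|}(\mathrm{Vec}),\qquad HC(\mathcal B)\simeq\bigoplus_{i\in\theta(G)}M_{n_i}(\mathrm{Vec}),\qquad n_i=\#\{x\in G:\theta(x)=i\},$$ where the direct sum is the product of the finitely many categories with the componentwise tensor product. Every twist on $\mathcal B$ is of the form $\theta_x=\theta\cdot\omega(x,-)$ for some $x\in G$ (that is, $\theta_x$ acts by $\theta(g)\omega(x,g)$ in degree $g$; each $\theta_x$ is a twist and $\theta_0=\theta$), and $\theta_x$ and $\theta_y$ yield the same theory whenever $\theta(x)=\theta(y)$. -/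

import Mathlib

open CategoryTheory MonoidalCategory

universe u

set_option linter.unusedSectionVars false
set_option linter.unusedVariables false

noncomputable section

namespace BraidedVec

/-- The category `Vec_G` of `G`-graded vector spaces over `k`. -/
abbrev GVec (k : Type u) [Field k] (G : Type u) : Type (u+1) := GradedObject G (ModuleCat.{u} k)

variable {k : Type u} [Field k] {G : Type u} [AddCommGroup G]

/-- The usual tensor product, `(X ⊗ Y)_g = ⨁_{x + y = g} X_x ⊗ Y_y`, with the trivial associator. -/
instance gvecMonoidal : MonoidalCategory (GVec k G) :=
  letI : DecidableEq G := Classical.decEq G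
  GradedObject.monoidalCategory

/-- The pairing `X_x × Y_y → (X ⊗ Y)_g`, `(m, n) ↦ m ⊗ n`, for `x + y = g`. -/
def tmk (X Y : GVec k G) {x y g : G} (h : x + y = g) : X x →ₗ[k] Y y →ₗ[k] (X ⊗ Y : GVec k G) g :=
  TensorProduct.curry (GradedObject.Monoidal.ιTensorObj X Y x y g h).hom

theorem tmk_apply (X Y : GVec k G) {x y g : G} (h : x + y = g) (m : X x) (n : Y y) :
  tmk X Y h m n = (GradedObject.Monoidal.ιTensorObj X Y x y g h).hom (m ⊗ₜ n) := rfl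

/-- The linear map out of `(X ⊗ Y)_g` given by bilinear maps on `X_x × Y_y`, `x + y = g`. -/
def tlift {X Y : GVec k G} {g : G} {T : Type u} [AddCommGroup T] [Module k T]
    (φ : ∀ x y : G, x + y = g → (X x →ₗ[k] Y y →ₗ[k] T)) : (X ⊗ Y : GVec k G) g →ₗ[k] T :=
  (GradedObject.Monoidal.tensorObjDesc (X₁ := X) (X₂ := Y) (A := ModuleCat.of k T)
    (fun x y h => ModuleCat.ofHom (TensorProduct.lift (φ x y h)))).hom

theorem tlift_tmk {X Y : GVec k G} {g : G} {T : Type u} [AddCommGroup T] [Module k T]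
    (φ : ∀ x y : G, x + y = g → (X x →ₗ[k] Y y →ₗ[k] T)) {x y : G} (h : x + y = g) (m : X x) (n : Y y) :
    tlift φ (tmk X Y h m n) = φ x y h m n := by
  have := GradedObject.Monoidal.ι_tensorObjDesc (X₁ := X) (X₂ := Y) (A := ModuleCat.of k T)
    (fun x y h => ModuleCat.ofHom (TensorProduct.lift (φ x y h))) x y h
  have := congrArg (fun f => f.hom (m ⊗ₜ[k] n)) this
  exact this

theorem thom_ext {X Y : GVec k G} {g : G} {T : Type u} [AddCommGroup T] [Module k T]
    {f f' : (X ⊗ Y : GVec k G) g →ₗ[k] T}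
    (hf : ∀ (x y : G) (h : x + y = g) (m : X x) (n : Y y), f (tmk X Y h m n) = f' (tmk X Y h m n)) :
    f = f' := by
  have := GradedObject.Monoidal.tensorObj_ext (X₁ := X) (X₂ := Y) (A := ModuleCat.of k T)
    (ModuleCat.ofHom f) (ModuleCat.ofHom f') ?_
  · exact congrArg ModuleCat.Hom.hom this
  · intro x y h
    apply ModuleCat.hom_ext
    apply TensorProduct.ext'
    intro m n
    exact hf x y h m n

theorem tensorHom_tmk {X X' Y Y' : GVec k G} (f : X ⟶ X') (f' : Y ⟶ Y') {x y g : G} (h : x + y = g)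
    (m : X x) (n : Y y) :
    ((f ⊗ₘ f') g).hom (tmk X Y h m n) = tmk X' Y' h ((f x).hom m) ((f' y).hom n) := by
  have := GradedObject.Monoidal.ι_tensorHom f f' x y g h
  exact congrArg (fun f => f.hom (m ⊗ₜ[k] n)) this

theorem whiskerRight_tmk {X X' : GVec k G} (f : X ⟶ X') (Y : GVec k G) {x y g : G} (h : x + y = g)
    (m : X x) (n : Y y) :
    ((f ▷ Y) g).hom (tmk X Y h m n) = tmk X' Y h ((f x).hom m) n :=
  (tensorHom_tmk f (𝟙 Y) h m n)

theorem whiskerLeft_tmk (X : GVec k G) {Y Y' : GVec k G} (f : Y ⟶ Y') {x y g : G} (h : x + y = g)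
    (m : X x) (n : Y y) :
    ((X ◁ f) g).hom (tmk X Y h m n) = tmk X Y' h m ((f y).hom n) :=
  (tensorHom_tmk (𝟙 X) f h m n)

theorem associator_tmk (X Y Z : GVec k G) {x y z u v g : G} (hu : x + y = u) (hv : y + z = v)
   (hg : u + z = g) (hg' : x + v = g) (a : X x) (b : Y y) (c : Z z) :
   ((α_ X Y Z).hom g).hom (tmk (X ⊗ Y) Z hg (tmk X Y hu a b) c) =
    tmk X (Y ⊗ Z) hg' a (tmk Y Z hv b c) := by
  subst hu hv
  have := GradedObject.Monoidal.ιTensorObj₃'_associator_hom (X₁ := X) (X₂ := Y) (X₃ := Z) x y z g hg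
  exact congrArg (fun f => f.hom ((a ⊗ₜ[k] b) ⊗ₜ[k] c)) this

theorem associator_inv_tmk (X Y Z : GVec k G) {x y z u v g : G} (hu : x + y = u) (hv : y + z = v)
   (hg : u + z = g) (hg' : x + v = g) (a : X x) (b : Y y) (c : Z z) :
   ((α_ X Y Z).inv g).hom (tmk X (Y ⊗ Z) hg' a (tmk Y Z hv b c)) =
    (tmk (X ⊗ Y) Z hg (tmk X Y hu a b) c) := by
  rw [← associator_tmk X Y Z hu hv hg hg']
  have : (α_ X Y Z).hom g ≫ (α_ X Y Z).inv g = 𝟙 _ := congrFun (α_ X Y Z).hom_inv_id g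
  exact congrArg (fun f => f.hom (tmk (X ⊗ Y) Z hg (tmk X Y hu a b) c)) this


attribute [irreducible] tmk tlift

theorem thom_ext3 {X Y Z : GVec k G} {g : G} {T : Type u} [AddCommGroup T] [Module k T]
    {f f' : (X ⊗ (Y ⊗ Z) : GVec k G) g →ₗ[k] T}
    (hf : ∀ (x v : G) (h : x + v = g) (y z : G) (h' : y + z = v) (a : X x) (b : Y y) (c : Z z),
      f (tmk X (Y ⊗ Z) h a (tmk Y Z h' b c)) = f' (tmk X (Y ⊗ Z) h a (tmk Y Z h' b c))) :
    f = f' := by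
  apply thom_ext
  intro x v h a n
  have : f ∘ₗ (tmk X (Y ⊗ Z) h a) = f' ∘ₗ (tmk X (Y ⊗ Z) h a) :=
    thom_ext fun y z h' b c => hf x v h y z h' a b c
  exact LinearMap.congr_fun this n

theorem thom_ext3' {X Y Z : GVec k G} {g : G} {T : Type u} [AddCommGroup T] [Module k T]
    {f f' : ((X ⊗ Y) ⊗ Z : GVec k G) g →ₗ[k] T}
    (hf : ∀ (v z : G) (h : v + z = g) (x y : G) (h' : x + y = v) (a : X x) (b : Y y) (c : Z z),
      f (tmk (X ⊗ Y) Z h (tmk X Y h' a b) c) = f' (tmk (X ⊗ Y) Z h (tmk X Y h' a b) c)) :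
    f = f' := by
  apply thom_ext
  intro v z h n c
  have : f ∘ₗ ((tmk (X ⊗ Y) Z h).flip c) = f' ∘ₗ ((tmk (X ⊗ Y) Z h).flip c) :=
    thom_ext fun x y h' a b => hf v z h x y h' a b c
  exact LinearMap.congr_fun this n

theorem gvec_hom_ext {X Y : GVec k G} {f f' : X ⟶ Y} (h : ∀ g, (f g).hom = (f' g).hom) : f = f' := by
  funext g
  exact ModuleCat.hom_ext (h g)

/-- A bicharacter on the (additively written) abelian group `G` with values in `kˣ`. -/
structure Bicharacter (k : Type u) [Field k] (G : Type u) [AddCommGroup G] where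
  toFun : G → G → kˣ
  map_add_left : ∀ x y z, toFun (x + y) z = toFun x z * toFun y z
  map_add_right : ∀ x y z, toFun x (y + z) = toFun x y * toFun x z

namespace Bicharacter

instance : CoeFun (Bicharacter k G) (fun _ => G → G → kˣ) := ⟨toFun⟩

variable (χ : Bicharacter k G)

theorem zero_left (x : G) : χ 0 x = 1 := by
  have h := χ.map_add_left 0 0 x
  rw [add_zero] at h
  exact (left_eq_mul.mp h)

theorem zero_right (x : G) : χ x 0 = 1 := by
  have h := χ.map_add_right x 0 0
  rw [add_zero] at h
  exact (left_eq_mul.mp h)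

/-- `ω(x, y) = χ(x, y) χ(y, x)`. -/
def omega (x y : G) : kˣ := χ x y * χ y x

/-- `ω` is non-degenerate. -/
def IsNondegenerate : Prop := ∀ x, (∀ y, χ.omega x y = 1) → x = 0

/-- The ribbon element `θ(x) = χ(x, x)`. -/
def theta (x : G) : kˣ := χ x x

end Bicharacter

variable (χ : Bicharacter k G)

/-- The map `m ⊗ n ↦ c(x, y) n ⊗ m` for `m` of degree `x` and `n` of degree `y`. -/
def braidingLin (c : G → G → k) (X Y : GVec k G) (g : G) :
    (X ⊗ Y : GVec k G) g →ₗ[k] (Y ⊗ X : GVec k G) g :=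
  tlift (X := X) (Y := Y) (T := (Y ⊗ X : GVec k G) g) fun x y h =>
    c x y • (tmk Y X (x := y) (y := x) ((add_comm y x).trans h)).flip

theorem braidingLin_tmk (c : G → G → k) (X Y : GVec k G) {x y g : G} (h : x + y = g)
    (h' : y + x = g) (m : X x) (n : Y y) :
    braidingLin c X Y g (tmk X Y h m n) = c x y • tmk Y X h' n m := by
  rw [braidingLin, tlift_tmk]; rfl

/-- The braiding `τ : m ⊗ n ↦ χ(x, y) n ⊗ m` for `m` of degree `x` and `n` of degree `y`. -/
def braidingHom (X Y : GVec k G) : (X ⊗ Y : GVec k G) ⟶ Y ⊗ X := fun g =>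
  ModuleCat.ofHom (braidingLin (fun x y => ((χ x y : kˣ) : k)) X Y g)

/-- The inverse of the braiding. -/
def braidingInv (X Y : GVec k G) : (Y ⊗ X : GVec k G) ⟶ X ⊗ Y := fun g =>
  ModuleCat.ofHom (braidingLin (fun y x => (((χ x y)⁻¹ : kˣ) : k)) Y X g)

theorem braidingHom_tmk (X Y : GVec k G) {x y g : G} (h : x + y = g) (h' : y + x = g)
    (m : X x) (n : Y y) :
    (braidingHom χ X Y g).hom (tmk X Y h m n) = ((χ x y : kˣ) : k) • tmk Y X h' n m :=
  braidingLin_tmk _ X Y h h' m n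

theorem braidingInv_tmk (X Y : GVec k G) {x y g : G} (h : x + y = g) (h' : y + x = g)
    (m : X x) (n : Y y) :
    (braidingInv χ X Y g).hom (tmk Y X h' n m) = (((χ x y)⁻¹ : kˣ) : k) • tmk X Y h m n :=
  braidingLin_tmk _ Y X h' h n m

theorem gcomp_hom {X Y Z : GVec k G} (f : X ⟶ Y) (f' : Y ⟶ Z) (g : G) (v : X g) :
    ((f ≫ f') g).hom v = (f' g).hom ((f g).hom v) := rfl

theorem gid_hom {X : GVec k G} (g : G) (v : X g) :
    ((𝟙 X : X ⟶ X) g).hom v = v := rfl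

/-- The braided monoidal category `B = (Vec_G, χ)`. It is not an instance, since it depends on `χ`. -/
abbrev vecBraided : BraidedCategory (GVec k G) where
  braiding X Y :=
    { hom := braidingHom χ X Y
      inv := braidingInv χ X Y
      hom_inv_id := by
        apply gvec_hom_ext; intro g; apply thom_ext; intro x y h m n
        rw [gcomp_hom, braidingHom_tmk χ X Y h ((add_comm y x).trans h), map_smul,
          braidingInv_tmk χ X Y h, smul_smul, gid_hom]
        simp
      inv_hom_id := by
        apply gvec_hom_ext; intro g; apply thom_ext; intro y x h n m
        rw [gcomp_hom, braidingInv_tmk χ X Y ((add_comm x y).trans h), map_smul,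
          braidingHom_tmk χ X Y _ h, smul_smul, gid_hom]
        simp }
  braiding_naturality_right X Y Z f := by
    apply gvec_hom_ext; intro g; apply thom_ext; intro x y h m n
    have h' := (add_comm y x).trans h
    rw [gcomp_hom, gcomp_hom, whiskerLeft_tmk]
    dsimp only
    rw [braidingHom_tmk χ _ _ h h', braidingHom_tmk χ _ _ h h', map_smul, whiskerRight_tmk]
  braiding_naturality_left {X Y} f Z := by
    apply gvec_hom_ext; intro g; apply thom_ext; intro x y h m n
    have h' := (add_comm y x).trans h
    rw [gcomp_hom, gcomp_hom, whiskerRight_tmk]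
    dsimp only
    rw [braidingHom_tmk χ _ _ h h', braidingHom_tmk χ _ _ h h', map_smul, whiskerLeft_tmk]
  hexagon_forward X Y Z := by
    apply gvec_hom_ext; intro g; apply thom_ext3'; intro v z h x y h' a b c
    subst h' h
    dsimp only
    rw [gcomp_hom, gcomp_hom, gcomp_hom, gcomp_hom,
      associator_tmk X Y Z rfl (v := y + z) rfl rfl (add_assoc x y z).symm,
      braidingHom_tmk χ _ _ (x := x) (y := y + z) _ (by abel), map_smul,
      associator_tmk Y Z X (v := x + z) rfl (add_comm z x) _ (show y + (x + z) = x + y + z by abel),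
      whiskerRight_tmk,
      braidingHom_tmk χ X Y rfl (add_comm y x)]
    simp only [map_smul, LinearMap.smul_apply]
    rw [associator_tmk Y X Z (x := y) (y := x) (z := z) (v := x + z) _ rfl _ (by abel), whiskerLeft_tmk,
      braidingHom_tmk χ X Z rfl (add_comm z x)]
    simp only [map_smul, smul_smul, χ.map_add_right, Units.val_mul]
  hexagon_reverse X Y Z := by
    apply gvec_hom_ext; intro g; apply thom_ext3; intro x v h y z h' a b c
    subst h' h
    dsimp only
    rw [gcomp_hom, gcomp_hom, gcomp_hom, gcomp_hom,
      associator_inv_tmk X Y Z (u := x + y) rfl rfl (add_assoc x y z) rfl,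
      braidingHom_tmk χ (X ⊗ Y) _ (x := x + y) (y := z) _ (by abel), map_smul,
      associator_inv_tmk Z X Y (u := x + z) (add_comm z x) rfl (show (x + z) + y = x + (y + z) by abel),
      whiskerLeft_tmk,
      braidingHom_tmk χ Y Z rfl (add_comm z y)]
    simp only [map_smul]
    rw [associator_inv_tmk X Z Y (u := x + z) rfl _ (by abel), whiskerRight_tmk,
      braidingHom_tmk χ X Z rfl (add_comm z x)]
    simp only [map_smul, LinearMap.smul_apply, smul_smul, χ.map_add_left, Units.val_mul]
    congr 1
    ring



/-- Base change along the tensor product: `(Δ_* M)_{(x, y)} = M_{x + y}`. -/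
def deltaStar (k : Type u) [Field k] (G : Type u) [AddCommGroup G] : GVec k G ⥤ GVec k (G × G) :=
  GradedObject.comap (ModuleCat.{u} k) (fun p : G × G => p.1 + p.2)

/-- The interchange `σ` of the two factors of `Vec_{G × G}`. -/
def swapFactors (k : Type u) [Field k] (G : Type u) : GVec k (G × G) ⥤ GVec k (G × G) :=
  GradedObject.comap (ModuleCat.{u} k) (Prod.swap : G × G → G × G)

/-- The component `M_{y + x} ⟶ M_{x + y}` of a morphism `σ Δ_* M ⟶ Δ_* M` in degree `(x, y)`. -/
def degreePart {M : GVec k G} (t : (swapFactors k G).obj ((deltaStar k G).obj M) ⟶ (deltaStar k G).obj M)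
    (x y : G) : M (y + x) ⟶ M (x + y) := t (x, y)

/-- The component `M_g ⟶ M_h` of a morphism `σ Δ_* M ⟶ Δ_* M` in degree `(x, y)`,
where `g = y + x` and `h = x + y`. -/
def component {M : GVec k G} (t : (swapFactors k G).obj ((deltaStar k G).obj M) ⟶ (deltaStar k G).obj M)
    (x y : G) {g h : G} (hg : y + x = g) (hh : x + y = h) : M g ⟶ M h :=
  eqToHom (congrArg M hg.symm) ≫ degreePart t x y ≫ eqToHom (congrArg M hh)

/-- The Hochschild homology category `HH(B)` of the monoidal category `Vec_G`: graded spaces `M`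
with an isomorphism `τ : σ Δ_* M ≅ Δ_* M`, with components `τ_{x,y} : M_{y+x} ⟶ M_{x+y}`, that is
unital, `τ_{0,g} = id`, and associative, `τ_{x,y+z} τ_{y,z+x} = τ_{x+y,z}`. The category does not
depend on the braiding; the bicharacter is recorded for the monoidal structure. -/
structure HH (χ : Bicharacter k G) where
  obj : GVec k G
  tau : (swapFactors k G).obj ((deltaStar k G).obj obj) ≅ (deltaStar k G).obj obj
  unit : ∀ g : G, component tau.hom 0 g (add_zero g) (zero_add g) = 𝟙 (obj g)
  assoc : ∀ (x y z : G) {g g' g'' : G} (h : z + (x + y) = g) (h' : (y + z) + x = g')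
      (h'' : (x + y) + z = g''),
      component tau.hom y (z + x) ((add_assoc z x y).trans h) ((add_assoc y z x).symm.trans h') ≫
          component tau.hom x (y + z) h' ((add_assoc x y z).symm.trans h'') =
        component tau.hom (x + y) z h h''

namespace HH

variable {χ}

@[ext]
structure Hom (M N : HH χ) where
  hom : M.obj ⟶ N.obj
  comm : M.tau.hom ≫ (deltaStar k G).map hom = (swapFactors k G).map ((deltaStar k G).map hom) ≫ N.tau.hom

instance : Category (HH χ) where
  Hom M N := Hom M N
  id M := ⟨𝟙 M.obj, by simp⟩
  comp f f' := ⟨f.hom ≫ f'.hom, by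
    rw [Functor.map_comp, ← Category.assoc, f.comm, Category.assoc, f'.comm, ← Category.assoc]
    rfl⟩

/-- The operator `τ_{a,g-a}` on `M_g`, viewed as an action of `a ∈ G`. -/
def act (M : HH χ) (a g : G) : M.obj g →ₗ[k] M.obj g :=
  (component M.tau.hom a (g - a) (sub_add_cancel g a) (add_sub_cancel a g)).hom

theorem component_eq_act (M : HH χ) (x y : G) {g : G} (hg : y + x = g) (hh : x + y = g) :
    component M.tau.hom x y hg hh = ModuleCat.ofHom (M.act x g) := by
  obtain rfl : y = g - x := eq_sub_of_add_eq hg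
  rfl

theorem act_zero (M : HH χ) (g : G) : M.act 0 g = LinearMap.id := by
  have h := M.unit g
  rw [component_eq_act] at h
  exact congrArg ModuleCat.Hom.hom h

theorem act_add (M : HH χ) (a b g : G) : M.act (a + b) g = M.act a g ∘ₗ M.act b g := by
  have h := M.assoc a b (g - a - b) (g := g) (g' := g) (g'' := g) (by abel) (by abel) (by abel)
  rw [component_eq_act, component_eq_act, component_eq_act] at h
  exact (congrArg ModuleCat.Hom.hom h).symm

theorem act_zero_apply (M : HH χ) {g : G} (m : M.obj g) : M.act 0 g m = m := by
  rw [act_zero]; rfl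

theorem act_add_apply (M : HH χ) (a b : G) {g : G} (m : M.obj g) :
    M.act (a + b) g m = M.act a g (M.act b g m) := by
  rw [act_add]; rfl

theorem eqToHom_family {M N : GVec k G} (φ : ∀ g, M g ⟶ N g) {g h : G} (e : g = h) :
    φ g ≫ eqToHom (congrArg N e) = eqToHom (congrArg M e) ≫ φ h := by
  subst e; simp

theorem comm_iff {M N : HH χ} (f : M.obj ⟶ N.obj) :
    M.tau.hom ≫ (deltaStar k G).map f = (swapFactors k G).map ((deltaStar k G).map f) ≫ N.tau.hom ↔
      ∀ (a g : G) (m : M.obj g), (f g).hom (M.act a g m) = N.act a g ((f g).hom m) := by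
  have key : ∀ (M : HH χ) (x y : G), degreePart M.tau.hom x y =
      ModuleCat.ofHom (M.act x (y + x)) ≫ eqToHom (congrArg M.obj (add_comm y x)) := by
    intro M x y
    rw [← component_eq_act M x y rfl (add_comm x y), component, eqToHom_refl, Category.id_comp,
      Category.assoc, eqToHom_trans, eqToHom_refl, Category.comp_id]
  have key2 : ∀ x y : G, (degreePart M.tau.hom x y ≫ f (x + y) =
      f (y + x) ≫ degreePart N.tau.hom x y) ↔ ModuleCat.ofHom (M.act x (y + x)) ≫ f (y + x) =
      f (y + x) ≫ ModuleCat.ofHom (N.act x (y + x)) := by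
    intro x y
    rw [key, key, Category.assoc, ← eqToHom_family f (add_comm y x), ← Category.assoc,
      ← Category.assoc, cancel_mono]
  constructor
  · intro h a g m
    have h' := (key2 a (g - a)).1 (congrFun h (a, g - a))
    have h'' : ∀ g', g - a + a = g' → ModuleCat.ofHom (M.act a g') ≫ f g' =
        f g' ≫ ModuleCat.ofHom (N.act a g') := by
      intro g' e; subst e; exact h'
    exact congrArg (fun φ => φ.hom m) (h'' g (sub_add_cancel g a))
  · intro h
    funext ⟨x, y⟩
    refine (key2 x y).2 ?_
    apply ModuleCat.hom_ext
    apply LinearMap.ext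
    intro m
    exact h x _ m

/-- A morphism of `HH(B)` is a family of linear maps commuting with the actions of all `a ∈ G`. -/
def mkHom {M N : HH χ} (f : ∀ g, M.obj g →ₗ[k] N.obj g)
    (hf : ∀ (a g : G) (m : M.obj g), f g (M.act a g m) = N.act a g (f g m)) : M ⟶ N where
  hom g := ModuleCat.ofHom (f g)
  comm := (comm_iff _).2 hf

/-- The linear map in degree `g` of a morphism of `HH(B)`. -/
def lin {M N : HH χ} (f : M ⟶ N) (g : G) : M.obj g →ₗ[k] N.obj g := (f.hom g).hom

theorem lin_act {M N : HH χ} (f : M ⟶ N) (a : G) {g : G} (m : M.obj g) :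
    lin f g (M.act a g m) = N.act a g (lin f g m) := (comm_iff f.hom).1 f.comm a g m

theorem hom_ext' {M N : HH χ} {f f' : M ⟶ N} (h : ∀ g, lin f g = lin f' g) : f = f' :=
  Hom.ext (gvec_hom_ext h)

@[simp] theorem lin_mkHom {M N : HH χ} (f : ∀ g, M.obj g →ₗ[k] N.obj g)
    (hf : ∀ (a g : G) (m : M.obj g), f g (M.act a g m) = N.act a g (f g m)) (g : G) :
    lin (mkHom f hf) g = f g := rfl

@[simp] theorem lin_id (M : HH χ) (g : G) : lin (𝟙 M) g = LinearMap.id := rfl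

@[simp] theorem lin_comp {M N P : HH χ} (f : M ⟶ N) (f' : N ⟶ P) (g : G) :
    lin (f ≫ f') g = lin f' g ∘ₗ lin f g := rfl

/-- An isomorphism of `HH(B)` from mutually inverse families of linear maps. -/
def mkIso {M N : HH χ} (f : ∀ g, M.obj g →ₗ[k] N.obj g) (f' : ∀ g, N.obj g →ₗ[k] M.obj g)
    (hf : ∀ (a g : G) (m : M.obj g), f g (M.act a g m) = N.act a g (f g m))
    (h : ∀ g, f' g ∘ₗ f g = LinearMap.id) (h' : ∀ g, f g ∘ₗ f' g = LinearMap.id) : M ≅ N where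
  hom := mkHom f hf
  inv := mkHom f' (fun a g n => by
    have h1 : ∀ m, f' g (f g m) = m := LinearMap.congr_fun (h g)
    have h2 : ∀ m, f g (f' g m) = m := LinearMap.congr_fun (h' g)
    rw [← h1 (M.act a g (f' g n)), hf, h2])
  hom_inv_id := hom_ext' h
  inv_hom_id := hom_ext' h'

/-- The isomorphism `σ Δ_* X ≅ Δ_* X` given by actions of `G` on all `X_g`. -/
def ofActIso (X : GVec k G) (r : G → ∀ g, X g →ₗ[k] X g)
    (h0 : ∀ g, r 0 g = LinearMap.id) (hadd : ∀ a b g, r (a + b) g = r a g ∘ₗ r b g) :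
    (swapFactors k G).obj ((deltaStar k G).obj X) ≅ (deltaStar k G).obj X where
  hom p := ModuleCat.ofHom (r p.1 (p.2 + p.1)) ≫ eqToHom (congrArg X (add_comm p.2 p.1))
  inv p := eqToHom (congrArg X (add_comm p.1 p.2)) ≫ ModuleCat.ofHom (r (-p.1) (p.2 + p.1))
  hom_inv_id := by
    funext p
    change (ModuleCat.ofHom (r p.1 (p.2 + p.1)) ≫ eqToHom (congrArg X (add_comm p.2 p.1))) ≫
      eqToHom (congrArg X (add_comm p.1 p.2)) ≫ ModuleCat.ofHom (r (-p.1) (p.2 + p.1)) = 𝟙 _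
    rw [Category.assoc, eqToHom_trans_assoc, eqToHom_refl, Category.id_comp, ← ModuleCat.ofHom_comp,
      ← hadd, neg_add_cancel, h0]
    rfl
  inv_hom_id := by
    funext p
    change (eqToHom (congrArg X (add_comm p.1 p.2)) ≫ ModuleCat.ofHom (r (-p.1) (p.2 + p.1))) ≫
      ModuleCat.ofHom (r p.1 (p.2 + p.1)) ≫ eqToHom (congrArg X (add_comm p.2 p.1)) = 𝟙 _
    rw [Category.assoc, ← Category.assoc (ModuleCat.ofHom _) (ModuleCat.ofHom _),
      ← ModuleCat.ofHom_comp, ← hadd, add_neg_cancel, h0, ModuleCat.ofHom_id, Category.id_comp,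
      eqToHom_trans, eqToHom_refl]

theorem component_ofActIso (X : GVec k G) (r : G → ∀ g, X g →ₗ[k] X g)
    (h0 : ∀ g, r 0 g = LinearMap.id) (hadd : ∀ a b g, r (a + b) g = r a g ∘ₗ r b g)
    (x y : G) {g h : G} (hg : y + x = g) (hh : x + y = h) :
    component (ofActIso X r h0 hadd).hom x y hg hh =
      ModuleCat.ofHom (r x g) ≫ eqToHom (congrArg X (hg.symm.trans ((add_comm y x).trans hh))) := by
  subst hg hh
  change eqToHom _ ≫ (ModuleCat.ofHom (r x (y + x)) ≫ eqToHom (congrArg X (add_comm y x))) ≫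
    eqToHom _ = _
  rw [eqToHom_refl, eqToHom_refl, Category.id_comp, Category.comp_id]

/-- The object of `HH(B)` given by a graded space `X` with an action of `G` on each `X_g`. -/
def ofAct (X : GVec k G) (r : G → ∀ g, X g →ₗ[k] X g)
    (h0 : ∀ g, r 0 g = LinearMap.id) (hadd : ∀ a b g, r (a + b) g = r a g ∘ₗ r b g) : HH χ where
  obj := X
  tau := ofActIso X r h0 hadd
  unit g := by
    rw [component_ofActIso, h0]; simp
  assoc x y z g g' g'' h h' h'' := by
    obtain rfl : g = g' := by rw [← h, ← h']; abel
    obtain rfl : g = g'' := by rw [← h, ← h'']; abel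
    rw [component_ofActIso, component_ofActIso, component_ofActIso, hadd]
    simp

theorem act_ofAct (X : GVec k G) (r : G → ∀ g, X g →ₗ[k] X g)
    (h0 : ∀ g, r 0 g = LinearMap.id) (hadd : ∀ a b g, r (a + b) g = r a g ∘ₗ r b g) (a g : G) :
    (ofAct (χ := χ) X r h0 hadd).act a g = r a g := by
  unfold act
  have := component_ofActIso X r h0 hadd a (g - a) (sub_add_cancel g a) (add_sub_cancel a g)
  refine (congrArg ModuleCat.Hom.hom this).trans ?_
  simp

end HH


namespace HH

variable {χ : Bicharacter k G}

section Tensor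

variable (M N : HH χ)

/-- The action of a simple object of degree `a` on `M ⊗ N` through `M`, its dual being braided past `N`. -/
def actFst (a g : G) :
    (M.obj ⊗ N.obj : GVec k G) g →ₗ[k] (M.obj ⊗ N.obj : GVec k G) g :=
  tlift (T := (M.obj ⊗ N.obj : GVec k G) g) fun x y h =>
    (((χ y a)⁻¹ : kˣ) : k) • (tmk M.obj N.obj h).comp (M.act a x)

/-- The action of a simple object of degree `a` on `M ⊗ N` through `N`, after braiding it past `M`. -/
def actSnd (a g : G) :
    (M.obj ⊗ N.obj : GVec k G) g →ₗ[k] (M.obj ⊗ N.obj : GVec k G) g :=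
  tlift (T := (M.obj ⊗ N.obj : GVec k G) g) fun x y h =>
    ((χ a x : kˣ) : k) • (tmk M.obj N.obj h).compl₂ (N.act a y)

theorem actFst_tmk (a : G) {x y g : G} (h : x + y = g) (m : M.obj x) (n : N.obj y) :
    M.actFst N a g (tmk M.obj N.obj h m n) =
      (((χ y a)⁻¹ : kˣ) : k) • tmk M.obj N.obj h (M.act a x m) n := by
  rw [actFst, tlift_tmk]; rfl

theorem actSnd_tmk (a : G) {x y g : G} (h : x + y = g) (m : M.obj x) (n : N.obj y) :
    M.actSnd N a g (tmk M.obj N.obj h m n) =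
      ((χ a x : kˣ) : k) • tmk M.obj N.obj h m (N.act a y n) := by
  rw [actSnd, tlift_tmk]; rfl

/-- The subspace on which the two actions are identified. -/
def balance (g : G) : Submodule k ((M.obj ⊗ N.obj : GVec k G) g) :=
  ⨆ a : G, LinearMap.range (M.actFst N a g - M.actSnd N a g)

theorem actFst_add (a b g : G) :
    M.actFst N (a + b) g = M.actFst N a g ∘ₗ M.actFst N b g := by
  apply thom_ext; intro x y h m n
  rw [LinearMap.comp_apply, actFst_tmk, actFst_tmk, map_smul, actFst_tmk, smul_smul,
    act_add_apply, χ.map_add_right, mul_inv_rev, Units.val_mul]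

theorem actFst_zero (g : G) : M.actFst N 0 g = LinearMap.id := by
  apply thom_ext; intro x y h m n
  rw [actFst_tmk, act_zero_apply, χ.zero_right]
  simp

theorem actFst_comm (a b g : G) (z) :
    M.actFst N a g (M.actFst N b g z) = M.actFst N b g (M.actFst N a g z) := by
  rw [← LinearMap.comp_apply, ← actFst_add, add_comm, actFst_add]; rfl

theorem actFst_actSnd (a b g : G) (z) :
    M.actFst N a g (M.actSnd N b g z) = M.actSnd N b g (M.actFst N a g z) := by
  have : M.actFst N a g ∘ₗ M.actSnd N b g = M.actSnd N b g ∘ₗ M.actFst N a g := by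
    apply thom_ext; intro x y h m n
    rw [LinearMap.comp_apply, LinearMap.comp_apply, actFst_tmk, actSnd_tmk, map_smul, map_smul,
      actFst_tmk, actSnd_tmk, smul_smul, smul_smul, mul_comm]
  exact LinearMap.congr_fun this z

theorem balance_le (a g : G) : M.balance N g ≤ (M.balance N g).comap (M.actFst N a g) := by
  refine iSup_le fun b => ?_
  rintro _ ⟨z, rfl⟩
  rw [Submodule.mem_comap, LinearMap.sub_apply, map_sub, actFst_comm, actFst_actSnd,
    ← LinearMap.sub_apply]
  exact Submodule.mem_iSup_of_mem b ⟨_, rfl⟩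

/-- The common action on the quotient. -/
def qAct (a g : G) : ((M.obj ⊗ N.obj : GVec k G) g ⧸ M.balance N g) →ₗ[k]
    ((M.obj ⊗ N.obj : GVec k G) g ⧸ M.balance N g) :=
  (M.balance N g).mapQ (M.balance N g) (M.actFst N a g) (M.balance_le N a g)

/-- The annuli-stacking product: the largest quotient of `M ⊗ N` on which the two actions of `Vec_G`,
through `M` and through `N`, coincide, with the common action. It is the tensor product over the
commutative algebra in the centre of `B` whose modules are the objects of `HH(B)`. -/
def tens : HH χ :=
  ofAct (fun g => ModuleCat.of k ((M.obj ⊗ N.obj : GVec k G) g ⧸ M.balance N g))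
    (fun a g => M.qAct N a g)
    (fun g => by
      apply Submodule.linearMap_qext
      apply LinearMap.ext
      intro z
      change (M.balance N g).mkQ (M.actFst N 0 g z) = (M.balance N g).mkQ z
      rw [actFst_zero]; rfl)
    (fun a b g => by
      apply Submodule.linearMap_qext
      apply LinearMap.ext
      intro z
      change (M.balance N g).mkQ (M.actFst N (a + b) g z) =
        (M.balance N g).mkQ (M.actFst N a g (M.actFst N b g z))
      rw [actFst_add]; rfl)

/-- The class of `m ⊗ n`. -/
def qmk {x y g : G} (h : x + y = g) : M.obj x →ₗ[k] N.obj y →ₗ[k] (M.tens N).obj g :=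
  (tmk M.obj N.obj h).compr₂ (M.balance N g).mkQ

theorem qmk_balanced (a : G) {x y g : G} (h : x + y = g) (m : M.obj x) (n : N.obj y) :
    (((χ y a)⁻¹ : kˣ) : k) • M.qmk N h (M.act a x m) n =
      ((χ a x : kˣ) : k) • M.qmk N h m (N.act a y n) := by
  have h1 := M.actFst_tmk N a h m n
  have h2 := M.actSnd_tmk N a h m n
  have : (M.balance N g).mkQ (M.actFst N a g (tmk M.obj N.obj h m n)) =
      (M.balance N g).mkQ (M.actSnd N a g (tmk M.obj N.obj h m n)) := by
    apply (Submodule.Quotient.eq _).2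
    exact Submodule.mem_iSup_of_mem a ⟨tmk M.obj N.obj h m n, rfl⟩
  rw [h1, h2, map_smul, map_smul] at this
  exact this

theorem act_qmk (a : G) {x y g : G} (h : x + y = g) (m : M.obj x) (n : N.obj y) :
    (M.tens N).act a g (M.qmk N h m n) =
      (((χ y a)⁻¹ : kˣ) : k) • M.qmk N h (M.act a x m) n := by
  have h1 : (M.tens N).act a g = M.qAct N a g := act_ofAct _ _ _ _ _ _
  rw [h1]
  change (M.balance N g).mkQ (M.actFst N a g (tmk M.obj N.obj h m n)) = _
  rw [actFst_tmk, map_smul]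
  rfl

theorem act_qmk' (a : G) {x y g : G} (h : x + y = g) (m : M.obj x) (n : N.obj y) :
    (M.tens N).act a g (M.qmk N h m n) =
      ((χ a x : kˣ) : k) • M.qmk N h m (N.act a y n) := by
  rw [act_qmk, qmk_balanced]

variable {M N}

theorem qext {g : G} {T : Type u} [AddCommGroup T] [Module k T]
    {f f' : (M.tens N).obj g →ₗ[k] T}
    (hf : ∀ (x y : G) (h : x + y = g) (m : M.obj x) (n : N.obj y),
      f (M.qmk N h m n) = f' (M.qmk N h m n)) : f = f' := by
  have : f ∘ₗ (M.balance N g).mkQ = f' ∘ₗ (M.balance N g).mkQ := thom_ext hf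
  exact Submodule.linearMap_qext _ this

/-- The linear map out of the product given by balanced bilinear maps. -/
def qlift {g : G} {T : Type u} [AddCommGroup T] [Module k T]
    (φ : ∀ x y : G, x + y = g → (M.obj x →ₗ[k] N.obj y →ₗ[k] T))
    (hφ : ∀ (a x y : G) (h : x + y = g) (m : M.obj x) (n : N.obj y),
      (((χ y a)⁻¹ : kˣ) : k) • φ x y h (M.act a x m) n =
        ((χ a x : kˣ) : k) • φ x y h m (N.act a y n)) :
    (M.tens N).obj g →ₗ[k] T :=
  (M.balance N g).liftQ (tlift φ) (by
    refine iSup_le fun a => ?_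
    rintro _ ⟨z, rfl⟩
    have : tlift φ ∘ₗ M.actFst N a g = tlift φ ∘ₗ M.actSnd N a g := by
      apply thom_ext; intro x y h m n
      rw [LinearMap.comp_apply, LinearMap.comp_apply, actFst_tmk, actSnd_tmk, map_smul, map_smul,
        tlift_tmk, tlift_tmk, hφ]
    rw [LinearMap.mem_ker, LinearMap.sub_apply, map_sub, sub_eq_zero]
    exact LinearMap.congr_fun this z)

theorem qlift_qmk {g : G} {T : Type u} [AddCommGroup T] [Module k T]
    (φ : ∀ x y : G, x + y = g → (M.obj x →ₗ[k] N.obj y →ₗ[k] T))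
    (hφ : ∀ (a x y : G) (h : x + y = g) (m : M.obj x) (n : N.obj y),
      (((χ y a)⁻¹ : kˣ) : k) • φ x y h (M.act a x m) n =
        ((χ a x : kˣ) : k) • φ x y h m (N.act a y n))
    {x y : G} (h : x + y = g) (m : M.obj x) (n : N.obj y) :
    qlift φ hφ (M.qmk N h m n) = φ x y h m n :=
  tlift_tmk φ h m n

end Tensor

attribute [irreducible] tens qmk qlift

theorem qext3 {M N P : HH χ} {g : G} {T : Type u} [AddCommGroup T] [Module k T]
    {f f' : (M.tens (N.tens P)).obj g →ₗ[k] T}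
    (hf : ∀ (x v : G) (h : x + v = g) (y z : G) (h' : y + z = v) (a : M.obj x) (b : N.obj y)
      (c : P.obj z), f (M.qmk (N.tens P) h a (N.qmk P h' b c)) =
        f' (M.qmk (N.tens P) h a (N.qmk P h' b c))) : f = f' := by
  apply qext
  intro x v h a n
  have : f ∘ₗ (M.qmk (N.tens P) h a) = f' ∘ₗ (M.qmk (N.tens P) h a) :=
    qext fun y z h' b c => hf x v h y z h' a b c
  exact LinearMap.congr_fun this n

theorem qext3' {M N P : HH χ} {g : G} {T : Type u} [AddCommGroup T] [Module k T]
    {f f' : ((M.tens N).tens P).obj g →ₗ[k] T}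
    (hf : ∀ (v z : G) (h : v + z = g) (x y : G) (h' : x + y = v) (a : M.obj x) (b : N.obj y)
      (c : P.obj z), f ((M.tens N).qmk P h (M.qmk N h' a b) c) =
        f' ((M.tens N).qmk P h (M.qmk N h' a b) c)) : f = f' := by
  apply qext
  intro v z h n c
  have : f ∘ₗ (((M.tens N).qmk P h).flip c) = f' ∘ₗ (((M.tens N).qmk P h).flip c) :=
    qext fun x y h' a b => hf v z h x y h' a b c
  exact LinearMap.congr_fun this n

theorem qext4' {M N P R : HH χ} {g : G} {T : Type u} [AddCommGroup T] [Module k T]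
    {f f' : (((M.tens N).tens P).tens R).obj g →ₗ[k] T}
    (hf : ∀ (w t : G) (h : w + t = g) (v z : G) (h'' : v + z = w) (x y : G) (h' : x + y = v)
      (a : M.obj x) (b : N.obj y) (c : P.obj z) (d : R.obj t),
      f (((M.tens N).tens P).qmk R h ((M.tens N).qmk P h'' (M.qmk N h' a b) c) d) =
      f' (((M.tens N).tens P).qmk R h ((M.tens N).qmk P h'' (M.qmk N h' a b) c) d)) : f = f' := by
  apply qext
  intro w t h n d
  have : f ∘ₗ ((((M.tens N).tens P).qmk R h).flip d) =
      f' ∘ₗ ((((M.tens N).tens P).qmk R h).flip d) :=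
    qext3' fun v z h'' x y h' a b c => hf w t h v z h'' x y h' a b c d
  exact LinearMap.congr_fun this n

/-- The product of two morphisms. -/
def tensMap {M M' N N' : HH χ} (f : M ⟶ M') (f' : N ⟶ N') : M.tens N ⟶ M'.tens N' :=
  mkHom (fun g => qlift (T := (M'.tens N').obj g)
      (fun x y h => (M'.qmk N' h).compl₁₂ (lin f x) (lin f' y))
      (fun a x y h m n => by
        simp only [LinearMap.compl₁₂_apply, lin_act]
        exact M'.qmk_balanced N' a h _ _))
    (fun a g z => by
      refine LinearMap.congr_fun (f := _ ∘ₗ (M.tens N).act a g) (g := (M'.tens N').act a g ∘ₗ _)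
        (qext fun x y h m n => ?_) z
      rw [LinearMap.comp_apply, LinearMap.comp_apply, act_qmk, map_smul, qlift_qmk, qlift_qmk,
        LinearMap.compl₁₂_apply, LinearMap.compl₁₂_apply, lin_act, act_qmk])

theorem tensMap_qmk {M M' N N' : HH χ} (f : M ⟶ M') (f' : N ⟶ N') {x y g : G} (h : x + y = g)
    (m : M.obj x) (n : N.obj y) :
    lin (tensMap f f') g (M.qmk N h m n) = M'.qmk N' h (lin f x m) (lin f' y n) := by
  rw [tensMap, lin_mkHom, qlift_qmk, LinearMap.compl₁₂_apply]

def assocFwdAux (M N P : HH χ) {u z g : G} (hu : u + z = g) :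
    (M.tens N).obj u →ₗ[k] P.obj z →ₗ[k] (M.tens (N.tens P)).obj g :=
  qlift (T := P.obj z →ₗ[k] (M.tens (N.tens P)).obj g) (fun x y hx =>
      LinearMap.mk₂ k (fun m n => (M.qmk (N.tens P) (x := x) (y := y + z)
          (by rw [← hu, ← hx, add_assoc]) m) ∘ₗ (N.qmk P rfl n))
        (fun m m' n => by ext p; simp) (fun c m n => by ext p; simp)
        (fun m n n' => by ext p; simp) (fun c m n => by ext p; simp))
      (fun a x y h m n => by
        ext p
        have e1 := M.qmk_balanced (N.tens P) a (x := x) (y := y + z) (g := g)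
          (by rw [← hu, ← h, add_assoc]) m (N.qmk P rfl n p)
        rw [act_qmk, map_smul] at e1
        simp only [LinearMap.smul_apply, LinearMap.mk₂_apply, LinearMap.comp_apply]
        rw [χ.map_add_left, mul_inv, Units.val_mul, smul_smul] at e1
        have hz : ((χ z a : kˣ) : k) * (((χ z a)⁻¹ : kˣ) : k) = 1 := by simp
        have e2 := congrArg (fun w => ((χ z a : kˣ) : k) • w) e1
        simp only [smul_smul] at e2
        convert e2 using 2
        · rw [mul_comm, mul_assoc, mul_comm _ ((χ z a : kˣ) : k), hz, mul_one]
        · rw [mul_comm (((χ a x : kˣ) : k)), ← mul_assoc, hz, one_mul])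

theorem assocFwdAux_qmk (M N P : HH χ) {x y z u v g : G} (hu : x + y = u) (hv : y + z = v)
    (hg : u + z = g) (hg' : x + v = g) (m : M.obj x) (n : N.obj y) (p : P.obj z) :
    assocFwdAux M N P hg (M.qmk N hu m n) p = M.qmk (N.tens P) hg' m (N.qmk P hv n p) := by
  subst hv
  rw [assocFwdAux, qlift_qmk]
  rfl

def assocFwd (M N P : HH χ) (g : G) :
    ((M.tens N).tens P).obj g →ₗ[k] (M.tens (N.tens P)).obj g :=
  qlift (T := (M.tens (N.tens P)).obj g) (fun _ _ hu => assocFwdAux M N P hu)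
    (fun a u z h q p => by
      refine Eq.trans (LinearMap.congr_fun (f := (((χ z a)⁻¹ : kˣ) : k) •
        (((assocFwdAux M N P h).flip p) ∘ₗ (M.tens N).act a u))
        (g := ((χ a u : kˣ) : k) • ((assocFwdAux M N P h).flip (P.act a z p)))
        (qext fun x y hx m n => ?_) q) rfl
      simp only [LinearMap.smul_apply, LinearMap.comp_apply, LinearMap.flip_apply]
      have hg' : x + (y + z) = g := by rw [← h, ← hx, add_assoc]
      rw [act_qmk', map_smul, LinearMap.smul_apply, assocFwdAux_qmk M N P hx rfl h hg',
        assocFwdAux_qmk M N P hx rfl h hg']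
      have e := N.qmk_balanced P a (g := y + z) rfl n p
      rw [smul_comm, ← map_smul, e, map_smul, smul_smul, ← Units.val_mul, ← χ.map_add_right, hx])

theorem assocFwd_qmk (M N P : HH χ) {x y z u v g : G} (hu : x + y = u) (hv : y + z = v)
    (hg : u + z = g) (hg' : x + v = g) (m : M.obj x) (n : N.obj y) (p : P.obj z) :
    assocFwd M N P g ((M.tens N).qmk P hg (M.qmk N hu m n) p) =
      M.qmk (N.tens P) hg' m (N.qmk P hv n p) := by
  rw [assocFwd, qlift_qmk, assocFwdAux_qmk M N P hu hv hg hg']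

def assocBwdAux (M N P : HH χ) {x v g : G} (hg : x + v = g) :
    M.obj x →ₗ[k] (N.tens P).obj v →ₗ[k] ((M.tens N).tens P).obj g :=
  LinearMap.flip (qlift (T := M.obj x →ₗ[k] ((M.tens N).tens P).obj g) (fun y z hy =>
      LinearMap.mk₂ k (fun n p => ((M.tens N).qmk P (x := x + y) (y := z)
          (by rw [← hg, ← hy, add_assoc])).flip p ∘ₗ ((M.qmk N rfl).flip n))
        (fun m m' n => by ext p; simp) (fun c m n => by ext p; simp)
        (fun m n n' => by ext p; simp) (fun c m n => by ext p; simp))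
      (fun a y z h n p => by
        ext m
        have e1 := (M.tens N).qmk_balanced P a (x := x + y) (y := z) (g := g)
          (by rw [← hg, ← h, add_assoc]) (M.qmk N rfl m n) p
        rw [act_qmk', map_smul, LinearMap.smul_apply] at e1
        simp only [LinearMap.smul_apply, LinearMap.mk₂_apply, LinearMap.comp_apply,
          LinearMap.flip_apply]
        rw [χ.map_add_right, Units.val_mul, smul_smul] at e1
        have hz : (((χ a x)⁻¹ : kˣ) : k) * ((χ a x : kˣ) : k) = 1 := by simp
        have e2 := congrArg (fun w => (((χ a x)⁻¹ : kˣ) : k) • w) e1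
        simp only [smul_smul] at e2
        convert e2 using 2
        · rw [mul_comm (((χ z a)⁻¹ : kˣ) : k), ← mul_assoc, hz, one_mul]
        · rw [← mul_assoc, hz, one_mul]))

theorem assocBwdAux_qmk (M N P : HH χ) {x y z u v g : G} (hu : x + y = u) (hv : y + z = v)
    (hg : u + z = g) (hg' : x + v = g) (m : M.obj x) (n : N.obj y) (p : P.obj z) :
    assocBwdAux M N P hg' m (N.qmk P hv n p) = (M.tens N).qmk P hg (M.qmk N hu m n) p := by
  subst hu
  rw [assocBwdAux, LinearMap.flip_apply, qlift_qmk]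
  rfl

def assocBwd (M N P : HH χ) (g : G) :
    (M.tens (N.tens P)).obj g →ₗ[k] ((M.tens N).tens P).obj g :=
  qlift (T := ((M.tens N).tens P).obj g) (fun _ _ hg => assocBwdAux M N P hg)
    (fun a x v h m q => by
      refine Eq.trans (LinearMap.congr_fun (f := (((χ v a)⁻¹ : kˣ) : k) •
        (assocBwdAux M N P h (M.act a x m)))
        (g := ((χ a x : kˣ) : k) • ((assocBwdAux M N P h m) ∘ₗ (N.tens P).act a v))
        (qext fun y z hy n p => ?_) q) rfl
      simp only [LinearMap.smul_apply, LinearMap.comp_apply]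
      have hg : (x + y) + z = g := by rw [← h, ← hy, add_assoc]
      rw [act_qmk, map_smul, assocBwdAux_qmk M N P rfl hy hg h, assocBwdAux_qmk M N P rfl hy hg h]
      have e := M.qmk_balanced N a (g := x + y) rfl m n
      have e' := congrArg (fun w => (M.tens N).qmk P hg w p) e
      simp only [map_smul, LinearMap.smul_apply] at e'
      rw [smul_comm ((χ a x : kˣ) : k), ← e', smul_smul, ← Units.val_mul, ← mul_inv,
        mul_comm (χ z a), ← χ.map_add_left, hy])

theorem assocBwd_qmk (M N P : HH χ) {x y z u v g : G} (hu : x + y = u) (hv : y + z = v)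
    (hg : u + z = g) (hg' : x + v = g) (m : M.obj x) (n : N.obj y) (p : P.obj z) :
    assocBwd M N P g (M.qmk (N.tens P) hg' m (N.qmk P hv n p)) =
      (M.tens N).qmk P hg (M.qmk N hu m n) p := by
  rw [assocBwd, qlift_qmk, assocBwdAux_qmk M N P hu hv hg hg']

/-- The associator, `(m ⊗ n) ⊗ p ↦ m ⊗ (n ⊗ p)`. -/
def tensAssoc (M N P : HH χ) : (M.tens N).tens P ≅ M.tens (N.tens P) :=
  mkIso (assocFwd M N P) (assocBwd M N P)
    (fun a g z => by
      refine LinearMap.congr_fun (f := assocFwd M N P g ∘ₗ ((M.tens N).tens P).act a g)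
        (g := (M.tens (N.tens P)).act a g ∘ₗ assocFwd M N P g)
        (qext3' fun u z hu x y hx m n p => ?_) z
      have hg' : x + (y + z) = g := by rw [← hu, ← hx, add_assoc]
      rw [LinearMap.comp_apply, LinearMap.comp_apply, act_qmk', map_smul,
        assocFwd_qmk M N P hx rfl hu hg', assocFwd_qmk M N P hx rfl hu hg', act_qmk', act_qmk',
        map_smul, smul_smul, ← Units.val_mul, ← χ.map_add_right, hx])
    (fun g => qext3' fun u z hu x y hx m n p => by
      have hg' : x + (y + z) = g := by rw [← hu, ← hx, add_assoc]
      rw [LinearMap.comp_apply, assocFwd_qmk M N P hx rfl hu hg', assocBwd_qmk M N P hx rfl hu hg']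
      rfl)
    (fun g => qext3 fun x v hx y z hv m n p => by
      have hg : (x + y) + z = g := by rw [← hx, ← hv, add_assoc]
      rw [LinearMap.comp_apply, assocBwd_qmk M N P rfl hv hg hx, assocFwd_qmk M N P rfl hv hg hx]
      rfl)

theorem tensAssoc_qmk (M N P : HH χ) {x y z u v g : G} (hu : x + y = u) (hv : y + z = v)
    (hg : u + z = g) (hg' : x + v = g) (m : M.obj x) (n : N.obj y) (p : P.obj z) :
    lin (tensAssoc M N P).hom g ((M.tens N).qmk P hg (M.qmk N hu m n) p) =
      M.qmk (N.tens P) hg' m (N.qmk P hv n p) :=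
  assocFwd_qmk M N P hu hv hg hg' m n p


/-- The unit object: the group algebra `k[G]` in degree `0` with the regular action. -/
def unitObj (χ : Bicharacter k G) : HH χ :=
  ofAct (fun g => ModuleCat.of k (G × PLift (g = 0) →₀ k))
    (fun a _ => Finsupp.lmapDomain k k (fun p => (a + p.1, p.2)))
    (fun g => by
      apply Finsupp.lhom_ext'; intro p; ext
      simp)
    (fun a b g => by
      apply Finsupp.lhom_ext'; intro p; ext
      simp [add_assoc])

/-- The basis vector `b` of the unit object. -/
def e (χ : Bicharacter k G) (b : G) {g : G} (h : g = 0) : (unitObj χ).obj g :=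
  Finsupp.single (b, PLift.up h) (1 : k)

theorem act_e (a b : G) {g : G} (h : g = 0) :
    (unitObj χ).act a g (e χ b h) = e χ (a + b) h := by
  have h1 : (unitObj χ).act a g = Finsupp.lmapDomain k k (fun p => (a + p.1, p.2)) :=
    act_ofAct _ _ _ _ _ _
  rw [h1]
  exact Finsupp.mapDomain_single

/-- The linear map out of the unit object with prescribed values on the basis. -/
def elift {g : G} {T : Type u} [AddCommGroup T] [Module k T] (f : G → g = 0 → T) :
    (unitObj χ).obj g →ₗ[k] T :=
  Finsupp.linearCombination k (fun p : G × PLift (g = 0) => f p.1 p.2.down)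

theorem elift_e {g : G} {T : Type u} [AddCommGroup T] [Module k T] (f : G → g = 0 → T)
    (b : G) (h : g = 0) : elift (χ := χ) f (e χ b h) = f b h := by
  refine (Finsupp.linearCombination_single k (1 : k) (b, PLift.up h)).trans ?_
  rw [one_smul]

theorem eext {g : G} {T : Type u} [AddCommGroup T] [Module k T]
    {f f' : (unitObj χ).obj g →ₗ[k] T}
    (h : ∀ (b : G) (hg : g = 0), f (e χ b hg) = f' (e χ b hg)) : f = f' := by
  apply Finsupp.lhom_ext'
  rintro ⟨b, ⟨hg⟩⟩
  ext
  exact h b hg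

attribute [irreducible] unitObj e elift

theorem qext_unit_left {M : HH χ} {g : G} {T : Type u} [AddCommGroup T] [Module k T]
    {f f' : ((unitObj χ).tens M).obj g →ₗ[k] T}
    (hf : ∀ m : M.obj g, f ((unitObj χ).qmk M (zero_add g) (e χ 0 rfl) m) =
      f' ((unitObj χ).qmk M (zero_add g) (e χ 0 rfl) m)) : f = f' := by
  apply qext
  intro x y h u m
  refine LinearMap.congr_fun (f := f ∘ₗ ((unitObj χ).qmk M h).flip m)
    (g := f' ∘ₗ ((unitObj χ).qmk M h).flip m) (eext fun b hx => ?_) u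
  subst hx
  obtain rfl : y = g := by rw [← h, zero_add]
  have e1 := (unitObj χ).qmk_balanced M b h (e χ 0 rfl) m
  rw [act_e, add_zero, χ.zero_right, Units.val_one, one_smul] at e1
  have e2 := congrArg (fun w => ((χ y b : kˣ) : k) • w) e1
  simp only [smul_smul, Units.mul_inv, one_smul] at e2
  simp only [LinearMap.comp_apply, LinearMap.flip_apply]
  rw [e2, map_smul, map_smul, hf]

theorem qext_unit_right {M : HH χ} {g : G} {T : Type u} [AddCommGroup T] [Module k T]
    {f f' : (M.tens (unitObj χ)).obj g →ₗ[k] T}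
    (hf : ∀ m : M.obj g, f (M.qmk (unitObj χ) (add_zero g) m (e χ 0 rfl)) =
      f' (M.qmk (unitObj χ) (add_zero g) m (e χ 0 rfl))) : f = f' := by
  apply qext
  intro x y h m u
  refine LinearMap.congr_fun (f := f ∘ₗ (M.qmk (unitObj χ) h) m)
    (g := f' ∘ₗ (M.qmk (unitObj χ) h) m) (eext fun b hx => ?_) u
  subst hx
  obtain rfl : x = g := by rw [← h, add_zero]
  have e1 := M.qmk_balanced (unitObj χ) b h m (e χ 0 rfl)
  rw [act_e, add_zero, χ.zero_left, inv_one, Units.val_one, one_smul] at e1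
  have e2 := congrArg (fun w => (((χ b x)⁻¹ : kˣ) : k) • w) e1
  simp only [smul_smul, Units.inv_mul, one_smul] at e2
  simp only [LinearMap.comp_apply]
  rw [← e2, map_smul, map_smul, hf]

def unitLeftFwd (M : HH χ) (g : G) : ((unitObj χ).tens M).obj g →ₗ[k] M.obj g :=
  qlift (fun x y h => elift fun b hx => ((χ y b : kˣ) : k) •
      (M.act b g ∘ₗ (eqToHom (congrArg M.obj (show y = g by rw [← h, hx, zero_add]))).hom))
    (fun a x y h u m => by
      have hx0 : ∀ hx : x = 0, y = g := fun hx => by rw [← h, hx, zero_add]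
      refine Eq.trans (LinearMap.congr_fun (f := (((χ y a)⁻¹ : kˣ) : k) •
        (LinearMap.applyₗ m ∘ₗ (elift fun b hx => ((χ y b : kˣ) : k) •
          (M.act b g ∘ₗ (eqToHom (congrArg M.obj (hx0 hx))).hom))) ∘ₗ (unitObj χ).act a x)
        (g := ((χ a x : kˣ) : k) • (LinearMap.applyₗ (M.act a y m) ∘ₗ
          (elift fun b hx => ((χ y b : kˣ) : k) •
          (M.act b g ∘ₗ (eqToHom (congrArg M.obj (hx0 hx))).hom)))) (eext fun b hx => ?_) u) rfl
      subst hx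
      obtain rfl : y = g := hx0 rfl
      simp only [LinearMap.smul_apply, LinearMap.comp_apply]
      rw [act_e, elift_e, elift_e]
      simp only [LinearMap.applyₗ_apply_apply, LinearMap.smul_apply, LinearMap.comp_apply,
        eqToHom_refl, ModuleCat.hom_id, LinearMap.id_apply]
      rw [χ.zero_right, Units.val_one, one_smul, smul_smul, χ.map_add_right, Units.val_mul,
        ← mul_assoc, Units.inv_mul, one_mul, add_comm a b, act_add_apply])

theorem unitLeftFwd_qmk (M : HH χ) {g : G} (m : M.obj g) :
    unitLeftFwd M g ((unitObj χ).qmk M (zero_add g) (e χ 0 rfl) m) = m := by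
  rw [unitLeftFwd, qlift_qmk, elift_e]
  simp only [LinearMap.smul_apply, LinearMap.comp_apply,
        eqToHom_refl, ModuleCat.hom_id, LinearMap.id_apply]
  rw [χ.zero_right, Units.val_one, one_smul, act_zero_apply]

def tensUnitLeft (M : HH χ) : (unitObj χ).tens M ≅ M :=
  mkIso (unitLeftFwd M) (fun g => (unitObj χ).qmk M (zero_add g) (e χ 0 rfl))
    (fun a g z => by
      refine LinearMap.congr_fun (f := unitLeftFwd M g ∘ₗ ((unitObj χ).tens M).act a g)
        (g := M.act a g ∘ₗ unitLeftFwd M g) (qext_unit_left fun m => ?_) z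
      rw [LinearMap.comp_apply, LinearMap.comp_apply, act_qmk', map_smul, unitLeftFwd_qmk,
        unitLeftFwd_qmk, χ.zero_right, Units.val_one, one_smul])
    (fun g => qext_unit_left fun m => by
      rw [LinearMap.comp_apply, unitLeftFwd_qmk]; rfl)
    (fun g => by
      ext m
      exact unitLeftFwd_qmk M m)

theorem tensUnitLeft_qmk (M : HH χ) {g : G} (m : M.obj g) :
    lin (tensUnitLeft M).hom g ((unitObj χ).qmk M (zero_add g) (e χ 0 rfl) m) = m :=
  unitLeftFwd_qmk M m

def unitRightFwd (M : HH χ) (g : G) : (M.tens (unitObj χ)).obj g →ₗ[k] M.obj g :=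
  qlift (fun x y h => LinearMap.flip (elift fun b hy => (((χ b x)⁻¹ : kˣ) : k) •
      (M.act b g ∘ₗ (eqToHom (congrArg M.obj (show x = g by rw [← h, hy, add_zero]))).hom)))
    (fun a x y h m u => by
      have hx0 : ∀ hy : y = 0, x = g := fun hy => by rw [← h, hy, add_zero]
      refine Eq.trans (LinearMap.congr_fun (f := (((χ y a)⁻¹ : kˣ) : k) •
        (LinearMap.applyₗ (M.act a x m) ∘ₗ (elift fun b hx => (((χ b x)⁻¹ : kˣ) : k) •
          (M.act b g ∘ₗ (eqToHom (congrArg M.obj (hx0 hx))).hom))))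
        (g := ((χ a x : kˣ) : k) • (LinearMap.applyₗ m ∘ₗ
          (elift fun b hx => (((χ b x)⁻¹ : kˣ) : k) •
          (M.act b g ∘ₗ (eqToHom (congrArg M.obj (hx0 hx))).hom))) ∘ₗ (unitObj χ).act a y)
        (eext fun b hx => ?_) u) rfl
      subst hx
      obtain rfl : x = g := hx0 rfl
      simp only [LinearMap.smul_apply, LinearMap.comp_apply]
      rw [act_e, elift_e, elift_e]
      simp only [LinearMap.applyₗ_apply_apply, LinearMap.smul_apply, LinearMap.comp_apply,
        eqToHom_refl, ModuleCat.hom_id, LinearMap.id_apply]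
      rw [χ.zero_left, inv_one, Units.val_one, one_smul, smul_smul, χ.map_add_left, mul_inv,
        Units.val_mul, ← mul_assoc, Units.mul_inv, one_mul, add_comm a b, act_add_apply])

theorem unitRightFwd_qmk (M : HH χ) {g : G} (m : M.obj g) :
    unitRightFwd M g (M.qmk (unitObj χ) (add_zero g) m (e χ 0 rfl)) = m := by
  rw [unitRightFwd, qlift_qmk, LinearMap.flip_apply, elift_e]
  simp only [LinearMap.smul_apply, LinearMap.comp_apply,
        eqToHom_refl, ModuleCat.hom_id, LinearMap.id_apply]
  rw [χ.zero_left, inv_one, Units.val_one, one_smul, act_zero_apply]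

def tensUnitRight (M : HH χ) : M.tens (unitObj χ) ≅ M :=
  mkIso (unitRightFwd M) (fun g => (M.qmk (unitObj χ) (add_zero g)).flip (e χ 0 rfl))
    (fun a g z => by
      refine LinearMap.congr_fun (f := unitRightFwd M g ∘ₗ (M.tens (unitObj χ)).act a g)
        (g := M.act a g ∘ₗ unitRightFwd M g) (qext_unit_right fun m => ?_) z
      rw [LinearMap.comp_apply, LinearMap.comp_apply, act_qmk, map_smul, unitRightFwd_qmk,
        unitRightFwd_qmk, χ.zero_left, inv_one, Units.val_one, one_smul])
    (fun g => qext_unit_right fun m => by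
      rw [LinearMap.comp_apply, unitRightFwd_qmk]; rfl)
    (fun g => by
      ext m
      exact unitRightFwd_qmk M m)

theorem tensUnitRight_qmk (M : HH χ) {g : G} (m : M.obj g) :
    lin (tensUnitRight M).hom g (M.qmk (unitObj χ) (add_zero g) m (e χ 0 rfl)) = m :=
  unitRightFwd_qmk M m

instance : MonoidalCategoryStruct (HH χ) where
  tensorObj M N := M.tens N
  whiskerLeft M _ _ f := tensMap (𝟙 M) f
  whiskerRight f N := tensMap f (𝟙 N)
  tensorHom f f' := tensMap f f'
  tensorUnit := unitObj χ
  associator M N P := tensAssoc M N P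
  leftUnitor M := tensUnitLeft M
  rightUnitor M := tensUnitRight M

theorem tensMap_id (M N : HH χ) : tensMap (𝟙 M) (𝟙 N) = 𝟙 (M.tens N) :=
  hom_ext' fun _ => qext fun _ _ _ _ _ => by rw [tensMap_qmk]; rfl

theorem tensMap_comp {M N P M' N' P' : HH χ} (f : M ⟶ N) (f' : N ⟶ P) (h : M' ⟶ N') (h' : N' ⟶ P') :
    tensMap f h ≫ tensMap f' h' = tensMap (f ≫ f') (h ≫ h') :=
  hom_ext' fun _ => qext fun _ _ _ _ _ => by
    rw [lin_comp, LinearMap.comp_apply, tensMap_qmk, tensMap_qmk, tensMap_qmk]; rfl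

theorem tensAssoc_naturality {M N P M' N' P' : HH χ} (f : M ⟶ M') (f' : N ⟶ N') (f'' : P ⟶ P') :
    tensMap (tensMap f f') f'' ≫ (tensAssoc M' N' P').hom =
      (tensAssoc M N P).hom ≫ tensMap f (tensMap f' f'') :=
  hom_ext' fun g => qext3' fun u z hu x y hx m n p => by
    have hg' : x + (y + z) = g := by rw [← hu, ← hx, add_assoc]
    rw [lin_comp, lin_comp, LinearMap.comp_apply, LinearMap.comp_apply, tensMap_qmk, tensMap_qmk,
      tensAssoc_qmk _ _ _ hx rfl hu hg', tensAssoc_qmk _ _ _ hx rfl hu hg', tensMap_qmk,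
      tensMap_qmk]

theorem tensUnitLeft_naturality {M N : HH χ} (f : M ⟶ N) :
    tensMap (𝟙 (unitObj χ)) f ≫ (tensUnitLeft N).hom = (tensUnitLeft M).hom ≫ f :=
  hom_ext' fun g => qext_unit_left fun m => by
    rw [lin_comp, lin_comp, LinearMap.comp_apply, LinearMap.comp_apply, tensMap_qmk,
      tensUnitLeft_qmk, lin_id, LinearMap.id_apply, tensUnitLeft_qmk]

theorem tensUnitRight_naturality {M N : HH χ} (f : M ⟶ N) :
    tensMap f (𝟙 (unitObj χ)) ≫ (tensUnitRight N).hom = (tensUnitRight M).hom ≫ f :=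
  hom_ext' fun g => qext_unit_right fun m => by
    rw [lin_comp, lin_comp, LinearMap.comp_apply, LinearMap.comp_apply, tensMap_qmk,
      tensUnitRight_qmk, lin_id, LinearMap.id_apply, tensUnitRight_qmk]

theorem tens_pentagon (M N P R : HH χ) :
    tensMap (tensAssoc M N P).hom (𝟙 R) ≫ (tensAssoc M (N.tens P) R).hom ≫
        tensMap (𝟙 M) (tensAssoc N P R).hom =
      (tensAssoc (M.tens N) P R).hom ≫ (tensAssoc M N (P.tens R)).hom :=
  hom_ext' fun g => qext4' fun w t h v z h'' x y h' a b c d => by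
    subst h' h'' h
    simp only [lin_comp, LinearMap.comp_apply]
    rw [tensMap_qmk, tensAssoc_qmk M N P (v := y + z) rfl rfl rfl (add_assoc x y z).symm,
      tensAssoc_qmk M (N.tens P) R (v := y + (z + t)) _ (add_assoc y z t) _ (by abel), tensMap_qmk,
      lin_id, lin_id, LinearMap.id_apply, LinearMap.id_apply,
      tensAssoc_qmk N P R (v := z + t) rfl rfl _ rfl,
      tensAssoc_qmk (M.tens N) P R (v := z + t) rfl rfl _ (add_assoc (x + y) z t).symm,
      tensAssoc_qmk M N (P.tens R) (v := y + (z + t)) rfl rfl]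

theorem tens_triangle (M N : HH χ) :
    (tensAssoc M (unitObj χ) N).hom ≫ tensMap (𝟙 M) (tensUnitLeft N).hom =
      tensMap (tensUnitRight M).hom (𝟙 N) := by
  have key : (tensAssoc M (unitObj χ) N).inv ≫ tensMap (tensUnitRight M).hom (𝟙 N) =
      tensMap (𝟙 M) (tensUnitLeft N).hom := by
    refine hom_ext' fun g => qext fun x v hx m q => ?_
    refine LinearMap.congr_fun (f := lin ((tensAssoc M (unitObj χ) N).inv ≫
      tensMap (tensUnitRight M).hom (𝟙 N)) g ∘ₗ M.qmk ((unitObj χ).tens N) hx m)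
      (g := lin (tensMap (𝟙 M) (tensUnitLeft N).hom) g ∘ₗ M.qmk ((unitObj χ).tens N) hx m)
      (qext_unit_left fun n => ?_) q
    simp only [lin_comp, LinearMap.comp_apply]
    rw [tensMap_qmk, tensUnitLeft_qmk]
    change lin (tensMap (tensUnitRight M).hom (𝟙 N)) g (assocBwd M (unitObj χ) N g _) = _
    rw [assocBwd_qmk M (unitObj χ) N (add_zero x) (zero_add v) hx hx, tensMap_qmk,
      tensUnitRight_qmk]
    rfl
  rw [← key, Iso.hom_inv_id_assoc]

instance : MonoidalCategory (HH χ) :=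
  MonoidalCategory.ofTensorHom
    (id_tensorHom_id := tensMap_id)
    (id_tensorHom := fun _ _ _ _ => rfl)
    (tensorHom_id := fun _ _ => rfl)
    (tensorHom_comp_tensorHom := fun f₁ f₂ g₁ g₂ => tensMap_comp f₁ g₁ f₂ g₂)
    (associator_naturality := fun f₁ f₂ f₃ => tensAssoc_naturality f₁ f₂ f₃)
    (leftUnitor_naturality := fun f => tensUnitLeft_naturality f)
    (rightUnitor_naturality := fun f => tensUnitRight_naturality f)
    (pentagon := tens_pentagon)
    (triangle := tens_triangle)

end HH


namespace HH

variable {χ : Bicharacter k G}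

theorem act_neg_act (M : HH χ) (a : G) {g : G} (m : M.obj g) : M.act (-a) g (M.act a g m) = m := by
  rw [← act_add_apply, neg_add_cancel, act_zero_apply]

theorem act_act_neg (M : HH χ) (a : G) {g : G} (m : M.obj g) : M.act a g (M.act (-a) g m) = m := by
  rw [← act_add_apply, add_neg_cancel, act_zero_apply]

theorem act_comm (M : HH χ) (a b : G) {g : G} (m : M.obj g) :
    M.act a g (M.act b g m) = M.act b g (M.act a g m) := by
  rw [← act_add_apply, add_comm, act_add_apply]

/-- The value of `ς` at `M`: it is `τ_{g,0}` on `M_g`. -/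
def sigmaIso (M : HH χ) : M ≅ M :=
  mkIso (fun g => (component M.tau.hom g 0 (zero_add g) (add_zero g)).hom)
    (fun g => M.act (-g) g)
    (fun a g m => by rw [component_eq_act]; exact M.act_comm g a m)
    (fun g => by rw [component_eq_act]; ext m; exact M.act_neg_act g m)
    (fun g => by rw [component_eq_act]; ext m; exact M.act_act_neg g m)

theorem lin_sigmaIso (M : HH χ) (g : G) : lin M.sigmaIso.hom g = M.act g g :=
  congrArg ModuleCat.Hom.hom (component_eq_act M g 0 (zero_add g) (add_zero g))

/-- The canonical automorphism `ς` of the identity functor of `HH(B)`. -/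
def sigma (χ : Bicharacter k G) : 𝟭 (HH χ) ≅ 𝟭 (HH χ) :=
  NatIso.ofComponents sigmaIso fun {M N} f => hom_ext' fun g => by
    ext m
    change lin N.sigmaIso.hom g (lin f g m) = lin f g (lin M.sigmaIso.hom g m)
    rw [lin_sigmaIso, lin_sigmaIso, lin_act]

theorem sigma_app (M : HH χ) : (sigma χ).hom.app M = M.sigmaIso.hom := rfl

/-- `ς` is monoidal. -/
theorem sigma_tensor (M N : HH χ) :
    (M ⊗ N : HH χ).sigmaIso.hom = M.sigmaIso.hom ⊗ₘ N.sigmaIso.hom :=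
  hom_ext' fun g => qext fun x y h m n => by
    refine Eq.trans ?_ (tensMap_qmk _ _ h m n).symm
    change lin (M.tens N).sigmaIso.hom g _ = _
    rw [lin_sigmaIso, lin_sigmaIso, lin_sigmaIso]
    subst h
    rw [act_add_apply, act_qmk', map_smul, act_qmk, smul_smul, Units.mul_inv, one_smul]

theorem sigma_unit : (𝟙_ (HH χ)).sigmaIso.hom = 𝟙 (𝟙_ (HH χ)) :=
  hom_ext' fun g => eext fun b h => by
    change lin (unitObj χ).sigmaIso.hom g _ = _
    rw [lin_sigmaIso, act_e]
    subst h
    rw [zero_add]; rfl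

/-- The objects `M` with `ς_M = id`. -/
def stable (χ : Bicharacter k G) : ObjectProperty (HH χ) :=
  fun M => (sigma χ).hom.app M = 𝟙 M

instance : (stable χ).IsMonoidal where
  prop_unit := sigma_unit
  prop_tensor M N hM hN := by
    change (M ⊗ N : HH χ).sigmaIso.hom = _
    change M.sigmaIso.hom = 𝟙 M at hM
    change N.sigmaIso.hom = 𝟙 N at hN
    rw [sigma_tensor, hM, hN, id_tensorHom_id]

end HH

/-- The cyclic homology category `HC(B)`: the full monoidal subcategory of the stable objects. -/
abbrev HC (χ : Bicharacter k G) := (HH.stable χ).FullSubcategory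

instance piPreadditive {I : Type*} (C : I → Type*) [∀ i, Category (C i)]
    [∀ i, Preadditive (C i)] : Preadditive (∀ i, C i) where
  homGroup X Y := inferInstanceAs (AddCommGroup (∀ i, X i ⟶ Y i))
  add_comp _ _ _ _ _ _ := funext fun _ => Preadditive.add_comp _ _ _ _ _ _
  comp_add _ _ _ _ _ _ := funext fun _ => Preadditive.comp_add _ _ _ _ _ _

instance piLinear {I : Type*} (R : Type*) [Semiring R] (C : I → Type*) [∀ i, Category (C i)]
    [∀ i, Preadditive (C i)] [∀ i, Linear R (C i)] : Linear R (∀ i, C i) where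
  homModule X Y := inferInstanceAs (Module R (∀ i, X i ⟶ Y i))
  smul_comp _ _ _ _ _ _ := funext fun _ => Linear.smul_comp _ _ _ _ _ _
  comp_smul _ _ _ _ _ _ := funext fun _ => Linear.comp_smul _ _ _ _ _ _

instance : Preadditive (GVec k G) := piPreadditive (fun _ : G => ModuleCat.{u} k)

instance : Linear k (GVec k G) := piLinear k (fun _ : G => ModuleCat.{u} k)

namespace HH

variable {χ : Bicharacter k G}

/-- The morphisms `M ⟶ N`, as a subspace of the space of all families of linear maps. -/
def homSubmodule (M N : HH χ) : Submodule k (∀ g, M.obj g →ₗ[k] N.obj g) where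
  carrier := {f | ∀ (a g : G) (m : M.obj g), f g (M.act a g m) = N.act a g (f g m)}
  add_mem' {f f'} hf hf' a g m := by
    simp only [Pi.add_apply, LinearMap.add_apply, map_add, hf a g m, hf' a g m]
  zero_mem' a g m := by simp
  smul_mem' c f hf a g m := by
    simp only [Pi.smul_apply, LinearMap.smul_apply, map_smul, hf a g m]

/-- Morphisms are the elements of `homSubmodule`; this gives them their linear structure. -/
def homEquiv (M N : HH χ) : (M ⟶ N) ≃ homSubmodule M N where
  toFun f := ⟨lin f, fun a _ m => lin_act f a m⟩
  invFun f := mkHom f.1 f.2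
  left_inv _ := hom_ext' fun _ => rfl
  right_inv _ := rfl

instance (M N : HH χ) : AddCommGroup (M ⟶ N) := (homEquiv M N).addCommGroup

instance (M N : HH χ) : Module k (M ⟶ N) := (homEquiv M N).module k

theorem lin_add {M N : HH χ} (f f' : M ⟶ N) (g : G) : lin (f + f') g = lin f g + lin f' g := rfl

theorem lin_smul {M N : HH χ} (c : k) (f : M ⟶ N) (g : G) : lin (c • f) g = c • lin f g := rfl

instance : Preadditive (HH χ) where
  add_comp _ _ _ f f' h := hom_ext' fun g => by
    rw [lin_comp, lin_add, lin_add, lin_comp, lin_comp, LinearMap.comp_add]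
  comp_add _ _ _ f h h' := hom_ext' fun g => by
    rw [lin_comp, lin_add, lin_add, lin_comp, lin_comp, LinearMap.add_comp]

instance : Linear k (HH χ) where
  smul_comp _ _ _ c f h := hom_ext' fun g => by
    rw [lin_comp, lin_smul, lin_smul, lin_comp, LinearMap.comp_smul]
  comp_smul _ _ _ f c h := hom_ext' fun g => by
    rw [lin_comp, lin_smul, lin_smul, lin_comp, LinearMap.smul_comp]

end HH



/-- The category `M_ι(Vec)` of `ι × ι` matrices with vector space entries. -/
def Mat (k : Type u) [Field k] (ι : Type) : Type (u + 1) := ι → ι → ModuleCat.{u} k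

namespace Mat

open scoped TensorProduct DirectSum

variable {ι : Type}

instance : Category (Mat k ι) := inferInstanceAs (Category (ι → ι → ModuleCat.{u} k))

instance : Preadditive (Mat k ι) :=
  inferInstanceAs (Preadditive (∀ _ : ι, ∀ _ : ι, ModuleCat.{u} k))

instance : Linear k (Mat k ι) :=
  inferInstanceAs (Linear k (∀ _ : ι, ∀ _ : ι, ModuleCat.{u} k))

/-- A morphism of matrices is a family of linear maps. -/
def ofLin {A B : Mat k ι} (f : ∀ i j, A i j →ₗ[k] B i j) : A ⟶ B :=
  fun i j => ModuleCat.ofHom (f i j)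

def lin {A B : Mat k ι} (f : A ⟶ B) (i j : ι) : A i j →ₗ[k] B i j := (f i j).hom

theorem hom_ext' {A B : Mat k ι} {f f' : A ⟶ B} (h : ∀ i j, lin f i j = lin f' i j) : f = f' := by
  funext i j
  exact ModuleCat.hom_ext (h i j)

theorem lin_ofLin {A B : Mat k ι} (f : ∀ i j, A i j →ₗ[k] B i j) (i j : ι) :
    lin (ofLin f) i j = f i j := rfl

theorem lin_id (A : Mat k ι) (i j : ι) : lin (𝟙 A) i j = LinearMap.id := rfl

theorem lin_comp {A B C : Mat k ι} (f : A ⟶ B) (f' : B ⟶ C) (i j : ι) :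
    lin (f ≫ f') i j = lin f' i j ∘ₗ lin f i j := rfl

def isoOfLin {A B : Mat k ι} (f : ∀ i j, A i j →ₗ[k] B i j) (f' : ∀ i j, B i j →ₗ[k] A i j)
    (h : ∀ i j, f' i j ∘ₗ f i j = LinearMap.id) (h' : ∀ i j, f i j ∘ₗ f' i j = LinearMap.id) :
    A ≅ B where
  hom := ofLin f
  inv := ofLin f'
  hom_inv_id := hom_ext' h
  inv_hom_id := hom_ext' h'

/-- Matrix multiplication, `(A ⬝ B)ᵢⱼ = ⨁ₗ Aᵢₗ ⊗ Bₗⱼ`. -/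
def mul (A B : Mat k ι) : Mat k ι := fun i j => ModuleCat.of k (⨁ l : ι, A i l ⊗[k] B l j)

/-- The identity matrix: `k` on the diagonal and zero elsewhere. -/
def one (k : Type u) [Field k] (ι : Type) : Mat k ι :=
  fun i j => ModuleCat.of k (PLift (i = j) →₀ k)

/-- The basis vector of a diagonal entry of the identity matrix. -/
def basis (k : Type u) [Field k] {i j : ι} (h : i = j) : one k ι i j :=
  Finsupp.single (PLift.up h) (1 : k)

/-- The linear map out of an entry of the identity matrix with prescribed value. -/
def oneLift {i j : ι} {T : Type u} [AddCommGroup T] [Module k T] (t : i = j → T) :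
    one k ι i j →ₗ[k] T :=
  Finsupp.linearCombination k (fun p : PLift (i = j) => t p.down)

theorem oneLift_basis {i j : ι} {T : Type u} [AddCommGroup T] [Module k T] (t : i = j → T)
    (h : i = j) : oneLift t (basis k h) = t h := by
  refine (Finsupp.linearCombination_single k (1 : k) (PLift.up h)).trans ?_
  rw [one_smul]

theorem one_ext {i j : ι} {T : Type u} [AddCommGroup T] [Module k T] {f f' : one k ι i j →ₗ[k] T}
    (h : ∀ e : i = j, f (basis k e) = f' (basis k e)) : f = f' := by
  apply Finsupp.lhom_ext'
  rintro ⟨e⟩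
  ext
  exact h e

variable [DecidableEq ι]

/-- The pairing `A_{il} × B_{lj} → (A ⬝ B)_{ij}`. -/
def mk (A B : Mat k ι) (i l j : ι) : A i l →ₗ[k] B l j →ₗ[k] (mul A B) i j :=
  TensorProduct.curry (DirectSum.lof k ι (fun l => A i l ⊗[k] B l j) l)

/-- The linear map out of `(A ⬝ B)_{ij}` given by bilinear maps. -/
def lift {A B : Mat k ι} {i j : ι} {T : Type u} [AddCommGroup T] [Module k T]
    (φ : ∀ l, A i l →ₗ[k] B l j →ₗ[k] T) : (mul A B) i j →ₗ[k] T :=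
  DirectSum.toModule k ι T (fun l => TensorProduct.lift (φ l))

theorem lift_mk {A B : Mat k ι} {i j : ι} {T : Type u} [AddCommGroup T] [Module k T]
    (φ : ∀ l, A i l →ₗ[k] B l j →ₗ[k] T) (l : ι) (a : A i l) (b : B l j) :
    lift φ (mk A B i l j a b) = φ l a b :=
  (DirectSum.toModule_lof k (φ := fun l => TensorProduct.lift (φ l)) l (a ⊗ₜ[k] b)).trans
    (TensorProduct.lift.tmul a b)

theorem ext {A B : Mat k ι} {i j : ι} {T : Type u} [AddCommGroup T] [Module k T]
    {f f' : (mul A B) i j →ₗ[k] T}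
    (h : ∀ (l : ι) (a : A i l) (b : B l j), f (mk A B i l j a b) = f' (mk A B i l j a b)) :
    f = f' :=
  DirectSum.linearMap_ext k fun l => TensorProduct.ext' fun a b => h l a b

attribute [irreducible] mul one mk lift basis oneLift

theorem ext3 {A B C : Mat k ι} {i j : ι} {T : Type u} [AddCommGroup T] [Module k T]
    {f f' : (mul (mul A B) C) i j →ₗ[k] T}
    (h : ∀ (l m : ι) (a : A i l) (b : B l m) (c : C m j),
      f (mk (mul A B) C i m j (mk A B i l m a b) c) =
        f' (mk (mul A B) C i m j (mk A B i l m a b) c)) : f = f' := by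
  apply ext
  intro m ab c
  have : f ∘ₗ (mk (mul A B) C i m j).flip c = f' ∘ₗ (mk (mul A B) C i m j).flip c :=
    ext fun l a b => h l m a b c
  exact LinearMap.congr_fun this ab

theorem ext3' {A B C : Mat k ι} {i j : ι} {T : Type u} [AddCommGroup T] [Module k T]
    {f f' : (mul A (mul B C)) i j →ₗ[k] T}
    (h : ∀ (l m : ι) (a : A i l) (b : B l m) (c : C m j),
      f (mk A (mul B C) i l j a (mk B C l m j b c)) =
        f' (mk A (mul B C) i l j a (mk B C l m j b c))) : f = f' := by
  apply ext
  intro l a bc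
  have : f ∘ₗ (mk A (mul B C) i l j a) = f' ∘ₗ (mk A (mul B C) i l j a) :=
    ext fun m b c => h l m a b c
  exact LinearMap.congr_fun this bc

theorem ext4 {A B C D : Mat k ι} {i j : ι} {T : Type u} [AddCommGroup T] [Module k T]
    {f f' : (mul (mul (mul A B) C) D) i j →ₗ[k] T}
    (h : ∀ (l m n : ι) (a : A i l) (b : B l m) (c : C m n) (d : D n j),
      f (mk (mul (mul A B) C) D i n j (mk (mul A B) C i m n (mk A B i l m a b) c) d) =
        f' (mk (mul (mul A B) C) D i n j (mk (mul A B) C i m n (mk A B i l m a b) c) d)) :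
    f = f' := by
  apply ext
  intro n abc d
  have : f ∘ₗ (mk (mul (mul A B) C) D i n j).flip d = f' ∘ₗ (mk (mul (mul A B) C) D i n j).flip d :=
    ext3 fun l m a b c => h l m n a b c d
  exact LinearMap.congr_fun this abc

def mulMap {A A' B B' : Mat k ι} (f : A ⟶ A') (f' : B ⟶ B') : mul A B ⟶ mul A' B' :=
  ofLin fun i j => lift (T := mul A' B' i j) fun l =>
    (mk A' B' i l j).compl₁₂ (lin f i l) (lin f' l j)

theorem mulMap_mk {A A' B B' : Mat k ι} (f : A ⟶ A') (f' : B ⟶ B') (i l j : ι) (a : A i l)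
    (b : B l j) : lin (mulMap f f') i j (mk A B i l j a b) =
      mk A' B' i l j (lin f i l a) (lin f' l j b) := by
  rw [mulMap, lin_ofLin, lift_mk, LinearMap.compl₁₂_apply]

def assocFwd (A B C : Mat k ι) (i j : ι) : mul (mul A B) C i j →ₗ[k] mul A (mul B C) i j :=
  lift (T := mul A (mul B C) i j) fun m => lift (T := C m j →ₗ[k] mul A (mul B C) i j) fun l =>
    LinearMap.mk₂ k (fun a b => mk A (mul B C) i l j a ∘ₗ mk B C l m j b)
      (fun _ _ _ => by ext; simp) (fun _ _ _ => by ext; simp)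
      (fun _ _ _ => by ext; simp) (fun _ _ _ => by ext; simp)

theorem assocFwd_mk (A B C : Mat k ι) (i l m j : ι) (a : A i l) (b : B l m) (c : C m j) :
    assocFwd A B C i j (mk (mul A B) C i m j (mk A B i l m a b) c) =
      mk A (mul B C) i l j a (mk B C l m j b c) := by
  rw [assocFwd, lift_mk, lift_mk]; rfl

def assocBwd (A B C : Mat k ι) (i j : ι) : mul A (mul B C) i j →ₗ[k] mul (mul A B) C i j :=
  lift (T := mul (mul A B) C i j) fun l =>
    LinearMap.flip (lift (T := A i l →ₗ[k] mul (mul A B) C i j) fun m =>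
      LinearMap.mk₂ k (fun b c => (mk (mul A B) C i m j).flip c ∘ₗ (mk A B i l m).flip b)
      (fun _ _ _ => by ext; simp) (fun _ _ _ => by ext; simp)
      (fun _ _ _ => by ext; simp) (fun _ _ _ => by ext; simp))

theorem assocBwd_mk (A B C : Mat k ι) (i l m j : ι) (a : A i l) (b : B l m) (c : C m j) :
    assocBwd A B C i j (mk A (mul B C) i l j a (mk B C l m j b c)) =
      mk (mul A B) C i m j (mk A B i l m a b) c := by
  rw [assocBwd, lift_mk, LinearMap.flip_apply, lift_mk]; rfl

def mulAssoc (A B C : Mat k ι) : mul (mul A B) C ≅ mul A (mul B C) :=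
  isoOfLin (assocFwd A B C) (assocBwd A B C)
    (fun i j => ext3 fun l m a b c => by
      rw [LinearMap.comp_apply, assocFwd_mk, assocBwd_mk]; rfl)
    (fun i j => ext3' fun l m a b c => by
      rw [LinearMap.comp_apply, assocBwd_mk, assocFwd_mk]; rfl)

theorem mulAssoc_mk (A B C : Mat k ι) (i l m j : ι) (a : A i l) (b : B l m) (c : C m j) :
    lin (mulAssoc A B C).hom i j (mk (mul A B) C i m j (mk A B i l m a b) c) =
      mk A (mul B C) i l j a (mk B C l m j b c) :=
  assocFwd_mk A B C i l m j a b c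

theorem mulAssoc_inv_mk (A B C : Mat k ι) (i l m j : ι) (a : A i l) (b : B l m) (c : C m j) :
    lin (mulAssoc A B C).inv i j (mk A (mul B C) i l j a (mk B C l m j b c)) =
      mk (mul A B) C i m j (mk A B i l m a b) c :=
  assocBwd_mk A B C i l m j a b c

theorem ext_one_left {A : Mat k ι} {i j : ι} {T : Type u} [AddCommGroup T] [Module k T]
    {f f' : (mul (one k ι) A) i j →ₗ[k] T}
    (h : ∀ a : A i j, f (mk (one k ι) A i i j (basis k rfl) a) =
      f' (mk (one k ι) A i i j (basis k rfl) a)) : f = f' := by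
  apply ext
  intro l u a
  refine LinearMap.congr_fun (f := f ∘ₗ (mk (one k ι) A i l j).flip a)
    (g := f' ∘ₗ (mk (one k ι) A i l j).flip a) (one_ext fun hl => ?_) u
  subst hl
  exact h a

theorem ext_one_right {A : Mat k ι} {i j : ι} {T : Type u} [AddCommGroup T] [Module k T]
    {f f' : (mul A (one k ι)) i j →ₗ[k] T}
    (h : ∀ a : A i j, f (mk A (one k ι) i j j a (basis k rfl)) =
      f' (mk A (one k ι) i j j a (basis k rfl))) : f = f' := by
  apply ext
  intro l a u
  refine LinearMap.congr_fun (f := f ∘ₗ (mk A (one k ι) i l j a))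
    (g := f' ∘ₗ (mk A (one k ι) i l j a)) (one_ext fun hl => ?_) u
  subst hl
  exact h a

def oneMulFwd (A : Mat k ι) (i j : ι) : mul (one k ι) A i j →ₗ[k] A i j :=
  lift fun _ => oneLift fun h => (eqToHom (congrArg (fun x => A x j) h.symm)).hom

theorem oneMulFwd_mk (A : Mat k ι) (i j : ι) (a : A i j) :
    oneMulFwd A i j (mk (one k ι) A i i j (basis k rfl) a) = a := by
  rw [oneMulFwd, lift_mk, oneLift_basis]; rfl

def oneMul (A : Mat k ι) : mul (one k ι) A ≅ A :=
  isoOfLin (oneMulFwd A) (fun i j => mk (one k ι) A i i j (basis k rfl))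
    (fun i j => ext_one_left fun a => by
      rw [LinearMap.comp_apply, oneMulFwd_mk]; rfl)
    (fun i j => by ext a; exact oneMulFwd_mk A i j a)

theorem oneMul_mk (A : Mat k ι) (i j : ι) (a : A i j) :
    lin (oneMul A).hom i j (mk (one k ι) A i i j (basis k rfl) a) = a := oneMulFwd_mk A i j a

def mulOneFwd (A : Mat k ι) (i j : ι) : mul A (one k ι) i j →ₗ[k] A i j :=
  lift fun _ => LinearMap.flip (oneLift fun h => (eqToHom (congrArg (fun x => A i x) h)).hom)

theorem mulOneFwd_mk (A : Mat k ι) (i j : ι) (a : A i j) :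
    mulOneFwd A i j (mk A (one k ι) i j j a (basis k rfl)) = a := by
  rw [mulOneFwd, lift_mk, LinearMap.flip_apply, oneLift_basis]; rfl

def mulOne (A : Mat k ι) : mul A (one k ι) ≅ A :=
  isoOfLin (mulOneFwd A) (fun i j => (mk A (one k ι) i j j).flip (basis k rfl))
    (fun i j => ext_one_right fun a => by
      rw [LinearMap.comp_apply, mulOneFwd_mk]; rfl)
    (fun i j => by ext a; exact mulOneFwd_mk A i j a)

theorem mulOne_mk (A : Mat k ι) (i j : ι) (a : A i j) :
    lin (mulOne A).hom i j (mk A (one k ι) i j j a (basis k rfl)) = a := mulOneFwd_mk A i j a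

instance : MonoidalCategoryStruct (Mat k ι) where
  tensorObj A B := mul A B
  whiskerLeft A _ _ f := mulMap (𝟙 A) f
  whiskerRight f B := mulMap f (𝟙 B)
  tensorHom f f' := mulMap f f'
  tensorUnit := one k ι
  associator A B C := mulAssoc A B C
  leftUnitor A := oneMul A
  rightUnitor A := mulOne A

theorem mul_triangle (A B : Mat k ι) :
    (mulAssoc A (one k ι) B).hom ≫ mulMap (𝟙 A) (oneMul B).hom =
      mulMap (mulOne A).hom (𝟙 B) := by
  have key : (mulAssoc A (one k ι) B).inv ≫ mulMap (mulOne A).hom (𝟙 B) =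
      mulMap (𝟙 A) (oneMul B).hom := by
    refine hom_ext' fun i j => ext fun l a q => ?_
    refine LinearMap.congr_fun (f := lin ((mulAssoc A (one k ι) B).inv ≫
      mulMap (mulOne A).hom (𝟙 B)) i j ∘ₗ mk A (mul (one k ι) B) i l j a)
      (g := lin (mulMap (𝟙 A) (oneMul B).hom) i j ∘ₗ mk A (mul (one k ι) B) i l j a)
      (ext_one_left fun b => ?_) q
    rw [LinearMap.comp_apply, LinearMap.comp_apply, lin_comp, LinearMap.comp_apply,
      mulMap_mk, oneMul_mk, mulAssoc_inv_mk, mulMap_mk, mulOne_mk]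
    rfl
  rw [← key, Iso.hom_inv_id_assoc]

instance : MonoidalCategory (Mat k ι) :=
  MonoidalCategory.ofTensorHom
    (id_tensorHom_id := fun _ _ => hom_ext' fun _ _ => ext fun _ _ _ => mulMap_mk _ _ _ _ _ _ _)
    (id_tensorHom := by intros; rfl)
    (tensorHom_id := by intros; rfl)
    (tensorHom_comp_tensorHom := fun f₁ f₂ g₁ g₂ => hom_ext' fun _ _ => ext fun _ _ _ => by
      change lin (mulMap f₁ f₂ ≫ mulMap g₁ g₂) _ _ _ = lin (mulMap (f₁ ≫ g₁) (f₂ ≫ g₂)) _ _ _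
      rw [lin_comp, LinearMap.comp_apply, mulMap_mk, mulMap_mk, mulMap_mk]; rfl)
    (associator_naturality := fun {A₁ A₂ A₃ B₁ B₂ B₃} f₁ f₂ f₃ => hom_ext' fun _ _ => ext3 fun _ _ _ _ _ => by
      change lin (mulMap (mulMap f₁ f₂) f₃ ≫ (mulAssoc _ _ _).hom) _ _ _ =
        lin ((mulAssoc _ _ _).hom ≫ mulMap f₁ (mulMap f₂ f₃)) _ _ _
      rw [lin_comp, lin_comp, LinearMap.comp_apply, LinearMap.comp_apply, mulMap_mk, mulMap_mk,
        mulAssoc_mk, mulAssoc_mk, mulMap_mk, mulMap_mk])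
    (leftUnitor_naturality := fun {A B} f => hom_ext' fun _ _ => ext_one_left fun _ => by
      change lin (mulMap (𝟙 (one k ι)) f ≫ (oneMul B).hom) _ _ _ =
        lin ((oneMul A).hom ≫ f) _ _ _
      rw [lin_comp, lin_comp, LinearMap.comp_apply, LinearMap.comp_apply, mulMap_mk, oneMul_mk,
        lin_id, LinearMap.id_apply, oneMul_mk])
    (rightUnitor_naturality := fun {A B} f => hom_ext' fun _ _ => ext_one_right fun _ => by
      change lin (mulMap f (𝟙 (one k ι)) ≫ (mulOne B).hom) _ _ _ =
        lin ((mulOne A).hom ≫ f) _ _ _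
      rw [lin_comp, lin_comp, LinearMap.comp_apply, LinearMap.comp_apply, mulMap_mk, mulOne_mk,
        lin_id, LinearMap.id_apply, mulOne_mk])
    (pentagon := fun A B C D => hom_ext' fun _ _ => ext4 fun _ _ _ _ _ _ _ => by
      change lin (mulMap (mulAssoc A B C).hom (𝟙 D) ≫ (mulAssoc A (mul B C) D).hom ≫
        mulMap (𝟙 A) (mulAssoc B C D).hom) _ _ _ =
        lin ((mulAssoc (mul A B) C D).hom ≫ (mulAssoc A B (mul C D)).hom) _ _ _
      simp only [lin_comp, LinearMap.comp_apply]
      rw [mulMap_mk, mulAssoc_mk, mulAssoc_mk, mulMap_mk, lin_id, lin_id, LinearMap.id_apply,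
        LinearMap.id_apply, mulAssoc_mk, mulAssoc_mk, mulAssoc_mk])
    (triangle := mul_triangle)

end Mat


/-- A twist on a braided category: `θ ∈ Aut(Id_C)` with `θ_{X ⊗ Y} = τ_{Y,X} τ_{X,Y} (θ_X ⊗ θ_Y)`. -/
structure Twist (C : Type*) [Category C] [MonoidalCategory C] [BraidedCategory C] where
  iso : 𝟭 C ≅ 𝟭 C
  app_tensor : ∀ X Y : C, iso.hom.app (X ⊗ Y) =
    (iso.hom.app X ⊗ₘ iso.hom.app Y) ≫ (β_ X Y).hom ≫ (β_ Y X).hom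

/-- The twists on `B = (Vec_G, χ)`. -/
abbrev VecTwist (χ : Bicharacter k G) := @Twist (GVec k G) _ _ (vecBraided χ)

namespace Bicharacter

variable (χ : Bicharacter k G)

theorem omega_add_left (x y z : G) : χ.omega (x + y) z = χ.omega x z * χ.omega y z := by
  simp only [omega, χ.map_add_left, χ.map_add_right]; exact mul_mul_mul_comm _ _ _ _

theorem omega_add_right (x y z : G) : χ.omega x (y + z) = χ.omega x y * χ.omega x z := by
  simp only [omega, χ.map_add_left, χ.map_add_right]; exact mul_mul_mul_comm _ _ _ _

theorem theta_add (x y : G) : χ.theta (x + y) = χ.theta x * χ.theta y * χ.omega x y := by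
  simp only [omega, theta, χ.map_add_left, χ.map_add_right]
  rw [mul_assoc, mul_assoc]
  congr 1
  rw [← mul_assoc, mul_comm]

theorem theta_zero : χ.theta 0 = 1 := χ.zero_left 0

theorem omega_zero_right (x : G) : χ.omega x 0 = 1 := by
  rw [omega, χ.zero_left, χ.zero_right, one_mul]

/-- The automorphism of the identity functor of `Vec_G` acting by the scalar `s(g)` in degree `g`. -/
def scalarIso (s : G → kˣ) : 𝟭 (GVec k G) ≅ 𝟭 (GVec k G) :=
  NatIso.ofComponents
    (fun V =>
      { hom := fun g => ModuleCat.ofHom (((s g : kˣ) : k) • (LinearMap.id : V g →ₗ[k] V g))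
        inv := fun g => ModuleCat.ofHom ((((s g)⁻¹ : kˣ) : k) • (LinearMap.id : V g →ₗ[k] V g))
        hom_inv_id := gvec_hom_ext fun g => LinearMap.ext fun v => by
          change (((s g)⁻¹ : kˣ) : k) • ((s g : kˣ) : k) • v = v
          rw [smul_smul, Units.inv_mul, one_smul]
        inv_hom_id := gvec_hom_ext fun g => LinearMap.ext fun v => by
          change ((s g : kˣ) : k) • (((s g)⁻¹ : kˣ) : k) • v = v
          rw [smul_smul, Units.mul_inv, one_smul] })
    (fun {V W} f => gvec_hom_ext fun g => LinearMap.ext fun v => by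
      change ((s g : kˣ) : k) • (f g).hom v = (f g).hom (((s g : kˣ) : k) • v)
      rw [map_smul])

theorem scalarIso_apply (s : G → kˣ) (V : GVec k G) {g : G} (v : V g) :
    ((scalarIso s).hom.app V g).hom v = ((s g : kˣ) : k) • v := rfl

/-- The twist `θ_x = θ · ω(x, -)`, acting by `θ(g) ω(x, g)` in degree `g`; `θ_0` is the ribbon element `θ`. -/
def twist (x : G) : VecTwist χ :=
  letI := vecBraided χ
  { iso := scalarIso fun g => χ.theta g * χ.omega x g
    app_tensor := fun X Y => by
      apply gvec_hom_ext; intro g; apply thom_ext; intro y z h m n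
      refine (scalarIso_apply _ (X ⊗ Y) _).trans ?_
      rw [gcomp_hom, gcomp_hom]
      refine Eq.trans ?_ (congrArg (fun w => (braidingHom χ Y X g).hom
        ((braidingHom χ X Y g).hom w)) (tensorHom_tmk (X := X) (X' := X) (Y := Y) (Y' := Y)
          ((scalarIso fun g => χ.theta g * χ.omega x g).hom.app X)
          ((scalarIso fun g => χ.theta g * χ.omega x g).hom.app Y) h m n)).symm
      refine Eq.trans ?_ (congrArg _ (braidingHom_tmk χ X Y h ((add_comm z y).trans h) _ _)).symm
      rw [map_smul]
      refine Eq.trans ?_ (congrArg _ (braidingHom_tmk χ Y X ((add_comm z y).trans h) h _ _)).symm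
      refine Eq.trans ?_ (congrArg₂ (fun m n => ((χ y z : kˣ) : k) • ((χ z y : kˣ) : k) •
        tmk X Y h m n) (scalarIso_apply _ X m) (scalarIso_apply _ Y n)).symm
      simp only [map_smul, LinearMap.smul_apply, smul_smul, ← Units.val_mul]
      congr 2
      rw [← h, χ.theta_add, χ.omega_add_right, omega]
      generalize χ.theta y = p, χ.theta z = q, χ.omega x y = r, χ.omega x z = s, χ y z = t,
        χ z y = u
      simp only [mul_comm, mul_left_comm] }

end Bicharacter

/-- The one-dimensional space in degree `a`. -/
def delta (k : Type u) [Field k] {G : Type u} (a : G) : GVec k G :=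
  fun g => ModuleCat.of k (PLift (a = g) →₀ k)

def deltaGen (k : Type u) [Field k] {G : Type u} (a : G) : delta k a a :=
  Finsupp.single ⟨rfl⟩ (1 : k)

/-- The morphism from the one-dimensional space determined by a vector of degree `a`. -/
def deltaHom {V : GVec k G} {a : G} (v : V a) : delta k a ⟶ V := fun g =>
  ModuleCat.ofHom (Finsupp.linearCombination k fun p : PLift (a = g) =>
    (eqToHom (congrArg V p.down)).hom v)

theorem deltaHom_gen {V : GVec k G} {a : G} (v : V a) :
    (deltaHom v a).hom (deltaGen k a) = v := by
  refine (Finsupp.linearCombination_single k (1 : k) (PLift.up rfl)).trans ?_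
  rw [one_smul]; rfl

def deltaCoeff (a : G) : delta k a a →ₗ[k] k := Finsupp.lapply (⟨rfl⟩ : PLift (a = a))

theorem deltaCoeff_gen (a : G) : deltaCoeff a (deltaGen k a) = 1 := Finsupp.single_eq_same

theorem delta_eq (a : G) (v : delta k a a) : v = deltaCoeff a v • deltaGen k a := by
  refine Finsupp.ext ?_
  rintro ⟨_⟩
  change deltaCoeff a v = deltaCoeff a (deltaCoeff a v • deltaGen k a)
  rw [map_smul, deltaCoeff_gen, smul_eq_mul, mul_one]

theorem nat_apply (f : 𝟭 (GVec k G) ⟶ 𝟭 (GVec k G)) (V : GVec k G) {g : G} (v : V g) :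
    (f.app V g).hom v = deltaCoeff g ((f.app (delta k g) g).hom (deltaGen k g)) • v := by
  have h : (f.app V g).hom ((deltaHom v g).hom (deltaGen k g)) =
      (deltaHom v g).hom ((f.app (delta k g) g).hom (deltaGen k g)) :=
    congrArg (fun φ => (φ g).hom (deltaGen k g)) (f.naturality (deltaHom v))
  rw [deltaHom_gen] at h
  rw [h, delta_eq g ((f.app (delta k g) g).hom (deltaGen k g)), map_smul, deltaHom_gen,
    map_smul, deltaCoeff_gen, smul_eq_mul, mul_one]

def deltaSum (k : Type u) [Field k] {G : Type u} (a g : G) : delta k a g →ₗ[k] k :=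
  Finsupp.linearCombination k fun _ : PLift (a = g) => (1 : k)

theorem deltaSum_gen (a : G) : deltaSum k a a (deltaGen k a) = 1 :=
  (Finsupp.linearCombination_single k (1 : k) (PLift.up rfl)).trans (one_smul k 1)

theorem exists_deltaTensor_apply_eq_one (x y : G) :
    ∃ ψ : (delta k x ⊗ delta k y : GVec k G) (x + y) →ₗ[k] k,
      ψ (tmk (delta k x) (delta k y) rfl (deltaGen k x) (deltaGen k y)) = 1 := by
  refine ⟨tlift fun x' y' _ => (LinearMap.mul k k).compl₁₂ (deltaSum k x x') (deltaSum k y y'), ?_⟩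
  rw [tlift_tmk, LinearMap.compl₁₂_apply, deltaSum_gen, deltaSum_gen, LinearMap.mul_apply', mul_one]

namespace VecTwist

variable {χ : Bicharacter k G} (t : VecTwist χ)

/-- The scalar by which a twist acts in degree `g`. -/
def scalar (g : G) : kˣ :=
  letI := vecBraided χ
  { val := deltaCoeff g ((t.iso.hom.app (delta k g) g).hom (deltaGen k g))
    inv := deltaCoeff g ((t.iso.inv.app (delta k g) g).hom (deltaGen k g))
    val_inv := by
      have h : (t.iso.hom.app (delta k g) g).hom ((t.iso.inv.app (delta k g) g).hom (deltaGen k g)) =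
        deltaGen k g := congrArg (fun φ => (φ g).hom (deltaGen k g)) (t.iso.inv_hom_id_app (delta k g))
      rw [nat_apply t.iso.hom] at h
      have := congrArg (deltaCoeff g) h
      rwa [map_smul, deltaCoeff_gen, smul_eq_mul] at this
    inv_val := by
      have h : (t.iso.hom.app (delta k g) g).hom ((t.iso.inv.app (delta k g) g).hom (deltaGen k g)) =
        deltaGen k g := congrArg (fun φ => (φ g).hom (deltaGen k g)) (t.iso.inv_hom_id_app (delta k g))
      rw [nat_apply t.iso.hom] at h
      have := congrArg (deltaCoeff g) h
      rw [map_smul, deltaCoeff_gen, smul_eq_mul] at this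
      rwa [mul_comm] }

theorem app_apply (V : GVec k G) {g : G} (v : V g) :
    letI := vecBraided χ
    (t.iso.hom.app V g).hom v = ((scalar t g : kˣ) : k) • v := nat_apply _ V v

theorem scalar_add (x y : G) : scalar t (x + y) = scalar t x * scalar t y * χ.omega x y := by
  let _ := vecBraided χ
  set w := tmk (delta k x) (delta k y) (rfl : x + y = x + y) (deltaGen k x) (deltaGen k y) with hw
  have h1 : (t.iso.hom.app (delta k x ⊗ delta k y) (x + y)).hom w =
      ((scalar t (x + y) : kˣ) : k) • w := app_apply t _ w
  have h2 : (t.iso.hom.app (delta k x ⊗ delta k y) (x + y)).hom w =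
      (braidingHom χ _ _ (x + y)).hom ((braidingHom χ _ _ (x + y)).hom
        (((t.iso.hom.app (delta k x) ⊗ₘ t.iso.hom.app (delta k y)) (x + y)).hom w)) :=
    congrArg (fun φ => (φ (x + y)).hom w) (t.app_tensor (delta k x) (delta k y))
  have h2' := h2.trans (congrArg (fun w => (braidingHom χ _ _ (x + y)).hom
    ((braidingHom χ _ _ (x + y)).hom w)) (tensorHom_tmk (X := delta k x) (X' := delta k x)
      (Y := delta k y) (Y' := delta k y) (t.iso.hom.app (delta k x)) (t.iso.hom.app (delta k y))
      rfl (deltaGen k x) (deltaGen k y)))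
  have h3 : (t.iso.hom.app (delta k x) x).hom (deltaGen k x) = _ := app_apply t _ (deltaGen k x)
  have h4 : (t.iso.hom.app (delta k y) y).hom (deltaGen k y) = _ := app_apply t _ (deltaGen k y)
  rw [h1] at h2'
  have h5 := h2'.trans (congrArg₂ (fun m n => (braidingHom χ _ _ (x + y)).hom
    ((braidingHom χ _ _ (x + y)).hom (tmk (delta k x) (delta k y) rfl m n))) h3 h4)
  simp only [map_smul, LinearMap.smul_apply] at h5
  rw [braidingHom_tmk χ _ _ rfl (add_comm y x), map_smul,
    braidingHom_tmk χ _ _ (add_comm y x) rfl, ← hw] at h5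
  simp only [smul_smul, ← Units.val_mul] at h5
  obtain ⟨ψ, hψ⟩ := exists_deltaTensor_apply_eq_one (k := k) x y
  have h6 := congrArg ψ h5
  rw [map_smul, map_smul, hw, hψ, smul_eq_mul, smul_eq_mul, mul_one, mul_one] at h6
  rw [Units.ext_iff, h6, Bicharacter.omega]
  generalize scalar t x = p, scalar t y = q, χ x y = r, χ y x = s
  simp only [Units.val_mul]
  ring

theorem scalar_zero : scalar t 0 = 1 := by
  have h := scalar_add t 0 0
  rw [add_zero, χ.omega_zero_right, mul_one] at h
  exact (left_eq_mul.mp h)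

/-- The scalar `t(a) θ(a)⁻¹ χ(a, y)`. -/
def coeff (a y : G) : kˣ := scalar t a * (χ.theta a)⁻¹ * χ a y

theorem coeff_zero_left (y : G) : coeff t 0 y = 1 := by
  rw [coeff, scalar_zero, χ.theta_zero, χ.zero_left, inv_one, one_mul, one_mul]

theorem coeff_add_left (a b y : G) : coeff t (a + b) y = coeff t a y * coeff t b y := by
  simp only [coeff]
  rw [scalar_add, χ.theta_add, χ.map_add_left]
  generalize scalar t a = p, scalar t b = q, χ.omega a b = r, χ.theta a = s, χ.theta b = v,
    χ a y = w, χ b y = z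
  simp only [mul_inv]
  rw [show p * q * r * (s⁻¹ * v⁻¹ * r⁻¹) * (w * z) =
    (p * q * (s⁻¹ * v⁻¹) * (w * z)) * (r * r⁻¹) by
      simp only [mul_comm, mul_left_comm, mul_assoc], mul_inv_cancel, mul_one]
  simp only [mul_comm, mul_left_comm, mul_assoc]

theorem coeff_add_right (a x y : G) : coeff t a (x + y) = χ a x * coeff t a y := by
  simp only [coeff]
  rw [χ.map_add_right, mul_left_comm]

end VecTwist

/-- The module category `B_t`: the category `Vec_G` with the action of `HH(B)` defined by the twist `t`. -/
def TwistMod (χ : Bicharacter k G) (_ : VecTwist χ) : Type (u + 1) := GVec k G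

namespace TwistMod

variable {χ : Bicharacter k G} {t : VecTwist χ}

instance : Category (TwistMod χ t) := inferInstanceAs (Category (GVec k G))

instance : Preadditive (TwistMod χ t) := inferInstanceAs (Preadditive (GVec k G))

instance : Linear k (TwistMod χ t) := inferInstanceAs (Linear k (GVec k G))

def ofLin {V W : TwistMod χ t} (f : ∀ g, V g →ₗ[k] W g) : V ⟶ W := fun g => ModuleCat.ofHom (f g)

def lin {V W : TwistMod χ t} (f : V ⟶ W) (g : G) : V g →ₗ[k] W g := (f g).hom

theorem hom_ext' {V W : TwistMod χ t} {f f' : V ⟶ W} (h : ∀ g, lin f g = lin f' g) : f = f' :=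
  gvec_hom_ext h

theorem lin_ofLin {V W : TwistMod χ t} (f : ∀ g, V g →ₗ[k] W g) (g : G) : lin (ofLin f) g = f g :=
  rfl

theorem lin_id (V : TwistMod χ t) (g : G) : lin (𝟙 V) g = LinearMap.id := rfl

theorem lin_comp {V W U : TwistMod χ t} (f : V ⟶ W) (f' : W ⟶ U) (g : G) :
    lin (f ≫ f') g = lin f' g ∘ₗ lin f g := rfl

def isoOfLin {V W : TwistMod χ t} (f : ∀ g, V g →ₗ[k] W g) (f' : ∀ g, W g →ₗ[k] V g)
    (h : ∀ g, f' g ∘ₗ f g = LinearMap.id) (h' : ∀ g, f g ∘ₗ f' g = LinearMap.id) : V ≅ W where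
  hom := ofLin f
  inv := ofLin f'
  hom_inv_id := hom_ext' h
  inv_hom_id := hom_ext' h'

/-- The twist of `B_t`. -/
def twistIso (V : TwistMod χ t) : V ≅ V := by
  letI := vecBraided χ
  exact t.iso.app V

theorem lin_twistIso (V : TwistMod χ t) {g : G} (v : V g) :
    lin (twistIso V).hom g v = ((VecTwist.scalar t g : kˣ) : k) • v := VecTwist.app_apply t V v

/-- The object `J(V)` of `HH(B)` attached to `V ∈ B_t`: it is `V` with the circle action
`X ⊗ V ≅ V ⊗ X` given by the braiding `τ_{X,V}` followed by the automorphism `t_X θ_X⁻¹` of `X`,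
so that `ς` becomes `t` on `J(V)`. -/
def toHH (V : TwistMod χ t) : HH χ :=
  HH.ofAct V (fun a y => ((VecTwist.coeff t a y : kˣ) : k) • LinearMap.id)
    (fun y => by rw [VecTwist.coeff_zero_left, Units.val_one, one_smul])
    (fun a b y => by
      ext v
      simp only [LinearMap.smul_apply, LinearMap.comp_apply, LinearMap.id_apply]
      rw [VecTwist.coeff_add_left, Units.val_mul, mul_smul])

theorem toHH_act_eq (V : TwistMod χ t) (a y : G) :
    V.toHH.act a y = ((VecTwist.coeff t a y : kˣ) : k) • LinearMap.id := HH.act_ofAct _ _ _ _ _ _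

theorem toHH_act (V : TwistMod χ t) (a : G) {y : G} (v : V y) :
    V.toHH.act a y v = ((VecTwist.coeff t a y : kˣ) : k) • v := by
  rw [toHH_act_eq]; rfl

def toHHMap {V W : TwistMod χ t} (f : V ⟶ W) : V.toHH ⟶ W.toHH :=
  HH.mkHom (lin f) fun a g (m : V g) => by
    exact (congrArg (lin f g) (toHH_act V a m)).trans
      ((map_smul (lin f g) _ _).trans (toHH_act W a _).symm)

theorem lin_toHHMap {V W : TwistMod χ t} (f : V ⟶ W) (g : G) : HH.lin (toHHMap f) g = lin f g := rfl

/-- The action of `M ∈ HH(B)` on `V ∈ B_t` is the graded space of the annuli-stacking product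
`M ⊗ J(V)`; by `smulIso` this product is again of the form `J(-)`, so that `B_t` is a left ideal.
Explicitly, `M ▷ V` is the quotient of `M ⊗ V` by the relations
`a m ⊗ v = χ(a, x) ω(a, y) t(a) θ(a)⁻¹ m ⊗ v` for `m ∈ M_x`, `v ∈ V_y`. -/
def smul (M : HH χ) (V : TwistMod χ t) : TwistMod χ t := (M.tens V.toHH).obj

/-- The class of `m ⊗ v`. -/
def smk (M : HH χ) (V : TwistMod χ t) {x y g : G} (h : x + y = g) :
    M.obj x →ₗ[k] V y →ₗ[k] (smul M V) g := M.qmk V.toHH h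

theorem smk_balanced (M : HH χ) (V : TwistMod χ t) (a : G) {x y g : G} (h : x + y = g)
    (m : M.obj x) (v : V y) :
    smk M V h (M.act a x m) v =
      ((χ y a * χ a x * VecTwist.coeff t a y : kˣ) : k) • smk M V h m v := by
  have key : ∀ v : V.toHH.obj y, M.qmk V.toHH h (M.act a x m) v =
      ((χ y a * χ a x * VecTwist.coeff t a y : kˣ) : k) • M.qmk V.toHH h m v := by
    intro v
    have h1 := M.qmk_balanced V.toHH a h m v
    rw [toHH_act_eq, LinearMap.smul_apply, LinearMap.id_apply, map_smul] at h1
    have h2 := congrArg (fun w => ((χ y a : kˣ) : k) • w) h1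
    simp only [smul_smul, Units.mul_inv, one_smul] at h2
    rw [Units.val_mul, Units.val_mul, mul_assoc]
    exact h2
  exact key v

theorem smk_act (M : HH χ) (V : TwistMod χ t) (a : G) {g : G} (z : (smul M V) g) :
    (M.tens V.toHH).act a g z = ((VecTwist.coeff t a g : kˣ) : k) • z := by
  refine LinearMap.congr_fun (f := (M.tens V.toHH).act a g)
    (g := ((VecTwist.coeff t a g : kˣ) : k) • LinearMap.id) (HH.qext fun x y h m n => ?_) z
  have hc := VecTwist.coeff_add_right t a x y
  rw [h] at hc
  rw [HH.act_qmk', toHH_act_eq, LinearMap.smul_apply, LinearMap.smul_apply, LinearMap.id_apply,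
    LinearMap.id_apply, map_smul, smul_smul, hc, Units.val_mul]

theorem sext {M : HH χ} {V : TwistMod χ t} {g : G} {T : Type u} [AddCommGroup T] [Module k T]
    {f f' : (smul M V) g →ₗ[k] T}
    (hf : ∀ (x y : G) (h : x + y = g) (m : M.obj x) (v : V y),
      f (smk M V h m v) = f' (smk M V h m v)) : f = f' := HH.qext hf

/-- `J` of the action is a tensor product in `HH(B)`. -/
def smulIso (M : HH χ) (V : TwistMod χ t) : M.tens V.toHH ≅ (smul M V).toHH :=
  HH.mkIso (fun _ => LinearMap.id) (fun _ => LinearMap.id)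
    (fun a g z => by
      refine (smk_act M V a z).trans ?_
      exact (toHH_act (smul M V) a z).symm)
    (fun _ => rfl) (fun _ => rfl)

end TwistMod


/-- The underlying graded space. -/
def HH.forget (χ : Bicharacter k G) : HH χ ⥤ GVec k G where
  obj M := M.obj
  map f := f.hom

namespace TwistMod

open MonoidalLeftAction

variable {χ : Bicharacter k G} {t : VecTwist χ}

def smulMap {M M' : HH χ} {V V' : TwistMod χ t} (f : M ⟶ M') (φ : V ⟶ V') :
    smul M V ⟶ smul M' V' :=
  (HH.forget χ).map (HH.tensMap f (toHHMap φ))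

theorem smulMap_smk {M M' : HH χ} {V V' : TwistMod χ t} (f : M ⟶ M') (φ : V ⟶ V') {x y g : G}
    (h : x + y = g) (m : M.obj x) (v : V y) :
    lin (smulMap f φ) g (smk M V h m v) = smk M' V' h (HH.lin f x m) (lin φ y v) :=
  HH.tensMap_qmk f (toHHMap φ) h m v

def smulAssoc (M N : HH χ) (V : TwistMod χ t) : smul (M.tens N) V ≅ smul M (smul N V) :=
  (HH.forget χ).mapIso (HH.tensAssoc M N V.toHH ≪≫ whiskerLeftIso M (smulIso N V))

theorem smulAssoc_smk (M N : HH χ) (V : TwistMod χ t) {x y z u v g : G} (hu : x + y = u)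
    (hv : y + z = v) (hg : u + z = g) (hg' : x + v = g) (m : M.obj x) (n : N.obj y) (p : V z) :
    lin (smulAssoc M N V).hom g (smk (M.tens N) V hg (M.qmk N hu m n) p) =
      smk M (smul N V) hg' m (smk N V hv n p) := by
  refine (congrArg (HH.lin (HH.tensMap (𝟙 M) (smulIso N V).hom) g)
    (HH.tensAssoc_qmk M N V.toHH hu hv hg hg' m n p)).trans ?_
  exact HH.tensMap_qmk (𝟙 M) (smulIso N V).hom hg' m (N.qmk V.toHH hv n p)

theorem smulAssoc_inv_smk (M N : HH χ) (V : TwistMod χ t) {x y z u v g : G} (hu : x + y = u)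
    (hv : y + z = v) (hg : u + z = g) (hg' : x + v = g) (m : M.obj x) (n : N.obj y) (p : V z) :
    lin (smulAssoc M N V).inv g (smk M (smul N V) hg' m (smk N V hv n p)) =
      smk (M.tens N) V hg (M.qmk N hu m n) p := by
  rw [← smulAssoc_smk M N V hu hv hg hg', ← LinearMap.comp_apply, ← lin_comp, Iso.hom_inv_id]
  rfl

def smulUnit (V : TwistMod χ t) : smul (HH.unitObj χ) V ≅ V :=
  (HH.forget χ).mapIso (HH.tensUnitLeft V.toHH)

theorem smulUnit_smk (V : TwistMod χ t) {g : G} (v : V g) :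
    lin (smulUnit V).hom g (smk (HH.unitObj χ) V (zero_add g) (HH.e χ 0 rfl) v) = v :=
  HH.tensUnitLeft_qmk V.toHH v

theorem sext_unit {V : TwistMod χ t} {g : G} {T : Type u} [AddCommGroup T] [Module k T]
    {f f' : (smul (HH.unitObj χ) V) g →ₗ[k] T}
    (hf : ∀ v : V g, f (smk (HH.unitObj χ) V (zero_add g) (HH.e χ 0 rfl) v) =
      f' (smk (HH.unitObj χ) V (zero_add g) (HH.e χ 0 rfl) v)) : f = f' :=
  HH.qext_unit_left (M := V.toHH) hf

theorem smulUnit_inv (V : TwistMod χ t) {g : G} (v : V g) :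
    lin (smulUnit V).inv g v = smk (HH.unitObj χ) V (zero_add g) (HH.e χ 0 rfl) v := rfl

attribute [irreducible] smul smk smulMap smulAssoc smulUnit

theorem sext3 {M N : HH χ} {V : TwistMod χ t} {g : G} {T : Type u} [AddCommGroup T] [Module k T]
    {f f' : (smul (M.tens N) V) g →ₗ[k] T}
    (hf : ∀ (w z : G) (h : w + z = g) (x y : G) (h' : x + y = w) (m : M.obj x) (n : N.obj y)
      (v : V z), f (smk (M.tens N) V h (M.qmk N h' m n) v) =
        f' (smk (M.tens N) V h (M.qmk N h' m n) v)) : f = f' := by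
  apply sext
  intro w z h q v
  have : f ∘ₗ (smk (M.tens N) V h).flip v = f' ∘ₗ (smk (M.tens N) V h).flip v :=
    HH.qext fun x y h' m n => hf w z h x y h' m n v
  exact LinearMap.congr_fun this q

theorem sext4 {M N P : HH χ} {V : TwistMod χ t} {g : G} {T : Type u} [AddCommGroup T] [Module k T]
    {f f' : (smul ((M.tens N).tens P) V) g →ₗ[k] T}
    (hf : ∀ (w s : G) (h : w + s = g) (v z : G) (h'' : v + z = w) (x y : G) (h' : x + y = v)
      (a : M.obj x) (b : N.obj y) (c : P.obj z) (d : V s),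
      f (smk ((M.tens N).tens P) V h ((M.tens N).qmk P h'' (M.qmk N h' a b) c) d) =
      f' (smk ((M.tens N).tens P) V h ((M.tens N).qmk P h'' (M.qmk N h' a b) c) d)) : f = f' := by
  apply sext
  intro w s h q d
  have : f ∘ₗ (smk ((M.tens N).tens P) V h).flip d = f' ∘ₗ (smk ((M.tens N).tens P) V h).flip d :=
    HH.qext3' fun v z h'' x y h' a b c => hf w s h v z h'' x y h' a b c d
  exact LinearMap.congr_fun this q

theorem smulMap_id (M : HH χ) (V : TwistMod χ t) : smulMap (𝟙 M) (𝟙 V) = 𝟙 (smul M V) :=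
  hom_ext' fun _ => sext fun _ _ _ _ _ => by rw [smulMap_smk]; rfl

theorem smulMap_comp {M M' M'' : HH χ} {V V' V'' : TwistMod χ t} (f : M ⟶ M') (f' : M' ⟶ M'')
    (φ : V ⟶ V') (φ' : V' ⟶ V'') : smulMap f φ ≫ smulMap f' φ' = smulMap (f ≫ f') (φ ≫ φ') :=
  hom_ext' fun _ => sext fun _ _ _ _ _ => by
    rw [lin_comp, LinearMap.comp_apply, smulMap_smk, smulMap_smk, smulMap_smk]; rfl

theorem smulAssoc_naturality {M M' N N' : HH χ} {V V' : TwistMod χ t} (f : M ⟶ M') (f' : N ⟶ N')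
    (φ : V ⟶ V') : smulMap (HH.tensMap f f') φ ≫ (smulAssoc M' N' V').hom =
      (smulAssoc M N V).hom ≫ smulMap f (smulMap f' φ) :=
  hom_ext' fun g => sext3 fun w z h x y h' m n v => by
    have hg' : x + (y + z) = g := by rw [← h, ← h', add_assoc]
    rw [lin_comp, lin_comp, LinearMap.comp_apply, LinearMap.comp_apply, smulMap_smk,
      HH.tensMap_qmk, smulAssoc_smk _ _ _ h' rfl h hg', smulAssoc_smk _ _ _ h' rfl h hg',
      smulMap_smk, smulMap_smk]

theorem smulUnit_naturality {V V' : TwistMod χ t} (φ : V ⟶ V') :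
    (smulUnit V).hom ≫ φ = smulMap (𝟙 (HH.unitObj χ)) φ ≫ (smulUnit V').hom :=
  hom_ext' fun g => sext_unit fun v => by
    rw [lin_comp, lin_comp, LinearMap.comp_apply, LinearMap.comp_apply, smulMap_smk,
      smulUnit_smk, HH.lin_id, LinearMap.id_apply, smulUnit_smk]

theorem smul_pentagon (M N P : HH χ) (V : TwistMod χ t) :
    smulMap (HH.tensAssoc M N P).hom (𝟙 V) ≫ (smulAssoc M (N.tens P) V).hom ≫
        smulMap (𝟙 M) (smulAssoc N P V).hom =
      (smulAssoc (M.tens N) P V).hom ≫ (smulAssoc M N (smul P V)).hom :=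
  hom_ext' fun g => sext4 fun w s h v z h'' x y h' a b c d => by
    subst h' h'' h
    simp only [lin_comp, LinearMap.comp_apply]
    rw [smulMap_smk, HH.tensAssoc_qmk M N P (v := y + z) rfl rfl rfl (add_assoc x y z).symm,
      smulAssoc_smk M (N.tens P) V (v := y + (z + s)) _ (add_assoc y z s) _ (by abel), smulMap_smk,
      HH.lin_id, lin_id, LinearMap.id_apply, LinearMap.id_apply,
      smulAssoc_smk N P V (v := z + s) rfl rfl _ rfl,
      smulAssoc_smk (M.tens N) P V (v := z + s) rfl rfl _ (add_assoc (x + y) z s).symm,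
      smulAssoc_smk M N (smul P V) (v := y + (z + s)) rfl rfl]

theorem smul_leftUnitor (M : HH χ) (V : TwistMod χ t) :
    smulMap (HH.tensUnitLeft M).hom (𝟙 V) =
      (smulAssoc (HH.unitObj χ) M V).hom ≫ (smulUnit (smul M V)).hom := by
  refine hom_ext' fun g => sext fun x y h q v => ?_
  refine LinearMap.congr_fun (f := lin (smulMap (HH.tensUnitLeft M).hom (𝟙 V)) g ∘ₗ
    (smk ((HH.unitObj χ).tens M) V h).flip v) (g := lin ((smulAssoc (HH.unitObj χ) M V).hom ≫
      (smulUnit (smul M V)).hom) g ∘ₗ (smk ((HH.unitObj χ).tens M) V h).flip v)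
    (HH.qext_unit_left fun m => ?_) q
  simp only [lin_comp, LinearMap.comp_apply, LinearMap.flip_apply]
  rw [smulMap_smk, HH.tensUnitLeft_qmk, smulAssoc_smk _ _ _ (zero_add x) h h (zero_add g),
    smulUnit_smk]
  rfl

theorem smul_rightUnitor (M : HH χ) (V : TwistMod χ t) :
    smulMap (HH.tensUnitRight M).hom (𝟙 V) =
      (smulAssoc M (HH.unitObj χ) V).hom ≫ smulMap (𝟙 M) (smulUnit V).hom := by
  refine hom_ext' fun g => sext fun x y h q v => ?_
  refine LinearMap.congr_fun (f := lin (smulMap (HH.tensUnitRight M).hom (𝟙 V)) g ∘ₗ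
    (smk (M.tens (HH.unitObj χ)) V h).flip v) (g := lin ((smulAssoc M (HH.unitObj χ) V).hom ≫
      smulMap (𝟙 M) (smulUnit V).hom) g ∘ₗ (smk (M.tens (HH.unitObj χ)) V h).flip v)
    (HH.qext_unit_right fun m => ?_) q
  simp only [lin_comp, LinearMap.comp_apply, LinearMap.flip_apply]
  rw [smulMap_smk, HH.tensUnitRight_qmk, smulAssoc_smk _ _ _ (add_zero x) (zero_add y) h h,
    smulMap_smk, smulUnit_smk]
  rfl

instance : MonoidalLeftAction (HH χ) (TwistMod χ t) where
  actionObj M V := smul M V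
  actionHomLeft f V := smulMap f (𝟙 V)
  actionHomRight M _ _ φ := smulMap (𝟙 M) φ
  actionHom f φ := smulMap f φ
  actionAssocIso M N V := smulAssoc M N V
  actionUnitIso V := smulUnit V
  actionHom_def f φ := by
    refine Eq.trans ?_ (smulMap_comp f (𝟙 _) (𝟙 _) φ).symm
    rw [Category.id_comp, Category.comp_id]
  actionHomRight_id M V := smulMap_id M V
  id_actionHomLeft M V := smulMap_id M V
  actionHom_comp f₁ f₂ g₁ g₂ := (smulMap_comp f₁ f₂ g₁ g₂).symm
  actionAssocIso_hom_naturality f g h := smulAssoc_naturality f g h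
  actionUnitIso_hom_naturality f := smulUnit_naturality f
  whiskerLeft_actionHomLeft M N N' f V := by
    have h := smulAssoc_naturality (𝟙 M) f (𝟙 V)
    rw [← Category.assoc]
    exact (Iso.eq_comp_inv _).2 h
  whiskerRight_actionHomLeft {M M'} N f V := by
    have h := smulAssoc_naturality f (𝟙 N) (𝟙 V)
    rw [smulMap_id] at h
    rw [← Category.assoc]
    exact (Iso.eq_comp_inv _).2 h
  associator_actionHom M N P V := smul_pentagon M N P V
  leftUnitor_actionHom M V := smul_leftUnitor M V
  rightUnitor_actionHom M V := smul_rightUnitor M V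

/-- The action is compatible with `ς`: the twist of `M ▷ V` is `ς_M ▷ t_V`. -/
theorem twistIso_smul (M : HH χ) (V : TwistMod χ t) :
    (twistIso (M ⊙ₗ V : TwistMod χ t)).hom = (HH.sigma χ).hom.app M ⊙ₗₘ (twistIso V).hom :=
  hom_ext' fun g => sext fun x y h m v => by
    subst h
    refine Eq.trans ?_ (smulMap_smk M.sigmaIso.hom (twistIso V).hom rfl m v).symm
    refine (lin_twistIso (smul M V) _).trans ?_
    rw [HH.lin_sigmaIso, lin_twistIso, map_smul, smk_balanced, smul_smul, ← Units.val_mul,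
      VecTwist.scalar_add, VecTwist.coeff, Bicharacter.omega, Bicharacter.theta]
    congr 2
    generalize VecTwist.scalar t x = p, VecTwist.scalar t y = q, χ x y = r, χ y x = s, χ x x = w
    rw [show q * (s * w * (p * w⁻¹ * r)) = (q * s * p * r) * (w * w⁻¹) by
      simp only [mul_comm, mul_left_comm, mul_assoc], mul_inv_cancel, mul_one]
    simp only [mul_comm, mul_left_comm]

/-- The objects of `B_t` on which the twist is the identity. -/
def fixed (χ : Bicharacter k G) (t : VecTwist χ) : ObjectProperty (TwistMod χ t) :=
  fun V => (twistIso V).hom = 𝟙 V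

/-- The fixed objects form a module category over `HC(B)`. -/
theorem fixed_smul (M : HC χ) (V : (fixed χ t).FullSubcategory) :
    fixed χ t (M.obj ⊙ₗ V.obj) := by
  have h1 : (HH.sigma χ).hom.app M.obj = 𝟙 M.obj := M.property
  have h2 : (twistIso V.obj).hom = 𝟙 V.obj := V.property
  refine (twistIso_smul M.obj V.obj).trans ?_
  rw [h1, h2]
  exact smulMap_id _ _

instance : MonoidalLeftAction (HC χ) (fixed χ t).FullSubcategory where
  actionObj M V := ⟨M.obj ⊙ₗ V.obj, fixed_smul M V⟩
  actionHomLeft f V := ObjectProperty.homMk (f.hom ⊵ₗ V.obj)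
  actionHomRight M _ _ φ := ObjectProperty.homMk (M.obj ⊴ₗ φ.hom)
  actionHom f φ := ObjectProperty.homMk (f.hom ⊙ₗₘ φ.hom)
  actionAssocIso M N V := (fixed χ t).isoMk (αₗ M.obj N.obj V.obj)
  actionUnitIso V := (fixed χ t).isoMk (λₗ V.obj)
  actionHom_def f φ := ObjectProperty.hom_ext _ (actionHom_def f.hom φ.hom)
  actionHomRight_id M V := ObjectProperty.hom_ext _ (actionHomRight_id M.obj V.obj)
  id_actionHomLeft M V := ObjectProperty.hom_ext _ (id_actionHomLeft M.obj V.obj)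
  actionHom_comp f₁ f₂ g₁ g₂ :=
    ObjectProperty.hom_ext _ (actionHom_comp f₁.hom f₂.hom g₁.hom g₂.hom)
  actionAssocIso_hom_naturality f g h :=
    ObjectProperty.hom_ext _ (actionAssocIso_hom_naturality f.hom g.hom h.hom)
  actionUnitIso_hom_naturality f :=
    ObjectProperty.hom_ext _ (actionUnitIso_hom_naturality (C := HH χ) f.hom)
  whiskerLeft_actionHomLeft M N N' f V :=
    ObjectProperty.hom_ext _ (whiskerLeft_actionHomLeft M.obj f.hom V.obj)
  whiskerRight_actionHomLeft N f V :=
    ObjectProperty.hom_ext _ (whiskerRight_actionHomLeft N.obj f.hom V.obj)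
  associator_actionHom M N P V :=
    ObjectProperty.hom_ext _ (associator_actionHom M.obj N.obj P.obj V.obj)
  leftUnitor_actionHom M V := ObjectProperty.hom_ext _ (leftUnitor_actionHom M.obj V.obj)
  rightUnitor_actionHom M V := ObjectProperty.hom_ext _ (rightUnitor_actionHom M.obj V.obj)

end TwistMod

/-- `B_t` and `B_{t'}` are equivalent as `HH(B)`-module categories with twists. -/
def HochschildEquivalent {χ : Bicharacter k G} (t t' : VecTwist χ) : Prop :=
  ∃ e : TwistMod χ t ≌ TwistMod χ t',
    Nonempty (e.functor.LeftLinear (HH χ)) ∧ e.functor.Additive ∧ e.functor.Linear k ∧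
      ∀ V : TwistMod χ t, e.functor.map (TwistMod.twistIso V).hom =
        (TwistMod.twistIso (e.functor.obj V)).hom

/-- The fixed parts of `B_t` and `B_{t'}` are equivalent as `HC(B)`-module categories. -/
def CyclicEquivalent {χ : Bicharacter k G} (t t' : VecTwist χ) : Prop :=
  ∃ e : (TwistMod.fixed χ t).FullSubcategory ≌ (TwistMod.fixed χ t').FullSubcategory,
    Nonempty (e.functor.LeftLinear (HC χ)) ∧ e.functor.Additive ∧ e.functor.Linear k

/-- The twists `t` and `t'` yield the same relative theory: the coefficients `B_t` and `B_{t'}` of the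
relative Hochschild categories `HH(C) ⊠_{HH(B)} B_t`, and the coefficients of the relative cyclic
categories `HC(C) ⊠_{HC(B)} (B_t)^t`, are equivalent module categories. -/
def SameTheory {χ : Bicharacter k G} (t t' : VecTwist χ) : Prop :=
  HochschildEquivalent t t' ∧ CyclicEquivalent t t'

end BraidedVec

end

open BraidedVec

/-! An object of `HH(B)` is a graded space with an action of `G` on each degree, so it can be cut up
by characters of `G`. Non-degeneracy and characteristic `0` make `x ↦ ω(x,-)` a bijection from `G`
onto the characters with values in `k`, and orthogonality gives explicit idempotents, so no roots of
unity have to be adjoined. The block `(i, g)` of `M` is the part of `M_g` where `a` acts by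
`χ(g,a)⁻¹ ω(i,a)`. Up to isomorphism `M` is an arbitrary family of vector spaces indexed by these
pairs, and morphisms are arbitrary families of linear maps (`sum_proj`, `lin_glue`,
`blockOfBlocks`).

This normalisation of the eigenvalues turns annuli stacking into matrix multiplication. On block `i`
of `M_x` times block `l` of `N_y`, the two actions to be identified have eigenvalues `χ(x+y,a)⁻¹
ω(i,a)` and `χ(x+y,a)⁻¹ ω(l+x,a)`. The product therefore vanishes unless `l = i - x`, and otherwise
the relations impose nothing (`eig_tensor`, `eig_tensor'`). With the block `(i, i-j)` as the entry
in row `i` and column `j`, this is the matrix product, and `k[G]` has one-dimensional diagonal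
blocks and no others. Hence the block functor is a monoidal equivalence (`isIso_ε`, `isIso_μ`,
`isEquivalence_blockFunctor`).

On the entry `(i, j)` the automorphism `ς` is the scalar `θ(g)⁻¹ ω(i,g)` with `g = i - j`. Since `θ`
is quadratic with polarisation `ω`, this scalar is `1` exactly when `θ(i) = θ(j)`. So the stable
objects are the matrices that are block diagonal along the fibres of `θ` (`stable_iff`), which gives
the product of matrix categories.

A twist and `θ` satisfy the same quadratic identity, so their quotient is a character, hence some
`ω(x,-)`. In `B_{θ_x}` the relation between `a m ⊗ v` and `m ⊗ v` depends on the degree `b` of `v`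
only through `ω(b+x,a)`, so shifting degrees by `y - x` identifies the module structures for `θ_x`
and `θ_y`. Moreover `θ_x(g) = θ(g+x)/θ(x)`, so this shift carries one twist to the other once `θ(x)
= θ(y)`. -/

noncomputable section

namespace BraidedVec

variable {k : Type u} [Field k] {G : Type u} [AddCommGroup G]

/-! ### Characters of `G` and the quadratic function `θ`. -/

/-- The values of a non-trivial character sum to zero. -/
theorem sum_character_eq_zero [Fintype G] (f : G → kˣ) (hf : ∀ x y, f (x + y) = f x * f y)
    {a : G} (ha : f a ≠ 1) : ∑ x, ((f x : kˣ) : k) = 0 := by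
  have h : ((f a : kˣ) : k) * ∑ x, ((f x : kˣ) : k) = ∑ x, ((f x : kˣ) : k) := by
    rw [Finset.mul_sum]
    exact Fintype.sum_equiv (Equiv.addLeft a) _ _ fun x => by simp [hf]
  have h' : (((f a : kˣ) : k) - 1) * ∑ x, ((f x : kˣ) : k) = 0 := by rw [sub_mul, h, one_mul, sub_self]
  rcases mul_eq_zero.1 h' with h'' | h''
  · exact absurd (Units.ext (sub_eq_zero.1 h'')) ha
  · exact h''

theorem card_ne_zero [Fintype G] [CharZero k] : (Fintype.card G : k) ≠ 0 :=
  Nat.cast_ne_zero.2 Fintype.card_ne_zero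

namespace Bicharacter

variable (χ : Bicharacter k G)

theorem omega_comm (x y : G) : χ.omega x y = χ.omega y x := mul_comm _ _

theorem omega_zero_left (x : G) : χ.omega 0 x = 1 := by rw [omega_comm, omega_zero_right]

theorem omega_neg_left (x y : G) : χ.omega (-x) y = (χ.omega x y)⁻¹ := by
  rw [eq_inv_iff_mul_eq_one, ← omega_add_left, neg_add_cancel, omega_zero_left]

theorem omega_sub_left (x y z : G) : χ.omega (x - y) z = χ.omega x z * (χ.omega y z)⁻¹ := by
  rw [sub_eq_add_neg, omega_add_left, omega_neg_left]

theorem omega_self (x : G) : χ.omega x x = χ.theta x * χ.theta x := rfl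

/-- Expanding both sides gives `ω(x,x-y) = θ(x)² ω(x,y)⁻¹` and `θ(x-y) = θ(x) θ(y) ω(x,y)⁻¹`, whose
quotient is `θ(x)/θ(y)`. This is what later turns the condition `ς = id` into an equality of values
of `θ`. -/
theorem omega_sub_self_eq_theta_iff (x y : G) :
    χ.omega x (x - y) = χ.theta (x - y) ↔ χ.theta x = χ.theta y := by
  have h := χ.theta_add (x - y) y
  rw [sub_add_cancel, omega_comm] at h
  have h2 : χ.omega x (x - y) = χ.theta x * χ.theta x * (χ.omega y x)⁻¹ := by
    rw [omega_comm, omega_sub_left, omega_self]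
  have h3 : χ.omega y (x - y) = χ.omega y x * (χ.theta y * χ.theta y)⁻¹ := by
    rw [omega_comm, omega_sub_left, omega_self, omega_comm]
  rw [h3] at h
  rw [h2]
  generalize χ.theta x = p, χ.theta y = q, χ.theta (x - y) = r, χ.omega y x = s at h ⊢
  have h4 : p * q = r * s := by
    rw [h]
    have : r * q * (s * (q * q)⁻¹) * q = r * s * ((q * q) * (q * q)⁻¹) := by
      simp only [mul_comm, mul_left_comm, mul_assoc]
    rw [this, mul_inv_cancel, mul_one]
  constructor
  · intro h5
    have : p * p = r * s := by rw [← h5, mul_assoc, inv_mul_cancel, mul_one]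
    rw [← h4] at this
    exact mul_left_cancel this
  · rintro rfl
    rw [h4, mul_assoc, mul_inv_cancel, mul_one]

variable {χ}

theorem IsNondegenerate.exists_omega_ne (hχ : χ.IsNondegenerate) {i j : G} (h : i ≠ j) :
    ∃ a, χ.omega (i - j) a ≠ 1 := by
  by_contra! h'
  exact h (sub_eq_zero.1 (hχ _ h'))

/-- The second orthogonality relation, summing over labels instead of group elements. Symmetry of
`ω` transfers non-degeneracy to the other argument. -/
theorem IsNondegenerate.sum_omega_eq_zero [Fintype G] (hχ : χ.IsNondegenerate) {a : G} (h : a ≠ 0) :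
    ∑ i, ((χ.omega i a : kˣ) : k) = 0 := by
  have : ∃ i, χ.omega i a ≠ 1 := by
    by_contra! h'
    exact h (hχ a fun y => by rw [omega_comm, h'])
  obtain ⟨i, hi⟩ := this
  exact sum_character_eq_zero (fun i => χ.omega i a) (fun x y => χ.omega_add_left x y a) hi

/-- Every character of `G` is of the form `ω(x, -)`. -/
theorem IsNondegenerate.exists_eq_omega [Fintype G] [CharZero k] (hχ : χ.IsNondegenerate)
    (f : G → kˣ) (hf : ∀ x y, f (x + y) = f x * f y) : ∃ x, ∀ a, f a = χ.omega x a := by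
  by_contra! h
  -- If `f` differs from every `ω(x,-)`, each quotient is a non-trivial character and sums to zero.
  -- Summing over `x` first leaves only `a = 0`, which contributes `|G|`; this is non-zero in
  -- characteristic `0`.
  have h0 : ∀ x, ∑ a, ((f a * (χ.omega x a)⁻¹ : kˣ) : k) = 0 := by
    intro x
    obtain ⟨a, ha⟩ := h x
    refine sum_character_eq_zero (fun a => f a * (χ.omega x a)⁻¹) (fun y z => ?_) (a := a)
      fun h' => ha (mul_inv_eq_one.1 h')
    rw [hf, omega_add_right, mul_inv, mul_mul_mul_comm]
  have h1 : ∑ x, ∑ a, ((f a * (χ.omega x a)⁻¹ : kˣ) : k) = (Fintype.card G : k) := by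
    rw [Finset.sum_comm, Finset.sum_eq_single (0 : G)]
    · have hf0 : f 0 = 1 := by
        have := hf 0 0
        rw [add_zero] at this
        exact left_eq_mul.mp this
      simp [omega_zero_right, hf0]
    · intro a _ ha
      have := hχ.sum_omega_eq_zero (neg_ne_zero.2 ha)
      simp only [Units.val_mul, ← Finset.mul_sum]
      rw [mul_eq_zero]
      right
      rw [← this]
      refine Finset.sum_congr rfl fun x _ => ?_
      rw [omega_comm, ← omega_neg_left, omega_comm]
    · simp
  simp only [h0, Finset.sum_const_zero] at h1
  exact card_ne_zero h1.symm

end Bicharacter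

/-! ### Decomposition of objects of `HH(B)` into blocks. -/

namespace HH

variable {χ : Bicharacter k G}

/-- The eigenvalue of `a ∈ G` on the block `i` in degree `g`. -/
def eig (χ : Bicharacter k G) (i g a : G) : kˣ := (χ g a)⁻¹ * χ.omega i a

theorem eig_zero (i g : G) : eig χ i g 0 = 1 := by
  rw [eig, χ.zero_right, χ.omega_zero_right, inv_one, one_mul]

theorem eig_add (i g a b : G) : eig χ i g (a + b) = eig χ i g a * eig χ i g b := by
  rw [eig, eig, eig, χ.map_add_right, χ.omega_add_right, mul_inv, mul_mul_mul_comm]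

/-- The degree cancels, so separating two labels within one degree is a matter of non-degeneracy of
`ω` alone. -/
theorem eig_div_eig (i j g a : G) : (eig χ i g a)⁻¹ * eig χ j g a = χ.omega (j - i) a := by
  rw [eig, eig, χ.omega_sub_left]
  generalize χ g a = p, χ.omega i a = q, χ.omega j a = r
  rw [mul_inv, inv_inv, mul_mul_mul_comm, mul_inv_cancel, one_mul, mul_comm]

/-- The summand of `M_g` on which every `a ∈ G` acts by `χ(g, a)⁻¹ ω(i, a)`. -/
def block (M : HH χ) (i g : G) : Submodule k (M.obj g) where
  carrier := {m | ∀ a, M.act a g m = ((eig χ i g a : kˣ) : k) • m}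
  add_mem' h h' a := by rw [map_add, h a, h' a, smul_add]
  zero_mem' a := by rw [map_zero, smul_zero]
  smul_mem' c m h a := by rw [map_smul, h a, smul_comm]

theorem act_of_mem {M : HH χ} {i g : G} {m : M.obj g} (h : m ∈ M.block i g) (a : G) :
    M.act a g m = ((eig χ i g a : kˣ) : k) • m := h a

theorem lin_mem_block {M N : HH χ} (f : M ⟶ N) {i g : G} {m : M.obj g} (h : m ∈ M.block i g) :
    lin f g m ∈ N.block i g := fun a => by rw [← lin_act, act_of_mem h, map_smul]

variable [Fintype G]

/-- The projection of `M_g` to the block `i`. -/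
def proj (M : HH χ) (i g : G) : M.obj g →ₗ[k] M.obj g :=
  (Fintype.card G : k)⁻¹ • ∑ a, (((eig χ i g a)⁻¹ : kˣ) : k) • M.act a g

theorem proj_apply (M : HH χ) (i : G) {g : G} (m : M.obj g) : M.proj i g m =
    (Fintype.card G : k)⁻¹ • ∑ a, (((eig χ i g a)⁻¹ : kˣ) : k) • M.act a g m := by
  simp only [proj, LinearMap.smul_apply, LinearMap.sum_apply]

theorem proj_act (M : HH χ) (i a : G) {g : G} (m : M.obj g) :
    M.proj i g (M.act a g m) = M.act a g (M.proj i g m) := by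
  simp only [proj_apply, map_smul, map_sum, M.act_comm a]

/-- In the average over the group, acting by `a` amounts to the translation `b ↦ a + b`, which
brings out the eigenvalue of `a`. -/
theorem proj_mem (M : HH χ) (i : G) {g : G} (m : M.obj g) : M.proj i g m ∈ M.block i g := by
  intro a
  rw [proj_apply, map_smul, smul_comm, map_sum]
  congr 1
  rw [Finset.smul_sum]
  refine Fintype.sum_equiv (Equiv.addLeft a) _ _ fun b => ?_
  rw [map_smul, ← act_add_apply, smul_smul, Equiv.coe_addLeft, eig_add, ← Units.val_mul, mul_inv,
    mul_inv_cancel_left]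

theorem proj_of_mem [CharZero k] {M : HH χ} {i g : G} {m : M.obj g} (h : m ∈ M.block i g) :
    M.proj i g m = m := by
  simp only [proj_apply, act_of_mem h, smul_smul, Units.inv_mul, one_smul, Finset.sum_const,
    Finset.card_univ]
  rw [← Nat.cast_smul_eq_nsmul k, smul_smul, inv_mul_cancel₀ card_ne_zero, one_smul]

theorem proj_of_mem_of_ne (hχ : χ.IsNondegenerate) {M : HH χ} {i j g : G} (hij : i ≠ j)
    {m : M.obj g} (h : m ∈ M.block j g) : M.proj i g m = 0 := by
  simp only [proj_apply, act_of_mem h, smul_smul, ← Units.val_mul, eig_div_eig, ← Finset.sum_smul]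
  obtain ⟨a, ha⟩ := hχ.exists_omega_ne hij.symm
  rw [sum_character_eq_zero (fun a => χ.omega (j - i) a)
    (fun x y => χ.omega_add_right _ x y) ha, mul_zero, zero_smul]

/-- The blocks exhaust `M_g` over `k` itself. After exchanging sums, the coefficient of the action
of `a` is a multiple of `∑ᵢ ω(i,-a)`, which vanishes for `a ≠ 0`; the term `a = 0` is the identity
after division by `|G|`. -/
theorem sum_proj [CharZero k] (hχ : χ.IsNondegenerate) (M : HH χ) {g : G} (m : M.obj g) :
    ∑ i, M.proj i g m = m := by
  simp only [proj_apply, ← Finset.smul_sum]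
  rw [Finset.sum_comm]
  simp only [← Finset.sum_smul]
  rw [Finset.sum_eq_single (0 : G)]
  · simp only [eig_zero, inv_one, Units.val_one, Finset.sum_const, Finset.card_univ, act_zero_apply]
    rw [smul_smul, nsmul_one, inv_mul_cancel₀ card_ne_zero, one_smul]
  · intro a _ ha
    have : ∑ i, (((eig χ i g a)⁻¹ : kˣ) : k) =
        ((χ g a : kˣ) : k) * ∑ i, ((χ.omega i (-a) : kˣ) : k) := by
      rw [Finset.mul_sum]
      refine Finset.sum_congr rfl fun i _ => ?_
      rw [eig, mul_inv, inv_inv, Units.val_mul, χ.omega_comm i (-a), χ.omega_neg_left, χ.omega_comm]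
    rw [this, hχ.sum_omega_eq_zero (neg_ne_zero.2 ha), mul_zero, zero_smul]
  · simp

/-- The projection of `M_g` to the block `i`, with values in the block. -/
def projBlock (M : HH χ) (i g : G) : M.obj g →ₗ[k] M.block i g :=
  (M.proj i g).codRestrict _ (M.proj_mem i)

theorem projBlock_of_mem [CharZero k] {M : HH χ} {i g : G} {m : M.obj g} (h : m ∈ M.block i g) :
    M.projBlock i g m = ⟨m, h⟩ := Subtype.ext (proj_of_mem h)

theorem projBlock_of_mem_of_ne (hχ : χ.IsNondegenerate) {M : HH χ} {i j g : G} (hij : i ≠ j)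
    {m : M.obj g} (h : m ∈ M.block j g) : M.projBlock i g m = 0 :=
  Subtype.ext (proj_of_mem_of_ne hχ hij h)

theorem projBlock_act (M : HH χ) (i a : G) {g : G} (m : M.obj g) :
    M.projBlock i g (M.act a g m) = ((eig χ i g a : kˣ) : k) • M.projBlock i g m :=
  Subtype.ext ((M.proj_act i a m).trans (M.proj_mem i m a))

/-- Morphisms are determined by their restrictions to the blocks. -/
theorem hom_ext_block [CharZero k] (hχ : χ.IsNondegenerate) {M N : HH χ} {f f' : M ⟶ N}
    (h : ∀ i g, ∀ m ∈ M.block i g, lin f g m = lin f' g m) : f = f' :=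
  hom_ext' fun g => LinearMap.ext fun m => by
    rw [← sum_proj hχ M m, map_sum, map_sum]
    exact Finset.sum_congr rfl fun i _ => h i g _ (M.proj_mem i m)

/-- A morphism with prescribed restrictions to the blocks. -/
def glue {M N : HH χ} (φ : ∀ i g, M.block i g →ₗ[k] N.block i g) : M ⟶ N :=
  mkHom (fun g => ∑ i, (N.block i g).subtype ∘ₗ φ i g ∘ₗ M.projBlock i g) fun a g m => by
    simp only [LinearMap.sum_apply, LinearMap.comp_apply, map_sum, projBlock_act, map_smul]
    exact Finset.sum_congr rfl fun i _ => ((φ i g (M.projBlock i g m)).2 a).symm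

theorem lin_glue [CharZero k] (hχ : χ.IsNondegenerate) {M N : HH χ}
    (φ : ∀ i g, M.block i g →ₗ[k] N.block i g) {i g : G} (m : M.block i g) :
    lin (glue φ) g (m : M.obj g) = φ i g m := by
  rw [glue, lin_mkHom, LinearMap.sum_apply, Finset.sum_eq_single i]
  · simp [projBlock_of_mem m.2]
  · intro j _ hj
    simp [projBlock_of_mem_of_ne hχ hj m.2]
  · simp

/-- The object of `HH(B)` with prescribed blocks. -/
def ofBlocks (χ : Bicharacter k G) (V : G → G → ModuleCat.{u} k) : HH χ :=
  ofAct (fun g => ModuleCat.of k (∀ i, V i g))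
    (fun a g => LinearMap.pi fun i => ((eig χ i g a : kˣ) : k) • LinearMap.proj i)
    (fun g => by ext v i; simp [eig_zero])
    (fun a b g => by ext v i; simp [eig_add, mul_smul])

theorem ofBlocks_act (V : G → G → ModuleCat.{u} k) (a g i : G) (v : ∀ i, V i g) :
    ((ofBlocks χ V).act a g v : ∀ i, V i g) i = ((eig χ i g a : kˣ) : k) • v i := by
  have h : (ofBlocks χ V).act a g =
    LinearMap.pi fun i => ((eig χ i g a : kˣ) : k) • LinearMap.proj i := act_ofAct _ _ _ _ _ _
  exact congrFun (LinearMap.congr_fun h v) i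

/-- Distinct labels give distinct characters in a fixed degree, so an element `a` separating them
forces the component to vanish. -/
theorem apply_eq_zero_of_mem_block_ofBlocks (hχ : χ.IsNondegenerate) {V : G → G → ModuleCat.{u} k}
    {i j g : G} (hij : j ≠ i) {v : ∀ i, V i g} (hv : v ∈ (ofBlocks χ V).block i g) : v j = 0 := by
  obtain ⟨a, ha⟩ := hχ.exists_omega_ne hij
  have h : ((eig χ j g a : kˣ) : k) • v j = ((eig χ i g a : kˣ) : k) • v j :=
    (ofBlocks_act V a g j v).symm.trans (congrFun (act_of_mem hv a) j)
  rw [← sub_eq_zero, ← sub_smul] at h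
  refine (smul_eq_zero.1 h).resolve_left fun h' => ha ?_
  rw [← eig_div_eig i j g a, Units.ext (sub_eq_zero.1 h'), inv_mul_cancel]

theorem single_mem_block_ofBlocks [DecidableEq G] (V : G → G → ModuleCat.{u} k) {i g : G} (v : V i g) :
    (LinearMap.single k (fun i => V i g) i v : ∀ i, V i g) ∈ (ofBlocks χ V).block i g := by
  intro a
  refine funext fun j => (ofBlocks_act V a g j _).trans ?_
  by_cases h : j = i
  · subst h; rfl
  · refine Eq.trans ?_ (congrArg (fun w => ((eig χ i g a : kˣ) : k) • w)
      (Pi.single_eq_of_ne (M := fun i => V i g) h v).symm)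
    rw [LinearMap.coe_single, Pi.single_eq_of_ne h, smul_zero, smul_zero]

/-- The blocks of `ofBlocks V`. -/
def blockOfBlocks (hχ : χ.IsNondegenerate) (V : G → G → ModuleCat.{u} k) (i g : G) :
    (ofBlocks χ V).block i g ≃ₗ[k] V i g := by
  classical
  exact LinearEquiv.ofLinearMap
    ((LinearMap.proj i : (∀ i, V i g) →ₗ[k] V i g) ∘ₗ ((ofBlocks χ V).block i g).subtype)
    (LinearMap.codRestrict ((ofBlocks χ V).block i g)
      (LinearMap.single k (fun i => V i g) i) (single_mem_block_ofBlocks V))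
    (LinearMap.ext fun v => Pi.single_eq_same (M := fun i => V i g) i v)
    (LinearMap.ext fun v => Subtype.ext (funext fun j => by
      by_cases h : j = i
      · subst h; exact Pi.single_eq_same (M := fun i => V i g) j _
      · exact (Pi.single_eq_of_ne (M := fun i => V i g) h _).trans
          (apply_eq_zero_of_mem_block_ofBlocks hχ h v.2).symm))

end HH

/-! ### Blocks and the annuli-stacking product. -/

namespace HH

variable {χ : Bicharacter k G}

/-- The eigenvalue of the action through the left factor: a product inherits the label of its left
factor, while the degrees add. -/
theorem eig_tensor (i x y a : G) :
    (χ y a)⁻¹ * eig χ i x a = eig χ i (x + y) a := by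
  rw [eig, eig, χ.map_add_left, mul_inv, ← mul_assoc, mul_comm (χ y a)⁻¹]

/-- The source of matrix multiplication: the action through the right factor has the same eigenvalue
as the action through the left one when the right label is `i - x`. -/
theorem eig_tensor' (i x y a : G) :
    χ a x * eig χ (i - x) y a = eig χ i (x + y) a := by
  rw [eig, eig, χ.map_add_left, χ.omega_sub_left, Bicharacter.omega, Bicharacter.omega]
  generalize χ a x = p, χ y a = q, χ x a = r, χ i a = s, χ a i = t
  rw [mul_inv, mul_inv, show p * (q⁻¹ * (s * t * (r⁻¹ * p⁻¹))) = p * p⁻¹ * (q⁻¹ * (s * t * r⁻¹)) by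
    simp only [mul_comm, mul_left_comm, mul_assoc], mul_inv_cancel, one_mul]
  simp only [mul_comm, mul_left_comm]

/-- The restriction of a morphism to a block. -/
def blockMap {M N : HH χ} (f : M ⟶ N) (i g : G) : M.block i g →ₗ[k] N.block i g :=
  (lin f g).restrict fun _ hm => lin_mem_block f hm

theorem coe_blockMap {M N : HH χ} (f : M ⟶ N) {i g : G} (m : M.block i g) :
    (blockMap f i g m : N.obj g) = lin f g (m : M.obj g) := rfl

theorem qmk_mem_block {M : HH χ} (N : HH χ) {i x y g : G} (h : x + y = g) {m : M.obj x}
    (hm : m ∈ M.block i x) (n : N.obj y) : M.qmk N h m n ∈ (M.tens N).block i g := by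
  intro a
  rw [act_qmk, act_of_mem hm, map_smul, LinearMap.smul_apply, smul_smul, ← Units.val_mul,
    eig_tensor, h]

/-- The pairing of blocks. -/
def blockPairing (M N : HH χ) (i l : G) {x y g : G} (h : x + y = g) :
    M.block i x →ₗ[k] N.block l y →ₗ[k] (M.tens N).block i g :=
  LinearMap.mk₂ k (fun m n => ⟨M.qmk N h m n, qmk_mem_block N h m.2 n⟩)
    (fun _ _ _ => Subtype.ext (by simp)) (fun _ _ _ => Subtype.ext (by simp))
    (fun _ _ _ => Subtype.ext (by simp)) (fun _ _ _ => Subtype.ext (by simp))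

/-- The basis vector `b` is the translate by `b` of the basis vector `0`, and the balancing relation
moves that translation onto `n`. -/
theorem qmk_e (N : HH χ) {x g : G} (hx : x = 0) (h : x + g = g) (b : G) (n : N.obj g) :
    lin (tensUnitLeft N).hom g ((unitObj χ).qmk N h (e χ b hx) n) =
      ((χ g b : kˣ) : k) • N.act b g n := by
  subst hx
  have e1 := (unitObj χ).qmk_balanced N b h (e χ 0 rfl) n
  rw [act_e, add_zero, χ.zero_right, Units.val_one, one_smul] at e1
  have e2 := congrArg (fun w => ((χ g b : kˣ) : k) • w) e1
  simp only [smul_smul, Units.mul_inv, one_smul] at e2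
  rw [e2, map_smul, tensUnitLeft_qmk]

theorem qmk_e' (N : HH χ) {x g : G} (hx : x = 0) (h : g + x = g) (b : G) (n : N.obj g) :
    lin (tensUnitRight N).hom g (N.qmk (unitObj χ) h n (e χ b hx)) =
      (((χ b g)⁻¹ : kˣ) : k) • N.act b g n := by
  subst hx
  have e1 := N.qmk_balanced (unitObj χ) b h n (e χ 0 rfl)
  rw [act_e, add_zero, χ.zero_left, inv_one, Units.val_one, one_smul] at e1
  have e2 := congrArg (fun w => (((χ b g)⁻¹ : kˣ) : k) • w) e1
  simp only [smul_smul, Units.inv_mul, one_smul] at e2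
  rw [← e2, map_smul, tensUnitRight_qmk]

section Finite

variable [Fintype G]

/-- The normalised generator of the block `i` of the unit. -/
def unitVec (χ : Bicharacter k G) (i : G) {g : G} (h : g = 0) : (unitObj χ).obj g :=
  (Fintype.card G : k)⁻¹ • ∑ b, (((χ.omega i b)⁻¹ : kˣ) : k) • e χ b h

/-- In degree `0` the eigenvalue reduces to `ω(i,b)`, so the chosen generator is the component in
block `i` of the vector defining the unit constraints. -/
theorem unitVec_eq_proj (i : G) {g : G} (h : g = 0) :
    unitVec χ i h = (unitObj χ).proj i g (e χ 0 h) := by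
  subst h
  rw [proj_apply, unitVec]
  simp only [act_e, add_zero, eig, χ.zero_left, inv_one, one_mul]

theorem unitVec_mem (i : G) {g : G} (h : g = 0) : unitVec χ i h ∈ (unitObj χ).block i g := by
  rw [unitVec_eq_proj]; exact proj_mem _ _ _

/-- The normalised generator, as an element of the block. -/
def unitBlock (χ : Bicharacter k G) (i : G) {g : G} (h : g = 0) : (unitObj χ).block i g :=
  ⟨unitVec χ i h, unitVec_mem i h⟩

/-- Every summand contributes exactly `n`, because `ω(i,b)⁻¹ χ(g,b)` is inverse to the eigenvalue of
`b` on the block. The factor `|G|⁻¹` in the generator makes the total equal to `n`. -/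
theorem tensUnitLeft_unitVec [CharZero k] (N : HH χ) {i x g : G} (hx : x = 0) (h : x + g = g)
    {n : N.obj g} (hn : n ∈ N.block i g) :
    lin (tensUnitLeft N).hom g ((unitObj χ).qmk N h (unitVec χ i hx) n) = n := by
  rw [unitVec]
  simp only [map_smul, map_sum, LinearMap.smul_apply, LinearMap.sum_apply, qmk_e, act_of_mem hn,
    smul_smul, ← Units.val_mul, eig, mul_inv_cancel_left, inv_mul_cancel, Units.val_one,
    one_smul, Finset.sum_const, Finset.card_univ]
  rw [← Nat.cast_smul_eq_nsmul k, smul_smul, inv_mul_cancel₀ card_ne_zero, one_smul]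

/-- On the right the matching generator carries the column label `j = i - g`, not the row label.
With that choice every summand again contributes exactly `n`. -/
theorem tensUnitRight_unitVec [CharZero k] (N : HH χ) {i j x g : G} (hx : x = 0) (h : g + x = g)
    (hg : i - j = g) {n : N.obj g} (hn : n ∈ N.block i g) :
    lin (tensUnitRight N).hom g (N.qmk (unitObj χ) h n (unitVec χ j hx)) = n := by
  have key : ∀ b, (χ.omega j b)⁻¹ * ((χ b g)⁻¹ * eig χ i g b) = 1 := by
    intro b
    -- This is the only use of `i = j + g`; the remaining scalars `ω(g,b)` and `χ(b,g) χ(g,b)`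
    -- cancel by definition.
    have h1 : χ.omega i b = χ.omega j b * χ.omega g b := by
      rw [← χ.omega_add_left, ← hg, add_sub_cancel]
    rw [eig, h1, Bicharacter.omega, Bicharacter.omega]
    generalize χ j b = p, χ b j = q, χ g b = r, χ b g = s
    rw [show (p * q)⁻¹ * (s⁻¹ * (r⁻¹ * (p * q * (r * s)))) =
      ((p * q)⁻¹ * (p * q)) * ((s⁻¹ * s) * (r⁻¹ * r)) by
        simp only [mul_comm, mul_left_comm, mul_assoc]]
    simp only [inv_mul_cancel, one_mul]
  rw [unitVec]
  simp only [map_smul, map_sum, qmk_e', act_of_mem hn,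
    smul_smul, ← Units.val_mul, key, Units.val_one,
    one_smul, Finset.sum_const, Finset.card_univ]
  rw [← Nat.cast_smul_eq_nsmul k, smul_smul, inv_mul_cancel₀ card_ne_zero, one_smul]

/-- The action on a product may be computed through the left factor, and by `eig_tensor` the weights
of the two averages then agree. -/
theorem proj_qmk {M N : HH χ} (i : G) {x y g : G} (h : x + y = g) (m : M.obj x) (n : N.obj y) :
    (M.tens N).proj i g (M.qmk N h m n) = M.qmk N h (M.proj i x m) n := by
  rw [proj_apply, proj_apply]
  simp only [act_qmk, map_smul, map_sum, LinearMap.smul_apply, LinearMap.sum_apply, smul_smul]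
  congr 1
  refine Finset.sum_congr rfl fun a _ => ?_
  congr 1
  rw [← h, ← eig_tensor i x y, mul_inv, inv_inv, mul_comm (χ y a), Units.val_mul, mul_assoc,
    Units.mul_inv, mul_one]

/-- The product of an element of a block with an arbitrary element only sees one block of the
latter. -/
theorem qmk_of_mem [CharZero k] (hχ : χ.IsNondegenerate) {M N : HH χ} {i x y g : G} (h : x + y = g)
    {m : M.obj x} (hm : m ∈ M.block i x) (n : N.obj y) :
    M.qmk N h m n = M.qmk N h m (N.proj (i - x) y n) := by
  -- Balancing, with the eigenvalue of `m` known, shows that each term of the average defining the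
  -- projection of `n` has the class of `m ⊗ n`. Hence so does the average.
  have e1 : ∀ a, M.qmk N h m ((((eig χ (i - x) y a)⁻¹ : kˣ) : k) • N.act a y n) = M.qmk N h m n := by
    intro a
    have h1 := M.qmk_balanced N a h m n
    rw [act_of_mem hm, map_smul, LinearMap.smul_apply, smul_smul, ← Units.val_mul, eig_tensor,
      ← eig_tensor', Units.val_mul, mul_smul] at h1
    have h2 := congrArg (fun w => (((χ a x)⁻¹ : kˣ) : k) • w) h1
    simp only [smul_smul, Units.inv_mul, one_smul, ← mul_assoc, one_mul] at h2
    rw [map_smul, ← h2, smul_smul, Units.inv_mul, one_smul]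
  rw [proj_apply, map_smul, map_sum]
  simp only [e1, Finset.sum_const, Finset.card_univ]
  rw [← Nat.cast_smul_eq_nsmul k, smul_smul, inv_mul_cancel₀ card_ne_zero, one_smul]

end Finite

/-! ### The lax monoidal functor of blocks. -/

variable {ι : Type} (e : ι → G)

/-- The matrix of blocks of `M` for a family of indices. -/
def blockMat (M : HH χ) : Mat k ι := fun i j => ModuleCat.of k (M.block (e i) (e i - e j))

/-- The functor sending `M` to its matrix of blocks. -/
def blockFunctor (χ : Bicharacter k G) (e : ι → G) : HH χ ⥤ Mat k ι where
  obj M := M.blockMat e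
  map f := Mat.ofLin (A := blockMat e _) (B := blockMat e _)
    fun i j => blockMap f (e i) (e i - e j)

instance : (blockFunctor χ e).Additive where
  map_add := rfl

instance : (blockFunctor χ e).Linear k where
  map_smul _ _ := rfl

variable [DecidableEq ι]

/-- The multiplication of blocks. -/
def blockMul (M N : HH χ) (i j : ι) :
    Mat.mul (M.blockMat e) (N.blockMat e) i j →ₗ[k] (M.tens N).block (e i) (e i - e j) :=
  Mat.lift (A := M.blockMat e) (B := N.blockMat e) (T := (M.tens N).block (e i) (e i - e j)) fun l =>
    blockPairing M N (e i) (e l) (sub_add_sub_cancel (e i) (e l) (e j))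

theorem blockMul_mk (M N : HH χ) (i l j : ι) (m : M.blockMat e i l) (n : N.blockMat e l j) :
    blockMul e M N i j (Mat.mk (M.blockMat e) (N.blockMat e) i l j m n) =
      blockPairing M N (e i) (e l) (sub_add_sub_cancel (e i) (e l) (e j)) m n :=
  Mat.lift_mk (A := M.blockMat e) (B := N.blockMat e) (T := (M.tens N).block (e i) (e i - e j)) _ l m n

variable [Fintype G]

/-- The unit constraint. Its normalisation is forced by the unit laws, through
`tensUnitLeft_unitVec` and `tensUnitRight_unitVec`. -/
def blockOne (χ : Bicharacter k G) (i j : ι) :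
    Mat.one k ι i j →ₗ[k] (unitObj χ).block (e i) (e i - e j) :=
  Mat.oneLift (T := (unitObj χ).block (e i) (e i - e j)) fun h =>
    unitBlock χ (e i) (sub_eq_zero.2 (congrArg e h))

theorem blockOne_basis (χ : Bicharacter k G) {i j : ι} (h : i = j) :
    blockOne e χ i j (Mat.basis k h) = unitBlock χ (e i) (sub_eq_zero.2 (congrArg e h)) :=
  Mat.oneLift_basis (T := (unitObj χ).block (e i) (e i - e j)) _ h

/-- The family `e` is arbitrary here: the coherence laws hold for any choice of labels and are
checked on pure tensors. Invertibility of the constraints is a separate matter, for which `e` has to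
satisfy conditions. -/
instance [CharZero k] : (blockFunctor χ e).LaxMonoidal where
  ε := Mat.ofLin (B := (unitObj χ).blockMat e) (blockOne e χ)
  μ M N := Mat.ofLin (A := Mat.mul (M.blockMat e) (N.blockMat e)) (B := (M.tens N).blockMat e)
    (blockMul e M N)
  μ_natural_left {M M'} f N := Mat.hom_ext' fun i j => Mat.ext fun l m n => by
    refine (congrArg (blockMul e M' N i j) (Mat.mulMap_mk _ (𝟙 (N.blockMat e)) i l j m n)).trans ?_
    refine (blockMul_mk e M' N i l j _ _).trans ?_
    refine Eq.trans ?_ (congrArg (blockMap (tensMap f (𝟙 N)) _ _) (blockMul_mk e M N i l j m n)).symm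
    exact Subtype.ext (tensMap_qmk f (𝟙 N) _ _ _).symm
  μ_natural_right {N N'} M f := Mat.hom_ext' fun i j => Mat.ext fun l m n => by
    refine (congrArg (blockMul e M N' i j) (Mat.mulMap_mk (𝟙 (M.blockMat e)) _ i l j m n)).trans ?_
    refine (blockMul_mk e M N' i l j _ _).trans ?_
    refine Eq.trans ?_ (congrArg (blockMap (tensMap (𝟙 M) f) _ _) (blockMul_mk e M N i l j m n)).symm
    exact Subtype.ext (tensMap_qmk (𝟙 M) f _ _ _).symm
  associativity M N P := Mat.hom_ext' fun i j => Mat.ext3 fun l l' m n p => by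
    -- `h1` and `h3` evaluate the inner multiplications of the two bracketings. What then remains is
    -- the value of the associator of `HH(B)` on `(m ⊗ n) ⊗ p`.
    have h1 : Mat.lin (Mat.mulMap (Mat.ofLin (blockMul e M N)) (𝟙 (P.blockMat e))) i j
        (Mat.mk (Mat.mul (M.blockMat e) (N.blockMat e)) (P.blockMat e) i l' j
          (Mat.mk (M.blockMat e) (N.blockMat e) i l l' m n) p) =
        Mat.mk ((M.tens N).blockMat e) (P.blockMat e) i l' j
          (blockPairing M N (e i) (e l) (sub_add_sub_cancel (e i) (e l) (e l')) m n) p :=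
      (Mat.mulMap_mk _ _ i l' j _ p).trans
        (congrArg (fun w => Mat.mk ((M.tens N).blockMat e) (P.blockMat e) i l' j w p)
          (blockMul_mk e M N i l l' m n))
    have h2 := congrArg (fun w => blockMap (tensAssoc M N P).hom (e i) (e i - e j)
      (blockMul e (M.tens N) P i j w)) h1
    refine h2.trans ?_
    refine (congrArg (blockMap (tensAssoc M N P).hom (e i) (e i - e j))
      (blockMul_mk e (M.tens N) P i l' j _ p)).trans ?_
    have h3 : Mat.lin (Mat.mulMap (𝟙 (M.blockMat e)) (Mat.ofLin (blockMul e N P))) i j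
        (Mat.mk (M.blockMat e) (Mat.mul (N.blockMat e) (P.blockMat e)) i l j m
          (Mat.mk (N.blockMat e) (P.blockMat e) l l' j n p)) =
        Mat.mk (M.blockMat e) ((N.tens P).blockMat e) i l j m
          (blockPairing N P (e l) (e l') (sub_add_sub_cancel (e l) (e l') (e j)) n p) :=
      (Mat.mulMap_mk _ _ i l j m _).trans
        (congrArg (fun w => Mat.mk (M.blockMat e) ((N.tens P).blockMat e) i l j m w)
          (blockMul_mk e N P l l' j n p))
    have h4 := congrArg (fun w => blockMul e M (N.tens P) i j (Mat.lin (Mat.mulMap (𝟙 (M.blockMat e))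
      (Mat.ofLin (blockMul e N P))) i j w))
      (Mat.mulAssoc_mk (M.blockMat e) (N.blockMat e) (P.blockMat e) i l l' j m n p)
    refine Eq.trans ?_ h4.symm
    refine Eq.trans ?_ (congrArg (blockMul e M (N.tens P) i j) h3).symm
    refine Eq.trans ?_ (blockMul_mk e M (N.tens P) i l j _ _).symm
    exact Subtype.ext (tensAssoc_qmk M N P _ _ _ _ _ _ _)
  left_unitality N := Mat.hom_ext' fun i j => Mat.ext_one_left fun n => by
    refine (Mat.oneMul_mk (N.blockMat e) i j n).trans ?_
    have h1 : Mat.lin (Mat.mulMap (Mat.ofLin (blockOne e χ)) (𝟙 (N.blockMat e))) i j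
        (Mat.mk (Mat.one k ι) (N.blockMat e) i i j (Mat.basis k rfl) n) =
        Mat.mk ((unitObj χ).blockMat e) (N.blockMat e) i i j
          (blockOne e χ i i (Mat.basis k rfl)) n :=
      Mat.mulMap_mk _ _ i i j _ n
    have h2 := congrArg (fun w => blockMap (tensUnitLeft N).hom (e i) (e i - e j)
      (blockMul e (unitObj χ) N i j w)) h1
    refine Eq.trans ?_ h2.symm
    refine Eq.trans ?_ (congrArg (blockMap (tensUnitLeft N).hom (e i) (e i - e j))
      (blockMul_mk e (unitObj χ) N i i j _ n)).symm
    refine Subtype.ext ?_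
    refine (tensUnitLeft_unitVec N (sub_self (e i)) (by rw [sub_self, zero_add]) n.2).symm.trans ?_
    exact (congrArg (fun w : (unitObj χ).block (e i) (e i - e i) =>
      lin (tensUnitLeft N).hom (e i - e j) ((unitObj χ).qmk N _ (w : (unitObj χ).obj (e i - e i)) _))
      (blockOne_basis e χ rfl)).symm
  right_unitality N := Mat.hom_ext' fun i j => Mat.ext_one_right fun n => by
    refine (Mat.mulOne_mk (N.blockMat e) i j n).trans ?_
    have h1 : Mat.lin (Mat.mulMap (𝟙 (N.blockMat e)) (Mat.ofLin (blockOne e χ))) i j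
        (Mat.mk (N.blockMat e) (Mat.one k ι) i j j n (Mat.basis k rfl)) =
        Mat.mk (N.blockMat e) ((unitObj χ).blockMat e) i j j n
          (blockOne e χ j j (Mat.basis k rfl)) :=
      Mat.mulMap_mk _ _ i j j n _
    have h2 := congrArg (fun w => blockMap (tensUnitRight N).hom (e i) (e i - e j)
      (blockMul e N (unitObj χ) i j w)) h1
    refine Eq.trans ?_ h2.symm
    refine Eq.trans ?_ (congrArg (blockMap (tensUnitRight N).hom (e i) (e i - e j))
      (blockMul_mk e N (unitObj χ) i j j n _)).symm
    refine Subtype.ext ?_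
    -- The degree of an entry is by definition row label minus column label, so the condition
    -- relating the two labels holds by `rfl`.
    refine (tensUnitRight_unitVec N (sub_self (e j)) (by rw [sub_self, add_zero]) rfl n.2).symm.trans ?_
    exact (congrArg (fun w : (unitObj χ).block (e j) (e j - e j) =>
      lin (tensUnitRight N).hom (e i - e j) (N.qmk (unitObj χ) _ _ (w : (unitObj χ).obj (e j - e j))))
      (blockOne_basis e χ rfl)).symm

end HH

/-! ### Invertibility of the monoidal constraints. -/

theorem Mat.isIso_of_bijective {ι : Type} {A B : Mat k ι} (f : A ⟶ B)
    (h : ∀ i j, Function.Bijective (Mat.lin f i j)) : IsIso f :=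
  (Mat.isoOfLin (fun i j => Mat.lin f i j)
    (fun i j => ((LinearEquiv.ofBijective (Mat.lin f i j) (h i j)).symm : B i j →ₗ[k] A i j))
    (fun i j => LinearMap.ext fun x => (LinearEquiv.ofBijective _ (h i j)).symm_apply_apply x)
    (fun i j => LinearMap.ext fun x =>
      (LinearEquiv.ofBijective _ (h i j)).apply_symm_apply x)).isIso_hom

/-- Dependent functions extend along injections. -/
theorem exists_extension {S Q : Type*} {P : Q → Type*} [∀ q, Inhabited (P q)] {σ : S → Q}
    (hσ : Function.Injective σ) (h : ∀ s, P (σ s)) : ∃ φ : ∀ q, P q, ∀ s, φ (σ s) = h s := by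
  -- Quantifying over all preimages of `q` makes the value independent of a chosen one; injectivity
  -- guarantees that they agree.
  have : ∀ q, ∃ p : P q, ∀ (s : S) (e : σ s = q), e ▸ h s = p := by
    intro q
    by_cases hq : ∃ s, σ s = q
    · obtain ⟨s, rfl⟩ := hq
      exact ⟨h s, fun s' e => by obtain rfl := hσ e; rfl⟩
    · exact ⟨default, fun s e => absurd ⟨s, e⟩ hq⟩
  choose φ hφ using this
  exact ⟨φ, fun s => (hφ _ s rfl).symm⟩

namespace HH

variable {χ : Bicharacter k G} {ι : Type} {e : ι → G} [DecidableEq ι] [Fintype G]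

/-- The inverse of `blockOne`. -/
def blockOneInv (χ : Bicharacter k G) (he : Function.Injective e) (i j : ι) :
    (unitObj χ).obj (e i - e j) →ₗ[k] Mat.one k ι i j :=
  elift (T := Mat.one k ι i j) fun b h =>
    ((χ.omega (e i) b : kˣ) : k) • Mat.basis k (he (sub_eq_zero.1 h))

theorem blockOneInv_unitVec [CharZero k] (he : Function.Injective e) {i j : ι} (h : i = j) :
    blockOneInv χ he i j (unitVec χ (e i) (sub_eq_zero.2 (congrArg e h))) = Mat.basis k h := by
  rw [unitVec, map_smul, map_sum]
  simp only [map_smul, blockOneInv, elift_e, smul_smul, ← Units.val_mul, inv_mul_cancel,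
    Units.val_one, one_smul, Finset.sum_const, Finset.card_univ]
  rw [← Nat.cast_smul_eq_nsmul k, smul_smul, inv_mul_cancel₀ card_ne_zero, one_smul]

/-- All basis vectors are translates of one, so their components in block `i` are multiples of a
single vector: that block of the unit is spanned by `unitVec`. -/
theorem proj_e (i b : G) {g : G} (h : g = 0) :
    (unitObj χ).proj i g (HH.e χ b h) = ((χ.omega i b : kˣ) : k) • unitVec χ i h := by
  subst h
  have h1 : HH.e χ b rfl = (unitObj χ).act b 0 (HH.e χ 0 rfl) := by rw [act_e, add_zero]
  rw [h1, proj_act, ← unitVec_eq_proj, act_of_mem (unitVec_mem i rfl), eig, χ.zero_left, inv_one,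
    one_mul]

/-- `blockOneInv` is defined on the whole degree space, so the composite is the projection to the
block; it becomes the identity on restriction to the block. -/
theorem blockOne_blockOneInv (he : Function.Injective e) (i j : ι) :
    ((unitObj χ).block (e i) (e i - e j)).subtype ∘ₗ
      blockOne e χ i j ∘ₗ blockOneInv χ he i j =
      (unitObj χ).proj (e i) (e i - e j) :=
  eext fun b h => by
    rw [proj_e, LinearMap.comp_apply, LinearMap.comp_apply, blockOneInv, elift_e, map_smul, map_smul]
    exact congrArg (fun w : (unitObj χ).block (e i) (e i - e j) => ((χ.omega (e i) b : kˣ) : k) •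
      (w : (unitObj χ).obj (e i - e j))) (blockOne_basis e χ (he (sub_eq_zero.1 h)))

theorem blockOne_bijective [CharZero k] (he : Function.Injective e) (i j : ι) :
    Function.Bijective (blockOne e χ i j) := by
  have h1 : ∀ v, blockOneInv χ he i j
      (blockOne e χ i j v : (unitObj χ).obj (e i - e j)) = v :=
    LinearMap.congr_fun (f := blockOneInv χ he i j ∘ₗ
      ((unitObj χ).block (e i) (e i - e j)).subtype ∘ₗ blockOne e χ i j) (g := LinearMap.id)
      (Mat.one_ext fun h => by
        refine (congrArg (fun w : (unitObj χ).block (e i) (e i - e j) => blockOneInv χ he i j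
          (w : (unitObj χ).obj (e i - e j))) (blockOne_basis e χ h)).trans ?_
        exact blockOneInv_unitVec he h)
  refine ⟨fun v w h => ?_, fun v => ?_⟩
  · rw [← h1 v, h, h1 w]
  · refine ⟨blockOneInv χ he i j (v : (unitObj χ).obj (e i - e j)), Subtype.ext ?_⟩
    exact (LinearMap.congr_fun (blockOne_blockOneInv he i j) _).trans (proj_of_mem v.2)

theorem isIso_ε [CharZero k] (he : Function.Injective e) :
    IsIso (Functor.LaxMonoidal.ε (blockFunctor χ e)) :=
  Mat.isIso_of_bijective _ fun i j => blockOne_bijective he i j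

/-- The projection to a block in degree `g`, zero in the other degrees. -/
def projTo (M : HH χ) (i x g : G) : M.obj x →ₗ[k] M.block i g :=
  open Classical in
  if h : x = g then M.projBlock i g ∘ₗ (eqToHom (congrArg M.obj h)).hom else 0

theorem projTo_self (M : HH χ) (i x : G) : M.projTo i x x = M.projBlock i x := by
  rw [projTo, dif_pos rfl]; rfl

theorem projTo_of_ne (M : HH χ) (i : G) {x g : G} (h : x ≠ g) : M.projTo i x g = 0 := by
  rw [projTo, dif_neg h]

/-- The linear map out of a product determined by a pairing of two blocks. -/
def ofPairing {M N : HH χ} {i l j : G} {T : Type u} [AddCommGroup T] [Module k T]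
    (β : M.block i (i - l) →ₗ[k] N.block l (l - j) →ₗ[k] T) : (M.tens N).obj (i - j) →ₗ[k] T :=
  qlift (fun x y _ => β.compl₁₂ (M.projTo i x (i - l)) (N.projTo l y (l - j)))
    (fun a x y h m n => by
      -- The pairing is supported in the left degree `i - l`, where the right degree must be `l -
      -- j`. There the label condition `i - x = l` holds and the two eigenvalues agree; in every
      -- other left degree both sides vanish.
      by_cases hx : x = i - l
      · subst hx
        obtain rfl : y = l - j := by
          rw [← sub_add_sub_cancel i l j] at h
          exact add_left_cancel h
        simp only [LinearMap.compl₁₂_apply, projTo_self, projBlock_act, map_smul,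
          LinearMap.smul_apply, smul_smul, ← Units.val_mul]
        rw [eig_tensor, ← eig_tensor', sub_sub_cancel]
      · simp only [LinearMap.compl₁₂_apply, projTo_of_ne _ _ hx, LinearMap.zero_apply, map_zero,
          smul_zero])

theorem ofPairing_qmk_self [CharZero k] {M N : HH χ} {i l j : G} {T : Type u} [AddCommGroup T]
    [Module k T] (β : M.block i (i - l) →ₗ[k] N.block l (l - j) →ₗ[k] T)
    (m : M.block i (i - l)) (n : N.block l (l - j)) :
    ofPairing β (M.qmk N (sub_add_sub_cancel i l j) m n) = β m n := by
  rw [ofPairing, qlift_qmk, LinearMap.compl₁₂_apply, projTo_self, projTo_self,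
    projBlock_of_mem m.2, projBlock_of_mem n.2]

/-- Different middle labels correspond to different degrees of the left factor, so the pairing for
one of them does not see the summand of the other. -/
theorem ofPairing_qmk_of_ne {M N : HH χ} {i l l' j : G} (hl : l ≠ l') {T : Type u} [AddCommGroup T]
    [Module k T] (β : M.block i (i - l') →ₗ[k] N.block l' (l' - j) →ₗ[k] T)
    (m : M.obj (i - l)) (n : N.obj (l - j)) :
    ofPairing β (M.qmk N (sub_add_sub_cancel i l j) m n) = 0 := by
  have h : i - l ≠ i - l' := fun h => hl (sub_right_injective h)
  rw [ofPairing, qlift_qmk, LinearMap.compl₁₂_apply, projTo_of_ne _ _ h, LinearMap.zero_apply,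
    map_zero, LinearMap.zero_apply]

/-- The component at `l` of the inverse of `blockMul`. -/
def blockMulInv (e : ι → G) (M N : HH χ) (i l j : ι) : (M.tens N).obj (e i - e j) →ₗ[k]
    Mat.mul (M.blockMat e) (N.blockMat e) i j :=
  ofPairing (M := M) (N := N) (T := Mat.mul (M.blockMat e) (N.blockMat e) i j)
    (Mat.mk (M.blockMat e) (N.blockMat e) i l j)

/-- The sum of the maps `blockMulInv` over the middle index is a left inverse: on a summand only its
own term survives, since injectivity of `e` keeps the middle degrees apart. -/
theorem blockMul_injective [CharZero k] [Fintype ι] (he : Function.Injective e) (M N : HH χ)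
    (i j : ι) : Function.Injective (blockMul e M N i j) := by
  have h1 : ∀ v, ∑ l, blockMulInv e M N i l j
      (blockMul e M N i j v : (M.tens N).obj (e i - e j)) = v := by
    intro v
    refine Eq.trans (LinearMap.sum_apply _ _ _).symm (LinearMap.congr_fun
      (f := (∑ l, blockMulInv e M N i l j) ∘ₗ
      ((M.tens N).block (e i) (e i - e j)).subtype ∘ₗ blockMul e M N i j) (g := LinearMap.id)
      (Mat.ext fun l m n => ?_) v)
    refine (LinearMap.sum_apply _ _ _).trans ?_
    refine (Finset.sum_eq_single l (fun l' _ hl' => ?_) (by simp)).trans ?_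
    · refine (congrArg (fun w : (M.tens N).block (e i) (e i - e j) => blockMulInv e M N i l' j
          (w : (M.tens N).obj (e i - e j))) (blockMul_mk e M N i l j m n)).trans ?_
      exact ofPairing_qmk_of_ne (he.ne hl'.symm) _ _ _
    · refine (congrArg (fun w : (M.tens N).block (e i) (e i - e j) => blockMulInv e M N i l j
          (w : (M.tens N).obj (e i - e j))) (blockMul_mk e M N i l j m n)).trans ?_
      exact ofPairing_qmk_self (M := M) (N := N) _ m n
  intro v w h
  rw [← h1 v, h, h1 w]

/-- A block of the product is spanned by projected pure tensors. Projection puts `m` in block `e i`,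
and then only the component of `n` in block `e i - x` matters. The hypothesis on `M` says that this
label belongs to the family whenever the block containing `m` is non-zero. -/
theorem blockMul_surjective [CharZero k] (hχ : χ.IsNondegenerate) (M N : HH χ)
    (hM : ∀ i x, M.block (e i) x ≠ ⊥ → ∃ l, e l = e i - x)
    (i j : ι) : Function.Surjective (blockMul e M N i j) := by
  set R : Submodule k ((M.tens N).obj (e i - e j)) := LinearMap.range
    (((M.tens N).block (e i) (e i - e j)).subtype ∘ₗ blockMul e M N i j) with hR
  -- Stating that the projection has values in the range as the vanishing of a linear map lets it be
  -- tested on pure tensors.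
  have h1 : R.mkQ ∘ₗ (M.tens N).proj (e i) (e i - e j) = 0 := qext fun x y h m n => by
    rw [LinearMap.comp_apply, LinearMap.zero_apply, proj_qmk, Submodule.mkQ_apply,
      Submodule.Quotient.mk_eq_zero, qmk_of_mem hχ h (M.proj_mem _ _)]
    by_cases hm : M.block (e i) x = ⊥
    · have : M.proj (e i) x m = 0 := by
        have := M.proj_mem (e i) m
        rwa [hm, Submodule.mem_bot] at this
      rw [this, map_zero, LinearMap.zero_apply]
      exact R.zero_mem
    · obtain ⟨l, hl⟩ := hM i x hm
      rw [← hl]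
      obtain rfl : x = e i - e l := by rw [hl, sub_sub_cancel]
      obtain rfl : y = e l - e j := by
        rw [← sub_add_sub_cancel (e i) (e l) (e j)] at h
        exact add_left_cancel h
      exact ⟨_, congrArg Subtype.val (blockMul_mk e M N i l j (M.projBlock _ _ m)
        (N.projBlock _ _ n))⟩
  intro z
  have h2 := LinearMap.congr_fun h1 (z : (M.tens N).obj (e i - e j))
  rw [LinearMap.comp_apply, LinearMap.zero_apply, Submodule.mkQ_apply,
    Submodule.Quotient.mk_eq_zero] at h2
  obtain ⟨v, hv⟩ := h2
  exact ⟨v, Subtype.ext (hv.trans (proj_of_mem z.2))⟩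

theorem isIso_μ [CharZero k] [Fintype ι] (hχ : χ.IsNondegenerate) (he : Function.Injective e)
    (M N : HH χ) (hM : ∀ i x, M.block (e i) x ≠ ⊥ → ∃ l, e l = e i - x) :
    IsIso (Functor.LaxMonoidal.μ (blockFunctor χ e) M N) :=
  Mat.isIso_of_bijective _ fun i j =>
    ⟨blockMul_injective he M N i j, blockMul_surjective hχ M N hM i j⟩

/-! ### Equivalence with matrices, and the reconstruction of objects from their blocks. -/

section Equivalence

variable {S : Type*} {σ : S → G × G}

/-- Fullness of a block functor: maps on different blocks obey no common relation. Here `σ` lists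
the pairs of label and degree that the target category records; it will be all pairs for `HH(B)` and
those within a fibre of `θ` for `HC(B)`. -/
theorem exists_blockMap_eq [CharZero k] (hχ : χ.IsNondegenerate) (hσ : Function.Injective σ)
    {M N : HH χ} (h : ∀ s, M.block (σ s).1 (σ s).2 →ₗ[k] N.block (σ s).1 (σ s).2) :
    ∃ f : M ⟶ N, ∀ s, blockMap f (σ s).1 (σ s).2 = h s := by
  obtain ⟨φ, hφ⟩ := exists_extension (P := fun q : G × G => M.block q.1 q.2 →ₗ[k] N.block q.1 q.2)
    hσ h
  refine ⟨glue fun i g => φ (i, g), fun s => LinearMap.ext fun m => Subtype.ext ?_⟩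
  rw [coe_blockMap, lin_glue hχ, ← hφ]

/-- Faithfulness: the unrecorded blocks of the source are zero, so nothing is lost there, whatever
the target looks like. -/
theorem hom_ext_blockMap [CharZero k] (hχ : χ.IsNondegenerate) {M N : HH χ}
    (hM : ∀ q, q ∉ Set.range σ → M.block q.1 q.2 = ⊥) {f f' : M ⟶ N}
    (h : ∀ s, blockMap f (σ s).1 (σ s).2 = blockMap f' (σ s).1 (σ s).2) : f = f' :=
  hom_ext_block hχ fun i g m hm => by
    by_cases hs : (i, g) ∈ Set.range σ
    · obtain ⟨s, hs⟩ := hs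
      have key : ∀ q : G × G, σ s = q → blockMap f q.1 q.2 = blockMap f' q.1 q.2 := by
        rintro q rfl; exact h s
      exact congrArg Subtype.val (LinearMap.congr_fun (key _ hs) ⟨m, hm⟩)
    · obtain rfl : m = 0 := by
        have h0 := hM _ hs
        rw [h0] at hm
        exact (Submodule.mem_bot k).1 hm
      rw [map_zero, map_zero]

theorem exists_blocks (hχ : χ.IsNondegenerate) (hσ : Function.Injective σ)
    (V : S → ModuleCat.{u} k) :
    ∃ M : HH χ, (∀ q, q ∉ Set.range σ → M.block q.1 q.2 = ⊥) ∧
      ∀ s, Nonempty (M.block (σ s).1 (σ s).2 ≃ₗ[k] V s) := by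
  -- The zero space `PUnit` is put at the unrecorded pairs, so that the reconstructed object has no
  -- further blocks.
  set W : G → G → ModuleCat.{u} k :=
    fun i g => Function.extend σ V (fun _ => ModuleCat.of k PUnit.{u + 1}) (i, g) with hW
  refine ⟨ofBlocks χ W, fun q hq => ?_, fun s => ?_⟩
  · have h1 : W q.1 q.2 = ModuleCat.of k PUnit.{u + 1} := Function.extend_apply' _ _ _ hq
    have h2 : Subsingleton (W q.1 q.2) := by rw [h1]; exact inferInstanceAs (Subsingleton PUnit)
    have h3 : Subsingleton ((ofBlocks χ W).block q.1 q.2) :=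
      (blockOfBlocks hχ W q.1 q.2).toEquiv.subsingleton
    exact (Submodule.subsingleton_iff_eq_bot).1 h3
  · have h1 : W (σ s).1 (σ s).2 = V s := hσ.extend_apply V _ s
    exact ⟨(blockOfBlocks hχ W _ _).trans (eqToIso h1).toLinearEquiv⟩

end Equivalence

/-- The index of an entry of a matrix. -/
def entryIndex (e : ι → G) (p : ι × ι) : G × G := (e p.1, e p.1 - e p.2)

theorem entryIndex_injective (he : Function.Injective e) : Function.Injective (entryIndex e) := by
  rintro ⟨i, j⟩ ⟨i', j'⟩ h
  obtain rfl := he (congrArg Prod.fst h)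
  obtain rfl := he (sub_right_injective (congrArg Prod.snd h))
  rfl

/-- When `e` is bijective, `(i, j) ↦ (e i, e i - e j)` is a bijection onto all pairs of label and
degree, so the matrix records every block exactly once. -/
theorem isEquivalence_blockFunctor [CharZero k] (hχ : χ.IsNondegenerate)
    (he : Function.Bijective e) : (blockFunctor χ e).IsEquivalence where
  faithful := ⟨fun {M N f f'} h => by
    refine hom_ext_blockMap (σ := entryIndex e) hχ (fun q hq => absurd ?_ hq) fun s =>
      congrArg (fun φ : (blockFunctor χ e).obj M ⟶ (blockFunctor χ e).obj N => Mat.lin φ s.1 s.2) h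
    obtain ⟨i, hi⟩ := he.2 q.1
    obtain ⟨j, hj⟩ := he.2 (q.1 - q.2)
    exact ⟨(i, j), Prod.ext hi (by rw [entryIndex, hi, hj, sub_sub_cancel])⟩⟩
  full := ⟨fun {M N} h => by
    obtain ⟨f, hf⟩ := exists_blockMap_eq hχ (entryIndex_injective he.1) (M := M) (N := N)
      fun s => Mat.lin h s.1 s.2
    exact ⟨f, Mat.hom_ext' fun i j => hf (i, j)⟩⟩
  essSurj := ⟨fun V => by
    obtain ⟨M, -, hM⟩ := exists_blocks hχ (entryIndex_injective he.1) fun s => V s.1 s.2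
    let φ := fun i j => (hM (i, j)).some
    exact ⟨M, ⟨Mat.isoOfLin (A := M.blockMat e) (fun i j => (φ i j).toLinearMap)
      (fun i j => (φ i j).symm.toLinearMap)
      (fun i j => LinearMap.ext fun x => (φ i j).symm_apply_apply x)
      (fun i j => LinearMap.ext fun x => (φ i j).apply_symm_apply x)⟩⟩⟩

theorem exists_equivalence_mat [CharZero k] (hχ : χ.IsNondegenerate) :
    ∃ e : HH χ ≌ Mat k (Fin (Nat.card G)),
      Nonempty e.functor.Monoidal ∧ e.functor.Additive ∧ e.functor.Linear k := by
  let c := (Finite.equivFin G).symm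
  have := isEquivalence_blockFunctor hχ c.bijective
  have := isIso_ε (χ := χ) c.injective
  -- All labels occur, so the closure condition on the middle label is automatic.
  have := fun M N => isIso_μ hχ c.injective M N fun i x _ => c.surjective _
  exact ⟨(blockFunctor χ c).asEquivalence, ⟨Functor.Monoidal.ofLaxMonoidal (blockFunctor χ c)⟩,
    inferInstanceAs (blockFunctor χ c).Additive, inferInstanceAs ((blockFunctor χ c).Linear k)⟩

end HH

/-! ### Stable objects and block diagonal matrices. -/

namespace HH

variable {χ : Bicharacter k G}

/-- `ς` acts on the block `(i, g)` by `θ(g)⁻¹ ω(i,g)`. In matrix terms `i` is the row and `i - g`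
the column, so the condition compares `θ` on the two indices. -/
theorem eig_self_eq_one_iff (i g : G) : eig χ i g g = 1 ↔ χ.theta i = χ.theta (i - g) := by
  have h := χ.omega_sub_self_eq_theta_iff i (i - g)
  rw [sub_sub_cancel] at h
  rw [← h, eig, inv_mul_eq_one, eq_comm]
  rfl

variable [Fintype G]

/-- Stability in terms of blocks. -/
theorem stable_iff [CharZero k] (hχ : χ.IsNondegenerate) (M : HH χ) :
    stable χ M ↔ ∀ i g, χ.theta i ≠ χ.theta (i - g) → M.block i g = ⊥ := by
  constructor
  · intro hM i g hig
    refine (Submodule.eq_bot_iff _).2 fun m hm => ?_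
    have h1 : lin M.sigmaIso.hom g m = m :=
      congrArg (fun f : M ⟶ M => lin f g m) (show M.sigmaIso.hom = 𝟙 M from hM)
    rw [lin_sigmaIso, act_of_mem hm] at h1
    -- The automorphism is a scalar on the block, so a non-zero fixed vector would force that scalar
    -- to be `1`.
    have h2 : (((eig χ i g g : kˣ) : k) - 1) • m = 0 := by rw [sub_smul, h1, one_smul, sub_self]
    refine (smul_eq_zero.1 h2).resolve_left fun h3 => hig ?_
    exact (eig_self_eq_one_iff i g).1 (Units.ext (sub_eq_zero.1 h3))
  · intro h
    refine (show M.sigmaIso.hom = 𝟙 M from hom_ext_block hχ fun i g m hm => ?_)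
    rw [lin_sigmaIso, act_of_mem hm, lin_id, LinearMap.id_apply]
    by_cases hig : χ.theta i = χ.theta (i - g)
    · rw [(eig_self_eq_one_iff i g).2 hig, Units.val_one, one_smul]
    · rw [h i g hig, Submodule.mem_bot] at hm
      rw [hm, smul_zero]

section Cyclic

variable {B : Type u} {ι : B → Type} [∀ b, DecidableEq (ι b)] {e : ∀ b, ι b → G}

/-- The matrices of blocks of a stable object for a family of sets of indices. -/
def cyclicFunctor (χ : Bicharacter k G) (e : ∀ b, ι b → G) : HC χ ⥤ ∀ b, Mat k (ι b) :=
  Functor.pi' fun b => (stable χ).ι ⋙ blockFunctor χ (e b)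

/-- The index of an entry of a family of matrices. -/
def familyIndex (e : ∀ b, ι b → G) (p : Σ b, ι b × ι b) : G × G := entryIndex (e p.1) p.2

theorem familyIndex_injective (he : Function.Injective fun p : Σ b, ι b => e p.1 p.2) :
    Function.Injective (familyIndex e) := by
  rintro ⟨b, i, j⟩ ⟨b', i', j'⟩ h
  have h1 := @he ⟨b, i⟩ ⟨b', i'⟩ (congrArg Prod.fst h)
  obtain rfl : b = b' := congrArg Sigma.fst h1
  have hb : Function.Injective (e b) := fun i j h => by
    have := @he ⟨b, i⟩ ⟨b, j⟩ h
    exact eq_of_heq (Sigma.mk.inj this).2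
  exact congrArg (Sigma.mk b) (entryIndex_injective hb h)

/-- A pair is recorded by one of the matrices exactly when its row `q.1` and column `q.1 - q.2` lie
in the same fibre. Injectivity of `f` identifies fibres with values of `θ`. -/
theorem mem_range_familyIndex (he : Function.Surjective fun p : Σ b, ι b => e p.1 p.2)
    {f : B → kˣ} (hf : Function.Injective f) (hef : ∀ b i, χ.theta (e b i) = f b) (q : G × G) :
    q ∈ Set.range (familyIndex e) ↔ χ.theta q.1 = χ.theta (q.1 - q.2) := by
  constructor
  · rintro ⟨⟨b, i, j⟩, rfl⟩
    change χ.theta (e b i) = χ.theta (e b i - (e b i - e b j))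
    rw [sub_sub_cancel, hef, hef]
  · intro h
    obtain ⟨⟨b, i⟩, hi⟩ := he q.1
    obtain ⟨⟨b', j⟩, hj⟩ := he (q.1 - q.2)
    dsimp only at hi hj
    obtain rfl : b = b' := hf (by rw [← hef b i, ← hef b' j, hi, hj, h])
    exact ⟨⟨b, i, j⟩, Prod.ext hi (by
      change e b i - e b j = q.2
      rw [hi, hj, sub_sub_cancel])⟩

/-- By `stable_iff`, stability means exactly that the unrecorded blocks vanish. This supplies the
hypothesis for faithfulness, and conversely makes the object reconstructed from a family of matrices
stable. -/
theorem isEquivalence_cyclicFunctor [CharZero k] (hχ : χ.IsNondegenerate)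
    (he : Function.Bijective fun p : Σ b, ι b => e p.1 p.2)
    {f : B → kˣ} (hf : Function.Injective f) (hef : ∀ b i, χ.theta (e b i) = f b) :
    (cyclicFunctor χ e).IsEquivalence where
  faithful := ⟨fun {M N φ φ'} h => by
    refine ObjectProperty.hom_ext _ (hom_ext_blockMap (σ := familyIndex e) hχ (fun q hq => ?_)
      fun s => ?_)
    · rw [mem_range_familyIndex he.2 hf hef] at hq
      exact (stable_iff hχ M.obj).1 M.property _ _ hq
    · exact congrArg (fun ψ : (cyclicFunctor χ e).obj M ⟶ (cyclicFunctor χ e).obj N =>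
        Mat.lin (ψ s.1) s.2.1 s.2.2) h⟩
  full := ⟨fun {M N} h => by
    obtain ⟨φ, hφ⟩ := exists_blockMap_eq hχ (familyIndex_injective he.1) (M := M.obj) (N := N.obj)
      fun s => Mat.lin (h s.1) s.2.1 s.2.2
    exact ⟨ObjectProperty.homMk φ, funext fun b => Mat.hom_ext' fun i j => hφ ⟨b, i, j⟩⟩⟩
  essSurj := ⟨fun V => by
    obtain ⟨M, hM', hM⟩ := exists_blocks hχ (familyIndex_injective he.1) fun s => V s.1 s.2.1 s.2.2
    let φ := fun b i j => (hM ⟨b, i, j⟩).some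
    have hst : stable χ M := (stable_iff hχ M).2 fun i g hig => hM' (i, g) fun h =>
      hig ((mem_range_familyIndex he.2 hf hef _).1 h)
    exact ⟨⟨M, hst⟩, ⟨Pi.isoMk fun b => Mat.isoOfLin (A := M.blockMat (e b))
      (fun i j => (φ b i j).toLinearMap)
      (fun i j => (φ b i j).symm.toLinearMap)
      (fun i j => LinearMap.ext fun x => (φ b i j).symm_apply_apply x)
      (fun i j => LinearMap.ext fun x => (φ b i j).apply_symm_apply x)⟩⟩⟩

/-- On stable objects, the matrix of the blocks of a fibre of `θ` is a monoidal functor. -/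
theorem nonempty_monoidal_stable [CharZero k] (hχ : χ.IsNondegenerate) {ι : Type} [Fintype ι]
    [DecidableEq ι] {e : ι → G} (he : Function.Injective e) {c : kˣ}
    (hc : ∀ x, χ.theta x = c ↔ x ∈ Set.range e) :
    Nonempty ((stable χ).ι ⋙ blockFunctor χ e).Monoidal := by
  have := isIso_ε (χ := χ) he
  have : IsIso (Functor.LaxMonoidal.ε ((stable χ).ι ⋙ blockFunctor χ e)) := by
    rw [Functor.LaxMonoidal.comp_ε]
    infer_instance
  have : ∀ M N, IsIso (Functor.LaxMonoidal.μ ((stable χ).ι ⋙ blockFunctor χ e) M N) := by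
    intro M N
    -- A single fibre does not contain all labels, but stability of the left factor confines the
    -- non-zero blocks of a row in the fibre to columns in the same fibre. So no middle label is
    -- missed.
    have := isIso_μ hχ he M.obj N.obj fun i x hx => by
      have h1 : χ.theta (e i) = χ.theta (e i - x) := by
        by_contra h
        exact hx ((stable_iff hχ M.obj).1 M.property _ _ h)
      exact (hc _).1 (h1.symm.trans ((hc _).2 ⟨i, rfl⟩))
    rw [Functor.LaxMonoidal.comp_μ]
    have : IsIso (Functor.LaxMonoidal.μ (blockFunctor χ e) ((stable χ).ι.obj M)
      ((stable χ).ι.obj N)) := this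
    infer_instance
  exact ⟨Functor.Monoidal.ofLaxMonoidal _⟩

theorem exists_equivalence_pi_mat [CharZero k] (hχ : χ.IsNondegenerate) :
    ∃ e : HC χ ≌ (∀ i : Set.range χ.theta, Mat k (Fin (Nat.card {x : G // χ.theta x = i}))),
      Nonempty e.functor.Monoidal ∧ e.functor.Additive ∧ e.functor.Linear k := by
  let c := fun i : Set.range χ.theta => (Finite.equivFin {x : G // χ.theta x = i}).symm
  let e : ∀ i : Set.range χ.theta, Fin (Nat.card {x : G // χ.theta x = i}) → G :=
    fun i j => (c i j : G)
  have hef : ∀ i j, χ.theta (e i j) = i := fun i j => (c i j).2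
  -- The fibres of `θ` partition `G`, so together their enumerations list each label once.
  have he : Function.Bijective fun p : Σ i : Set.range χ.theta,
      Fin (Nat.card {x : G // χ.theta x = i}) =>
      e p.1 p.2 := by
    constructor
    · rintro ⟨i, j⟩ ⟨i', j'⟩ h
      obtain rfl : i = i' := Subtype.ext (by rw [← hef i j, ← hef i' j']; exact congrArg _ h)
      obtain rfl : j = j' := (c i).injective (Subtype.ext h)
      rfl
    · intro x
      refine ⟨⟨⟨χ.theta x, x, rfl⟩, (c _).symm ⟨x, rfl⟩⟩, ?_⟩
      exact congrArg Subtype.val ((c ⟨χ.theta x, x, rfl⟩).apply_symm_apply ⟨x, rfl⟩)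
  have := isEquivalence_cyclicFunctor hχ he Subtype.val_injective hef
  have hmon : ∀ i, Nonempty ((stable χ).ι ⋙ blockFunctor χ (e i)).Monoidal := fun i =>
    nonempty_monoidal_stable hχ (Subtype.val_injective.comp (c i).injective) fun x =>
      ⟨fun h => ⟨(c i).symm ⟨x, h⟩, congrArg Subtype.val ((c i).apply_symm_apply ⟨x, h⟩)⟩, by
        rintro ⟨j, rfl⟩; exact hef i j⟩
  have hmon' := fun i => (hmon i).some
  refine ⟨(cyclicFunctor χ e).asEquivalence, ⟨Pi.monoidalPi' _⟩, ⟨?_⟩, ⟨?_⟩⟩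
  · intros; rfl
  · intros; rfl

end Cyclic

end HH

/-! ### Classification of twists. -/

namespace VecTwist

variable {χ : Bicharacter k G}

theorem ext_scalar {t t' : VecTwist χ} (h : ∀ g, scalar t g = scalar t' g) : t = t' := by
  let _ := vecBraided χ
  have h1 : t.iso = t'.iso := Iso.ext (NatTrans.ext (funext fun V => gvec_hom_ext fun g =>
    LinearMap.ext fun v => (app_apply t V v).trans
      ((congrArg (fun c : kˣ => (c : k) • v) (h g)).trans (app_apply t' V v).symm)))
  cases t; cases t'
  cases h1
  rfl

theorem scalar_twist (x g : G) : scalar (χ.twist x) g = χ.theta g * χ.omega x g := by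
  let _ := vecBraided χ
  have h1 := (app_apply (χ.twist x) (delta k g) (deltaGen k g)).symm.trans
    (Bicharacter.scalarIso_apply (fun g => χ.theta g * χ.omega x g) (delta k g) (deltaGen k g))
  have h2 := congrArg (deltaCoeff g) h1
  rw [map_smul, map_smul, deltaCoeff_gen, smul_eq_mul, smul_eq_mul, mul_one, mul_one] at h2
  exact Units.ext h2

/-- Every twist is `θ_x` for some `x`. -/
theorem exists_eq_twist [Fintype G] [CharZero k] (hχ : χ.IsNondegenerate) (t : VecTwist χ) :
    ∃ x : G, t = χ.twist x := by
  -- The scalars of `t` and `θ` have the same defect `ω` from multiplicativity, so the quotient is a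
  -- character. It is the value of `coeff` in degree `0`, whose additivity is known.
  obtain ⟨x, hx⟩ := hχ.exists_eq_omega (fun a => scalar t a * (χ.theta a)⁻¹) fun a b => by
    have h := coeff_add_left t a b 0
    simpa only [coeff, χ.zero_right, mul_one] using h
  refine ⟨x, ext_scalar fun g => ?_⟩
  rw [scalar_twist, ← hx g, mul_left_comm, mul_inv_cancel, mul_one]

end VecTwist

/-! ### Shifting degrees between the module categories. -/

namespace TwistMod

open MonoidalLeftAction

variable {χ : Bicharacter k G} {t t' : VecTwist χ}

/-- The condition that the shift by `s` is compatible with the actions on `B_t` and `B_{t'}`. -/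
def ShiftCompatible (t t' : VecTwist χ) (s : G) : Prop :=
  ∀ a b, χ b a * VecTwist.coeff t' a b = χ (b + s) a * VecTwist.coeff t a (b + s)

/-- The shift of the degrees by `s`. -/
def shiftObj (t' : VecTwist χ) (s : G) (V : TwistMod χ t) : TwistMod χ t' := fun g => V (g + s)

/-- The shift of the degrees by `s`, as a functor `B_t ⥤ B_{t'}`. -/
def shift (t t' : VecTwist χ) (s : G) : TwistMod χ t ⥤ TwistMod χ t' where
  obj V := shiftObj t' s V
  map f := ofLin (V := shiftObj t' s _) (W := shiftObj t' s _) fun g => lin f (g + s)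

/-- The change of degree along an equality. -/
def castLin (V : TwistMod χ t) {g h : G} (e : g = h) : V g →ₗ[k] V h :=
  (eqToHom (congrArg V e)).hom

theorem castLin_castLin (V : TwistMod χ t) {g h : G} (e : g = h) (e' : h = g) (v : V g) :
    castLin V e' (castLin V e v) = v := by subst e; rfl

theorem lin_castLin {V W : TwistMod χ t} (f : V ⟶ W) {g h : G} (e : g = h) (v : V g) :
    lin f h (castLin V e v) = castLin W e (lin f g v) := by subst e; rfl

theorem add_add_eq_self {s s' : G} (h : s + s' = 0) (g : G) : g + s' + s = g := by
  rw [add_assoc, add_comm s', h, add_zero]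

/-- The shifts by `s` and `s'` are mutually inverse if `s + s' = 0`. -/
def shiftShift (t t' : VecTwist χ) {s s' : G} (h : s + s' = 0) :
    shift t t' s ⋙ shift t' t s' ≅ 𝟭 (TwistMod χ t) :=
  NatIso.ofComponents
    (fun V => isoOfLin (V := shiftObj t s' (shiftObj t' s V)) (W := V)
      (fun g => castLin V (add_add_eq_self h g))
      (fun g => castLin V (add_add_eq_self h g).symm)
      (fun g => LinearMap.ext fun v => castLin_castLin V _ _ v)
      (fun g => LinearMap.ext fun v => castLin_castLin V _ _ v))
    (fun {V W} f => hom_ext' fun g => LinearMap.ext fun v =>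
      (lin_castLin f (add_add_eq_self h g) v).symm)

/-- No relation between `t`, `t'` and `s` is needed: the twists affect only the action, and the
underlying categories are both `Vec_G`. -/
theorem isEquivalence_shift (t t' : VecTwist χ) (s : G) : (shift t t' s).IsEquivalence :=
  (CategoryTheory.Equivalence.mk (shift t t' s) (shift t' t (-s))
    (shiftShift t t' (add_neg_cancel s)).symm (shiftShift t' t (neg_add_cancel s))).isEquivalence_functor

/-! ### Compatibility of the shift with the action of `HH(B)`. -/

/-- The linear map out of `M ▷ V` given by balanced bilinear maps. -/
def slift {M : HH χ} {V : TwistMod χ t} {g : G} {T : Type u} [AddCommGroup T] [Module k T]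
    (φ : ∀ x y : G, x + y = g → (M.obj x →ₗ[k] V y →ₗ[k] T))
    (hφ : ∀ (a x y : G) (h : x + y = g) (m : M.obj x) (v : V y),
      φ x y h (M.act a x m) v = ((χ y a * χ a x * VecTwist.coeff t a y : kˣ) : k) • φ x y h m v) :
    (smul M V) g →ₗ[k] T := by
  unfold smul
  exact HH.qlift (N := V.toHH) φ fun a x y h m v => by
    refine (congrArg (fun w => (((χ y a)⁻¹ : kˣ) : k) • w) (hφ a x y h m v)).trans ?_
    refine Eq.trans ?_ (congrArg (fun w => ((χ a x : kˣ) : k) • w)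
      ((congrArg (φ x y h m) (toHH_act V a v)).trans (map_smul (φ x y h m) _ v))).symm
    rw [smul_smul, smul_smul, ← Units.val_mul, ← Units.val_mul, mul_assoc (χ y a),
      inv_mul_cancel_left]
    rfl

theorem slift_smk {M : HH χ} {V : TwistMod χ t} {g : G} {T : Type u} [AddCommGroup T] [Module k T]
    (φ : ∀ x y : G, x + y = g → (M.obj x →ₗ[k] V y →ₗ[k] T))
    (hφ : ∀ (a x y : G) (h : x + y = g) (m : M.obj x) (v : V y),
      φ x y h (M.act a x m) v = ((χ y a * χ a x * VecTwist.coeff t a y : kˣ) : k) • φ x y h m v)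
    {x y : G} (h : x + y = g) (m : M.obj x) (v : V y) :
    slift φ hφ (smk M V h m v) = φ x y h m v := by
  unfold slift smk
  exact HH.qlift_qmk (N := V.toHH) φ _ h m v

variable {s : G}

theorem add_add_eq {x y g : G} (s : G) (h : x + y = g) : x + (y + s) = g + s := by
  rw [← h, add_assoc]

theorem add_sub_eq {x y g s : G} (h : x + y = g + s) : x + (y - s) = g := by
  rw [← add_sub_assoc, h, add_sub_cancel_right]

/-- The map `m ⊗ v ↦ m ⊗ v` from `M ▷ V[s]` to `(M ▷ V)[s]`. -/
def shiftMul (hs : ShiftCompatible t t' s) (M : HH χ) (V : TwistMod χ t) (g : G) :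
    smul M (shiftObj t' s V) g →ₗ[k] smul M V (g + s) :=
  slift (V := shiftObj t' s V) (T := smul M V (g + s))
    (fun x y h => smk M V (add_add_eq s h)) fun a x y h m v => by
      refine (smk_balanced M V a _ m v).trans ?_
      -- The balancing scalar in the source uses `t'` in degree `y`, the one in the target uses `t`
      -- in degree `y + s`. Shift compatibility says that they coincide, the factor `χ a x` being
      -- common to both.
      exact congrArg (fun c : kˣ => (c : k) • smk M V (add_add_eq s h) m v)
        (by rw [mul_right_comm, ← hs, mul_right_comm])

theorem shiftMul_smk (hs : ShiftCompatible t t' s) (M : HH χ) (V : TwistMod χ t) {x y g : G}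
    (h : x + y = g) (m : M.obj x) (v : V (y + s)) :
    shiftMul hs M V g (smk M (shiftObj t' s V) h m v) = smk M V (add_add_eq s h) m v :=
  slift_smk (V := shiftObj t' s V) (T := smul M V (g + s)) _ _ h m v

/-- The inverse of `shiftMul`. -/
def shiftMulInv (hs : ShiftCompatible t t' s) (M : HH χ) (V : TwistMod χ t) (g : G) :
    smul M V (g + s) →ₗ[k] smul M (shiftObj t' s V) g :=
  slift (V := V) (T := smul M (shiftObj t' s V) g)
    (fun x y h => (smk M (shiftObj t' s V) (add_sub_eq h)).compl₂
      (castLin V (sub_add_cancel y s).symm)) fun a x y h m v => by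
      refine (smk_balanced M (shiftObj t' s V) a (add_sub_eq h) m
        (castLin V (sub_add_cancel y s).symm v)).trans ?_
      exact congrArg (fun c : kˣ => (c : k) • smk M (shiftObj t' s V) (add_sub_eq h) m
        (castLin V (sub_add_cancel y s).symm v))
        (by rw [mul_right_comm, hs, sub_add_cancel, mul_right_comm])

theorem shiftMulInv_smk (hs : ShiftCompatible t t' s) (M : HH χ) (V : TwistMod χ t) {x y g : G}
    (h : x + y = g) (m : M.obj x) (v : V (y + s)) :
    shiftMulInv hs M V g (smk M V (add_add_eq s h) m v) = smk M (shiftObj t' s V) h m v := by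
  refine (slift_smk (V := V) (T := smul M (shiftObj t' s V) g) _ _ _ m v).trans ?_
  -- The degree `y + s - s` equals `y` only propositionally; replacing it by a variable `c` lets the
  -- cast be eliminated.
  have key : ∀ (c : G) (hc : c = y) (h' : x + c = g) (e : y + s = c + s),
      smk M (shiftObj t' s V) h' m (castLin V e v) = smk M (shiftObj t' s V) h m v := by
    rintro c rfl h' e; rfl
  exact key _ (add_sub_cancel_right y s) _ _

theorem shiftMulInv_shiftMul (hs : ShiftCompatible t t' s) (M : HH χ) (V : TwistMod χ t) (g : G) :
    shiftMulInv hs M V g ∘ₗ shiftMul hs M V g = LinearMap.id :=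
  sext fun x y h m v =>
    (congrArg (shiftMulInv hs M V g) (shiftMul_smk hs M V h m v)).trans (shiftMulInv_smk hs M V h m v)

theorem shiftMul_shiftMulInv (hs : ShiftCompatible t t' s) (M : HH χ) (V : TwistMod χ t) (g : G) :
    shiftMul hs M V g ∘ₗ shiftMulInv hs M V g = LinearMap.id :=
  sext fun x y h m v => by
    obtain ⟨y, rfl⟩ : ∃ y', y = y' + s := ⟨y - s, (sub_add_cancel y s).symm⟩
    have h' : x + y = g := by rw [← add_assoc] at h; exact add_right_cancel h
    exact (congrArg (shiftMul hs M V g) (shiftMulInv_smk hs M V h' m v)).trans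
      (shiftMul_smk hs M V h' m v)

/-- The isomorphism `M ▷ V[s] ≅ (M ▷ V)[s]`. -/
def shiftMulIso (hs : ShiftCompatible t t' s) (M : HH χ) (V : TwistMod χ t) :
    smul M (shiftObj t' s V) ≅ shiftObj t' s (smul M V) :=
  isoOfLin (W := shiftObj t' s (smul M V)) (shiftMul hs M V) (shiftMulInv hs M V)
    (shiftMulInv_shiftMul hs M V) (shiftMul_shiftMulInv hs M V)

theorem lin_shiftMulIso_smk (hs : ShiftCompatible t t' s) (M : HH χ) (V : TwistMod χ t) {x y g : G}
    (h : x + y = g) (m : M.obj x) (v : V (y + s)) :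
    lin (shiftMulIso hs M V).hom g (smk M (shiftObj t' s V) h m v) =
      smk M V (add_add_eq s h) m v := shiftMul_smk hs M V h m v

theorem shiftMul_naturality (hs : ShiftCompatible t t' s) {M M' : HH χ} {V V' : TwistMod χ t}
    (f : M ⟶ M') (φ : V ⟶ V') :
    smulMap f ((shift t t' s).map φ) ≫ (shiftMulIso hs M' V').hom =
      (shiftMulIso hs M V).hom ≫ (shift t t' s).map (smulMap f φ) :=
  hom_ext' fun g => sext fun x y h m v => by
    refine (congrArg (lin (shiftMulIso hs M' V').hom g)
      (smulMap_smk f ((shift t t' s).map φ) h m v)).trans ?_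
    refine (lin_shiftMulIso_smk hs M' V' h _ _).trans ?_
    refine Eq.trans ?_ (congrArg (lin (smulMap f φ) (g + s)) (lin_shiftMulIso_smk hs M V h m v)).symm
    exact (smulMap_smk f φ _ m v).symm

/-- The constraint is the identity on pure tensors up to degree bookkeeping, so both routes send `(m
⊗ n) ⊗ v` to `m ⊗ (n ⊗ v)`. -/
theorem shiftMul_assoc (hs : ShiftCompatible t t' s) (M N : HH χ) (V : TwistMod χ t) :
    (shiftMulIso hs (M.tens N) V).hom ≫ (shift t t' s).map (smulAssoc M N V).hom =
      (smulAssoc M N (shiftObj t' s V)).hom ≫ smulMap (𝟙 M) (shiftMulIso hs N V).hom ≫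
        (shiftMulIso hs M (smul N V)).hom :=
  hom_ext' fun g => sext3 fun w z h x y h' m n v => by
    have hg : x + (y + z) = g := by rw [← h, ← h', add_assoc]
    refine (congrArg (lin (smulAssoc M N V).hom (g + s))
      (lin_shiftMulIso_smk hs (M.tens N) V h (M.qmk N h' m n) v)).trans ?_
    refine (smulAssoc_smk M N V h' (add_assoc y z s).symm _ (add_add_eq s hg) m n v).trans ?_
    refine Eq.trans ?_ (congrArg (fun w => lin (shiftMulIso hs M (smul N V)).hom g
      (lin (smulMap (𝟙 M) (shiftMulIso hs N V).hom) g w))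
      (smulAssoc_smk M N (shiftObj t' s V) h' rfl h hg m n v)).symm
    refine Eq.trans ?_ (congrArg (fun w => lin (shiftMulIso hs M (smul N V)).hom g w)
      (smulMap_smk (𝟙 M) (shiftMulIso hs N V).hom hg m (smk N (shiftObj t' s V) rfl n v))).symm
    refine Eq.trans ?_ (lin_shiftMulIso_smk hs M (smul N V) hg _ _).symm
    exact (congrArg (fun w => smk M (smul N V) (add_add_eq s hg) m w)
      (lin_shiftMulIso_smk hs N V rfl n v)).symm

theorem shiftMul_unit (hs : ShiftCompatible t t' s) (V : TwistMod χ t) :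
    (smulUnit (shiftObj t' s V)).hom =
      (shiftMulIso hs (HH.unitObj χ) V).hom ≫ (shift t t' s).map (smulUnit V).hom :=
  hom_ext' fun g => sext_unit fun v => by
    refine (smulUnit_smk (shiftObj t' s V) v).trans ?_
    refine Eq.trans ?_ (congrArg (lin (smulUnit V).hom (g + s))
      (lin_shiftMulIso_smk hs (HH.unitObj χ) V (zero_add g) (HH.e χ 0 rfl) v)).symm
    exact (smulUnit_smk V v).symm

/-- A functor with natural coherent isomorphisms `c ▷ F(d) ≅ F(c ▷ d)` is linear. -/
@[reducible]
def leftLinearOfIso {C D D' : Type*} [Category* C] [Category* D] [Category* D'] [MonoidalCategory C]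
    [MonoidalLeftAction C D] [MonoidalLeftAction C D'] (F : D ⥤ D')
    (μ : ∀ (c : C) (d : D), c ⊙ₗ F.obj d ≅ F.obj (c ⊙ₗ d))
    (h1 : ∀ {c c' : C} (f : c ⟶ c') (d : D),
      f ⊵ₗ F.obj d ≫ (μ c' d).hom = (μ c d).hom ≫ F.map (f ⊵ₗ d))
    (h2 : ∀ (c : C) {d d' : D} (f : d ⟶ d'),
      c ⊴ₗ F.map f ≫ (μ c d').hom = (μ c d).hom ≫ F.map (c ⊴ₗ f))
    (h3 : ∀ (c c' : C) (d : D), (μ (c ⊗ c') d).hom ≫ F.map (αₗ _ _ _).hom =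
      (αₗ c c' (F.obj d)).hom ≫ c ⊴ₗ (μ c' d).hom ≫ (μ c (c' ⊙ₗ d)).hom)
    (h4 : ∀ d : D, (λₗ (F.obj d)).hom = (μ (𝟙_ C) d).hom ≫ F.map (λₗ d).hom) :
    F.LeftLinear C where
  μₗ c d := (μ c d).hom
  δₗ c d := (μ c d).inv
  μₗ_naturality_left f d := h1 f d
  μₗ_naturality_right c _ _ f := h2 c f
  μₗ_associativity := h3
  μₗ_unitality := h4
  -- The oplax identities are the lax ones read backwards, obtained by cancelling an isomorphism on
  -- the left.
  δₗ_naturality_left f d := by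
    rw [← cancel_epi (μ _ d).hom, Iso.hom_inv_id_assoc, ← Category.assoc, ← h1 f d, Category.assoc,
      Iso.hom_inv_id, Category.comp_id]
  δₗ_naturality_right c _ _ f := by
    rw [← cancel_epi (μ c _).hom, Iso.hom_inv_id_assoc, ← Category.assoc, ← h2 c f, Category.assoc,
      Iso.hom_inv_id, Category.comp_id]
  δₗ_associativity c c' d := by
    rw [← cancel_epi (μ (c ⊗ c') d).hom, Iso.hom_inv_id_assoc, ← Category.assoc, h3,
      Category.assoc, Category.assoc, Iso.hom_inv_id_assoc, ← actionHomRight_comp, Iso.hom_inv_id,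
      actionHomRight_id, Category.comp_id]
  δₗ_unitality_inv d := by
    rw [← cancel_epi (λₗ[C] (F.obj d)).hom, Iso.hom_inv_id, h4, Category.assoc,
      ← F.map_comp_assoc, Iso.hom_inv_id, F.map_id, Category.id_comp, Iso.hom_inv_id]
  μₗ_comp_δₗ c d := (μ c d).hom_inv_id
  δₗ_comp_μₗ c d := (μ c d).inv_hom_id

/-- The shift is a functor of `HH(B)`-module categories. -/
theorem nonempty_leftLinear_shift (hs : ShiftCompatible t t' s) :
    Nonempty ((shift t t' s).LeftLinear (HH χ)) :=
  ⟨leftLinearOfIso _ (fun M V => shiftMulIso hs M V)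
    (fun f V => shiftMul_naturality hs f (𝟙 V))
    (fun M _ _ φ => shiftMul_naturality hs (𝟙 M) φ)
    (fun M N V => shiftMul_assoc hs M N V)
    (fun V => shiftMul_unit hs V)⟩

/-! ### Compatibility of the shift with twists and fixed objects. -/

/-- The condition that the shift by `s` carries `t` to `t'`. -/
def ShiftInvariant (t t' : VecTwist χ) (s : G) : Prop :=
  ∀ g, VecTwist.scalar t' g = VecTwist.scalar t (g + s)

theorem shift_map_twistIso (ht : ShiftInvariant t t' s) (V : TwistMod χ t) :
    (shift t t' s).map (twistIso V).hom = (twistIso ((shift t t' s).obj V)).hom :=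
  hom_ext' fun g => LinearMap.ext fun v => by
    refine (lin_twistIso V v).trans ?_
    refine Eq.trans ?_ (lin_twistIso ((shift t t' s).obj V) v).symm
    rw [ht g]
    rfl

/-- The twist is a scalar in each degree, so being the identity passes along isomorphisms. This
serves to restrict the shift to the fixed objects. -/
instance : (fixed χ t).IsClosedUnderIsomorphisms where
  of_iso {V W} φ hV := hom_ext' fun g => LinearMap.ext fun w => by
    have h1 : ∀ v : V g, ((VecTwist.scalar t g : kˣ) : k) • v = v := fun v =>
      (lin_twistIso V v).symm.trans
        (congrArg (fun f : V ⟶ V => lin f g v) (show (twistIso V).hom = 𝟙 V from hV))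
    have h2 : lin φ.hom g (lin φ.inv g w) = w :=
      congrArg (fun f : W ⟶ W => lin f g w) φ.inv_hom_id
    refine (lin_twistIso W w).trans ?_
    rw [← h2, ← map_smul, h1]
    rfl

/-- The shift carries one twist to the other and is faithful, so it both preserves and reflects the
triviality of the twist. -/
theorem inverseImage_fixed (ht : ShiftInvariant t t' s) :
    (fixed χ t').inverseImage (shift t t' s) = fixed χ t := by
  have := isEquivalence_shift t t' s
  ext V
  change (twistIso ((shift t t' s).obj V)).hom = 𝟙 _ ↔ (twistIso V).hom = 𝟙 V
  rw [← shift_map_twistIso ht, ← (shift t t' s).map_id, (shift t t' s).map_injective.eq_iff]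

theorem hochschildEquivalent_of_shift (hs : ShiftCompatible t t' s) (ht : ShiftInvariant t t' s) :
    HochschildEquivalent t t' := by
  have := isEquivalence_shift t t' s
  exact ⟨(shift t t' s).asEquivalence, nonempty_leftLinear_shift hs, ⟨rfl⟩, ⟨fun _ _ => rfl⟩,
    shift_map_twistIso ht⟩

theorem cyclicEquivalent_of_shift (hs : ShiftCompatible t t' s) (ht : ShiftInvariant t t' s) :
    CyclicEquivalent t t' := by
  have := isEquivalence_shift t t' s
  refine ⟨(shift t t' s).asEquivalence.congrFullSubcategory (inverseImage_fixed ht),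
    -- The `HC(B)`-action on fixed objects is restricted from the `HH(B)`-action on full
    -- subcategories, so the same constraints and identities serve again.
    ⟨leftLinearOfIso _ (fun M V => (fixed χ t').isoMk (shiftMulIso hs M.obj V.obj))
      (fun f V => ObjectProperty.hom_ext _ (shiftMul_naturality hs f.hom (𝟙 V.obj)))
      (fun M _ _ φ => ObjectProperty.hom_ext _ (shiftMul_naturality hs (𝟙 M.obj) φ.hom))
      (fun M N V => ObjectProperty.hom_ext _ (shiftMul_assoc hs M.obj N.obj V.obj))
      (fun V => ObjectProperty.hom_ext _ (shiftMul_unit hs V.obj))⟩, ⟨rfl⟩, ⟨fun _ _ => rfl⟩⟩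

/-- For `θ_z` the relevant scalar is `ω(b+z,a)`, which depends only on `b + z`, and `b + y = (b + (y
- x)) + x`. Thus all the `θ_z` give equivalent module categories if twists are disregarded. -/
theorem shiftCompatible_twist (x y : G) : ShiftCompatible (χ.twist x) (χ.twist y) (y - x) := by
  have h : ∀ a b z, χ b a * VecTwist.coeff (χ.twist z) a b = χ.omega (b + z) a := by
    intro a b z
    rw [VecTwist.coeff, VecTwist.scalar_twist, χ.omega_add_left,
      show χ.omega b a = χ b a * χ a b from rfl, mul_right_comm (χ.theta a),
      mul_inv_cancel, one_mul, mul_comm (χ.omega z a), ← mul_assoc]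
  intro a b
  rw [h, h, add_assoc, sub_add_cancel]

/-- Since `θ_z(g) = θ(g+z)/θ(z)`, the shift by `y - x` matches the numerators, and the denominators
agree by hypothesis. This is where `θ(x) = θ(y)` enters. -/
theorem shiftInvariant_twist {x y : G} (hxy : χ.theta x = χ.theta y) :
    ShiftInvariant (χ.twist x) (χ.twist y) (y - x) := by
  have h : ∀ g z, VecTwist.scalar (χ.twist z) g * χ.theta z = χ.theta (g + z) := by
    intro g z
    rw [VecTwist.scalar_twist, χ.theta_add, χ.omega_comm z, mul_right_comm]
  intro g
  refine mul_right_cancel (b := χ.theta x) ?_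
  rw [h, add_assoc, sub_add_cancel, hxy, h]

theorem sameTheory_twist {x y : G} (hxy : χ.theta x = χ.theta y) :
    SameTheory (χ.twist x) (χ.twist y) :=
  ⟨hochschildEquivalent_of_shift (shiftCompatible_twist x y) (shiftInvariant_twist hxy),
    cyclicEquivalent_of_shift (shiftCompatible_twist x y) (shiftInvariant_twist hxy)⟩

end TwistMod

end BraidedVec

end

theorem mainTheorem2 {k : Type u} [Field k] [CharZero k] {G : Type u} [AddCommGroup G] [Finite G]
    (χ : Bicharacter k G) (hχ : χ.IsNondegenerate) :
    (∃ e : HH χ ≌ Mat k (Fin (Nat.card G)),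
      Nonempty e.functor.Monoidal ∧ e.functor.Additive ∧ e.functor.Linear k) ∧
    (∃ e : HC χ ≌ (∀ i : Set.range χ.theta, Mat k (Fin (Nat.card {x : G // χ.theta x = i}))),
      Nonempty e.functor.Monoidal ∧ e.functor.Additive ∧ e.functor.Linear k) ∧
    (∀ t : VecTwist χ, ∃ x : G, t = χ.twist x) ∧
    (∀ x y : G, χ.theta x = χ.theta y → SameTheory (χ.twist x) (χ.twist y)) := by
  have := Fintype.ofFinite G
  exact ⟨HH.exists_equivalence_mat hχ, HH.exists_equivalence_pi_mat hχ,
    VecTwist.exists_eq_twist hχ, fun _ _ h => TwistMod.sameTheory_twist h⟩
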